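/- Let $V$ be a finite-dimensional positive definite quadratic space over $\mathbb{Q}$ with symmetric bilinear form $B$, and put $Q(x)=B(x,x)$. Let $L$ be a lattice on $V$ of odd rank $k\ge 3$ with $B(L,L)\subseteq\mathbb{Z}$. Let $A=(B(e_i,e_j))$ be the Gram matrix of a basis of $L$, let $d_L=\det A$ be the discriminant of $L$, and let the level $N_L$ be the smallest positive integer $N$ such that $NA^{-1}$ has integral entries. Let $a$ be a positive integer and $\nu\in L$ such that $a$ is the smallest positive integer $c$ with $c\nu\in aL$. For $\mu\in L$ and rational $t$ put $r(t,aL+\mu)=|\{x\in aL+\mu: Q(x)=t\}|$ (so $r(t,aL+\mu)=0$ if $t\notin\mathbb{Z}$), and let $\Theta_{aL+\nu}(z)=\sum_{x\in aL+\nu}q^{Q(x)}$ with $q=e^{2\pi i z}$, $\operatorname{Im} z>0$. All symbols $\left(\frac{\cdot}{\cdot}\right)$ are Kronecker symbols. Put $N=4N_La^2$ and $\psi(m)=\left(\frac{4d_L}{m}\right)$. For a congruence subgroup $\Gamma\subseteq\Gamma_0(4)$ let $M_{k/2}(\Gamma,\chi)$ be the space of holomorphic modular forms of weight $k/2$ on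 $\Gamma$ with character $\chi$, that is, of holomorphic functions $f$ on the upper half plane with $\left(\frac{c}{d}\right)\varepsilon_d^{k}(cz+d)^{-k/2}f(\gamma z)=\chi(d)f(z)$ for all $\gamma=\left(\begin{smallmatrix}*&*\\c&d\end{smallmatrix}\right)\in\Gamma$ that have at most polynomial growth in $\operatorname{Im} z$ at every cusp; here $\varepsilon_d=1$ if $d\equiv1\pmod 4$ and $\varepsilon_d=i$ if $d\equiv 3\pmod 4$. For a character $\chi$ of $(\mathbb{Z}/N\mathbb{Z})^\times$ and a prime $p$, let $T^{N}_{k/2,\chi}(p^2)$ be Shimura's Hecke operator on $M_{k/2}(\Gamma_0(N),\chi)$, given by the double coset of $\left(\left(\begin{smallmatrix}1&0\\0&p^2\end{smallmatrix}\right),p^{1/2}\right)$ with respect to the lift of $\Gamma_1(N)$ to Shimura's covering group and normalized by the factor $p^{k/2-2}$. Then $\Theta_{aL+\nu}\in M_{k/2}(\Gamma_0(N)\cap\Gamma_1(a),\psi)$, and $\Theta_{aL+\nu}=\sum_\chi f_\chi$ for unique $f_\chi\in M_{k/2}(\Gamma_0(N),\chi\psi)$, where $\chi$ runs over the Dirichlet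 characters modulo $a$. For a prime $p$ let $T(p^2)=\bigoplus_\chi T^{N}_{k/2,\chi\psi}(p^2)$, so that $\Theta_{aL+\nu}|T(p^2)=\sum_\chi f_\chi|T^{N}_{k/2,\chi\psi}(p^2)$, and write $(\Theta_{aL+\nu}|T(p^2))(z)=\sum_{n\ge0}b(n)q^n$. For every integer $n\ge 0$: 1. if $p\mid 4N_La^2$, then $b(n)=r(p^2n,aL+\nu)$; 2. if $p\nmid 4N_La^2$, then for every integer $\bar p$ with $p\bar p\equiv 1\pmod a$, $$b(n)=r(p^2n,aL+\nu)+\left(\frac{-1}{p}\right)^{\lambda}\left(\frac{4d_Ln}{p}\right)p^{\lambda-1}\,r(n,aL+\bar p\nu)+\left(\frac{4d_L}{p^2}\right)p^{k-2}\,r(n/p^2,aL+\bar p^2\nu),$$ where $\lambda=(k-1)/2$. -/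

import Mathlib

open UpperHalfPlane Matrix.SpecialLinearGroup
open scoped MatrixGroups Manifold

namespace LatticeCosetHecke

noncomputable section

/-! ### The Kronecker symbol -/

/-- The Kronecker symbol `(a / b)` for integers `a`, `b`: the completely multiplicative extension
in `b` of the Legendre symbol, with `(a / -1) = -1` exactly if `a < 0`, with
`(a / 2) = 0, 1, -1` according as `a` is even, `a ≡ ±1` or `a ≡ ±3` modulo `8`, and with
`(a / 0) = 1` if `a = ±1` and `0` otherwise. -/
def kronecker (a b : ℤ) : ℤ :=
  if b = 0 then (if a.natAbs = 1 then 1 else 0)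
  else (if a < 0 ∧ b < 0 then -1 else 1) * (ZMod.χ₈ (a : ZMod 8)) ^ (b.natAbs.factorization 2) *
    jacobiSym a (b.natAbs / 2 ^ (b.natAbs.factorization 2))

/-! ### Lattices and lattice cosets -/

section Lattice

variable {V : Type*} [AddCommGroup V] [Module ℚ V]

/-- The lattice `L` is integral: `B(L, L) ⊆ ℤ`. -/
def IsIntegralLattice (B : LinearMap.BilinForm ℚ V) (L : Submodule ℤ V) : Prop :=
  ∀ x ∈ L, ∀ y ∈ L, ∃ m : ℤ, B x y = m

/-- The Gram matrix `(B(e_i, e_j))` of a basis of an integral lattice, as an integer matrix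
(an integral rational number equals its numerator). -/
def gram (B : LinearMap.BilinForm ℚ V) {L : Submodule ℤ V} {k : ℕ}
    (e : Module.Basis (Fin k) ℤ L) : Matrix (Fin k) (Fin k) ℤ :=
  Matrix.of fun i j => (B (e i : V) (e j : V)).num

/-- The discriminant `d_L` of an integral lattice. -/
def discr (B : LinearMap.BilinForm ℚ V) {L : Submodule ℤ V} {k : ℕ}
    (e : Module.Basis (Fin k) ℤ L) : ℤ :=
  (gram B e).det

/-- The level `N_L` of an integral lattice: the smallest positive integer `N` such that `N A⁻¹`
has integral coefficients, `A` being the Gram matrix. -/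
def level (B : LinearMap.BilinForm ℚ V) {L : Submodule ℤ V} {k : ℕ}
    (e : Module.Basis (Fin k) ℤ L) : ℕ :=
  sInf {N : ℕ | 0 < N ∧ ∃ C : Matrix (Fin k) (Fin k) ℤ,
    (N : ℚ) • ((gram B e).map (Int.cast : ℤ → ℚ))⁻¹ = C.map (Int.cast : ℤ → ℚ)}

/-- The lattice coset `aL + ν`. -/
def latticeCoset (L : Submodule ℤ V) (a : ℕ) (ν : V) : Set V :=
  {x | ∃ y ∈ L, x = a • y + ν}

/-- `aL + ν` has conductor `c`: `c` is the smallest positive integer with `c ν ∈ aL`. -/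
def HasConductor (L : Submodule ℤ V) (a : ℕ) (ν : V) (c : ℕ) : Prop :=
  IsLeast {m : ℕ | 0 < m ∧ m • ν ∈ latticeCoset L a 0} c

/-- `r(t, S) = |{x ∈ S : Q(x) = t}|`, where `Q(x) = B(x, x)` and `t` is rational. -/
def repNum (B : LinearMap.BilinForm ℚ V) (S : Set V) (t : ℚ) : ℕ :=
  {x ∈ S | B x x = t}.ncard

/-- The theta series `Θ_S(z) = ∑_{x ∈ S} e^{2πi Q(x) z}`. -/
def theta (B : LinearMap.BilinForm ℚ V) (S : Set V) (z : ℍ) : ℂ :=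
  ∑' x : S, Complex.exp (2 * Real.pi * Complex.I * ((B (x : V) (x : V) : ℚ) : ℂ) * (z : ℂ))

end Lattice

/-! ### Modular forms of half-integral weight -/

/-- `ε_d = 1` if `d ≡ 1 (mod 4)` and `ε_d = i` if `d ≡ 3 (mod 4)` (used for odd `d` only). -/
def epsilon (d : ℤ) : ℂ := if d % 4 = 1 then 1 else Complex.I

/-- Shimura's factor of automorphy `j(γ, z) = ε_d⁻¹ (c / d) (cz + d)^{1/2}` of weight `1/2`
for `γ = (a, b; c, d) ∈ Γ₀(4)`, with the principal branch of the square root. -/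
def autFactor (γ : SL(2, ℤ)) (z : ℍ) : ℂ :=
  (epsilon (γ 1 1))⁻¹ * (kronecker (γ 1 0) (γ 1 1) : ℂ) *
    (((γ 1 0 : ℤ) : ℂ) * (z : ℂ) + ((γ 1 1 : ℤ) : ℂ)) ^ (1 / 2 : ℂ)

/-- Pairs `(α, φ)` of a matrix acting on the upper half plane and a function on it. All pairs that
occur below lie in Shimura's group, i.e. `det α > 0` and `φ(z)² = t (det α)^{-1/2} (cz + d)` with
`|t| = 1`. -/
abbrev Pair : Type := GL (Fin 2) ℝ × (ℍ → ℂ)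

/-- The composition law `(α, φ(z)) (β, ψ(z)) = (αβ, φ(βz) ψ(z))`. -/
def Pair.comp (x y : Pair) : Pair := (x.1 * y.1, fun z => x.2 (y.1 • z) * y.2 z)

/-- The slash operator of weight `k/2`: `(f|[(α, φ)]_k)(z) = f(αz) φ(z)^{-k}`. -/
def slash (k : ℕ) (f : ℍ → ℂ) (x : Pair) (z : ℍ) : ℂ := f (x.1 • z) * (x.2 z ^ k)⁻¹

/-- The lift `γ* = (γ, j(γ, z))`. For odd `k`, `(f|[γ*]_k)(z) =
(c / d) ε_d^k (cz + d)^{-k/2} f(γz)`. -/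
def lift (γ : SL(2, ℤ)) : Pair := (mapGL ℝ γ, autFactor γ)

/-- `f` is a holomorphic modular form of weight `k/2` (`k` odd) on `Γ ⊆ Γ₀(4)` with character `χ`,
a function of the lower right entry: it transforms like one, it is holomorphic on the upper half
plane and it has at most polynomial growth in `y = Im z` at every cusp `γ(i∞)`. -/
structure IsModularForm (k : ℕ) (Γ : Subgroup SL(2, ℤ)) (χ : ℤ → ℂ) (f : ℍ → ℂ) : Prop where
  slash_eq : ∀ γ ∈ Γ, ∀ z : ℍ, slash k f (lift γ) z = χ (γ 1 1) * f z
  holo : MDifferentiable 𝓘(ℂ) 𝓘(ℂ) f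
  growth : ∀ γ : SL(2, ℤ), ∃ m : ℕ,
    (fun z : ℍ => (((γ 1 0 : ℤ) : ℂ) * (z : ℂ) + ((γ 1 1 : ℤ) : ℂ)) ^ (-(k : ℂ) / 2) * f (γ • z))
      =O[atImInfty] (fun z : ℍ => z.im ^ m)

/-! ### Hecke operators -/

/-- `ξ_m = (diag(1, m), m^{1/4})`. -/
def xi (m : ℕ) [NeZero m] : Pair :=
  (Matrix.GeneralLinearGroup.mkOfDetNeZero !![(1 : ℝ), 0; 0, (m : ℝ)]
    (by simp [Matrix.det_fin_two, NeZero.ne m]),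
   fun _ => (((m : ℝ) ^ (1 / 4 : ℝ) : ℝ) : ℂ))

/-- The double coset `Δ₁ ξ_m Δ₁`, where `Δ₁ = {γ* : γ ∈ Γ₁(N)}`. -/
def doubleCoset (N m : ℕ) [NeZero m] : Set Pair :=
  {x | ∃ γ ∈ CongruenceSubgroup.Gamma1 N, ∃ γ' ∈ CongruenceSubgroup.Gamma1 N,
    x = ((lift γ).comp (xi m)).comp (lift γ')}

/-- The set of the cosets `Δ₁ x` contained in the double coset `Δ₁ ξ_m Δ₁`. -/
def cosetSpace (N m : ℕ) [NeZero m] : Set (Set Pair) :=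
  {C | ∃ x ∈ doubleCoset N m,
    C = {y | ∃ γ ∈ CongruenceSubgroup.Gamma1 N, y = (lift γ).comp x}}

/-- Shimura's Hecke operator of weight `k/2` and level `N` (`4 ∣ N`), given by the double coset:
`f ↦ det(ξ_m)^{k/4 - 1} ∑_x f|[x]_k`, where `x` runs over representatives of
`Δ₁ \ Δ₁ ξ_m Δ₁`. Its restriction to the forms on `Γ₀(N)` with character `χ` is the operator
`T^N_{k, χ}(m)`. -/
def shimuraHecke (k N m : ℕ) [NeZero m] (f : ℍ → ℂ) (z : ℍ) : ℂ :=
  (((m : ℝ) ^ ((k : ℝ) / 4 - 1) : ℝ) : ℂ) *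
    ∑ᶠ C : cosetSpace N m, slash k f C.2.choose z

/-- `f = ∑_χ F_χ`, where `χ` runs over the Dirichlet characters modulo `M` and `F_χ` is a modular
form of weight `k/2` on `Γ₀(N)` with character `χψ`. -/
def IsCharDecomp (k N M : ℕ) (ψ : ℤ → ℂ) (f : ℍ → ℂ) (F : DirichletCharacter ℂ M → ℍ → ℂ) :
    Prop :=
  (∀ χ : DirichletCharacter ℂ M,
    IsModularForm k (CongruenceSubgroup.Gamma0 N) (fun d => χ (d : ZMod M) * ψ d) (F χ)) ∧
  ∀ z : ℍ, f z = ∑ᶠ χ : DirichletCharacter ℂ M, F χ z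

open Classical in
/-- The Hecke operator `T(m) = ⨁_χ T^N_{k, χψ}(m)` on
`M_{k/2}(Γ₀(N) ∩ Γ₁(M), ψ) = ⨁_χ M_{k/2}(Γ₀(N), χψ)`, with `χ` running over the Dirichlet
characters modulo `M`; functions outside this sum are sent to `0`. -/
def hecke (k N M : ℕ) (ψ : ℤ → ℂ) (m : ℕ) [NeZero m] (f : ℍ → ℂ) (z : ℍ) : ℂ :=
  if h : ∃ F, IsCharDecomp k N M ψ f F then
    ∑ᶠ χ : DirichletCharacter ℂ M, shimuraHecke k N m (h.choose χ) z
  else 0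

end

end LatticeCosetHecke

open LatticeCosetHecke

open LatticeCosetHecke
open scoped NumberTheorySymbols

namespace LatticeCosetHecke

/-! ### Periodicity of the Kronecker symbol -/

/-! The proof has two halves: a transformation law that permutes the theta series of the cosets `aL
+ uν`, and an explicit evaluation of the double coset operator on the character components of this
family.

Transformation law. In coordinates `Θ_{aL+ν}` is a Gaussian sum over integral vectors. For a matrix
`γ` in `Γ₀(N)` with lower right entry `D > 0`, one splits the sum into classes modulo `D`, applies
Poisson summation to each class, completes the square modulo `D` and applies Poisson summation
backwards. This turns `Θ_{aL+Dν}(γz)` into `Θ_{aL+ν}(z)` times a `k`-dimensional quadratic Gauss sum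
and the `k`-th power of a square root (`ThetaDatum.thetaVec_smul`). If `D` is a prime `p`,
diagonalizing the form modulo `p` writes the Gauss sum as a Legendre symbol of the determinant times
the `k`-th power of a one-variable Gauss sum (`quadGaussSum_eq`). That one-variable sum is found by
applying the same law to `∑ e(n²z)` and comparing with `thetaZ_smul`, the classical law with
Shimura's factor, which is proved by Euclidean descent in `Γ₀(4)`. A general `γ` reduces to a prime
lower right entry by a translation and Dirichlet's theorem on primes in progressions. The result is
`theta_smul`: `γ` carries `aL + ν` to `aL + dν`, with Shimura's factor to the power `k` and the
character `(4d_L/d)`.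

Characters. Fourier analysis on `(ℤ/a)ˣ` therefore splits `Θ_{aL+ν}` into forms with characters
`χψ`. Linear independence of characters makes the decomposition unique (`ThetaFamily.unique`), so
the Hecke operator can be computed on the explicit components.

Hecke operator. The right factors in the double coset may be taken to be the translations modulo
`p²` and, if `p ∤ N`, also `p` matrices `(px, y; N, 1)`. The translations extract the coefficients
at `p²n`. After `diag(1, p²)` is put in front, each of the other matrices equals an element of
`Γ₀(N)` followed by `z ↦ z - j/p` with `j ≠ 0`, or by `z ↦ p²z`. The element of `Γ₀(N)` contributes
`χ(p)` or `χ(p)²`, and summing `χ(u) f_χ` over `χ` gives the theta series of the coset of `u⁻¹ν`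
(`sum_mul_charComponent`); this is how `p̄ν` and `p̄²ν` arise. The sum over `j` is again a quadratic
Gauss sum and produces `(n/p)`; its value `√p ε_p` combines with `ε_p⁻ᵏ` to `(-1/p)^λ`. -/

theorem kronecker_of_odd (c : ℤ) {d : ℤ} (hd : Odd d) :
    kronecker c d = (if c < 0 ∧ d < 0 then -1 else 1) * J(c | d.natAbs) := by
  have h0 : d ≠ 0 := by rintro rfl; simp at hd
  have h2 : d.natAbs.factorization 2 = 0 := by
    apply Nat.factorization_eq_zero_of_not_dvd
    rw [← even_iff_two_dvd, Nat.not_even_iff_odd]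
    exact Int.natAbs_odd.mpr hd
  simp [kronecker, h0, h2]

/-- For positive `a` the character `n ↦ (a/n)` modulo `4a` is even. By multiplicativity in `a` it
suffices to treat primes: at `2` the symbol is the even character `χ₈`, and at an odd prime the sign
of `-1` cancels against the sign of quadratic reciprocity. This covers moduli of opposite sign,
where absolute values satisfy a congruence for their sum. -/
theorem jacobiSym_eq_of_dvd_add : ∀ {a : ℕ}, a ≠ 0 → ∀ {e n : ℕ}, Odd e → Odd n → 4 * a ∣ e + n →
    J(a | n) = J(a | e) := by
  intro a
  induction a using induction_on_primes with
  | zero => simp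
  | one => simp [jacobiSym.one_left]
  | prime_mul p a hp ih =>
    intro hpa e n he hn h
    have ha : a ≠ 0 := by rintro rfl; simp at hpa
    have h1 : J(a | n) = J(a | e) := ih ha he hn (dvd_trans ⟨p, by ring⟩ h)
    have h2 : 4 * p ∣ e + n := dvd_trans ⟨a, by ring⟩ h
    push_cast
    rw [jacobiSym.mul_left, jacobiSym.mul_left, h1]
    congr 1
    rcases hp.eq_two_or_odd' with rfl | hodd
    · push_cast
      rw [jacobiSym.at_two hn, jacobiSym.at_two he]
      have : (n : ZMod 8) = -(e : ZMod 8) := by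
        rw [eq_neg_iff_add_eq_zero, add_comm]
        exact_mod_cast (ZMod.natCast_eq_zero_iff (e + n) 8).mpr h2
      rw [this]
      generalize (e : ZMod 8) = x
      revert x; decide
    · have h3 : J((n : ℤ) | p) = ZMod.χ₄ p * J((e : ℤ) | p) := by
        rw [← jacobiSym.neg _ hodd]
        apply jacobiSym.mod_left'
        refine Int.ModEq.symm (n := p) ?_
        rw [Int.modEq_iff_dvd, sub_neg_eq_add, add_comm]
        exact_mod_cast dvd_trans ⟨4, by ring⟩ h2
      have h4 : (e + n) % 4 = 0 := Nat.mod_eq_zero_of_dvd (dvd_trans ⟨p, rfl⟩ h2)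
      rcases Nat.odd_mod_four_iff.mp (Nat.odd_iff.mp hodd) with h | h
      · rw [jacobiSym.quadratic_reciprocity_one_mod_four h hn,
          jacobiSym.quadratic_reciprocity_one_mod_four h he, h3, ZMod.χ₄_nat_one_mod_four h, one_mul]
      · rw [ZMod.χ₄_nat_three_mod_four h] at h3
        rcases Nat.odd_mod_four_iff.mp (Nat.odd_iff.mp he) with h' | h'
        · rw [jacobiSym.quadratic_reciprocity_one_mod_four' hodd h',
            jacobiSym.quadratic_reciprocity_three_mod_four h (by omega), h3]; ring
        · rw [jacobiSym.quadratic_reciprocity_one_mod_four' hodd (b := n) (by omega),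
            jacobiSym.quadratic_reciprocity_three_mod_four h h', h3]; ring

theorem χ₄_eq_neg_of_dvd_add {e n : ℕ} (h : 4 ∣ e + n) : ZMod.χ₄ e = -ZMod.χ₄ n := by
  have : (n : ZMod 4) = -(e : ZMod 4) := by
    rw [eq_neg_iff_add_eq_zero, add_comm]
    exact_mod_cast (ZMod.natCast_eq_zero_iff (e + n) 4).mpr h
  rw [this]
  generalize (e : ZMod 4) = x
  revert x; decide

theorem jacobiSym_eq_sign_mul (s : ℤ) {n : ℕ} (hn : Odd n) :
    J(s | n) = (if s < 0 then ZMod.χ₄ n else 1) * J(s.natAbs | n) := by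
  split_ifs with h
  · rw [← jacobiSym.neg _ hn]; congr 1; omega
  · rw [one_mul]; congr 1; omega

theorem jacobiSym_four_mul (s : ℤ) {n : ℕ} (hn : Odd n) : J(4 * s | n) = J(s | n) := by
  rw [jacobiSym.mul_left, jacobiSym.at_four hn, one_mul]

/-- With `c = 4s`, the factor `4` is harmless and the sign of `s` contributes `χ₄`. If `d` and `d'`
have opposite signs and `s < 0`, then `χ₄` of the absolute value changes sign, and so does the sign
convention of the Kronecker symbol; the two changes cancel. -/
theorem kronecker_eq_of_dvd_sub {c d d' : ℤ} (hc : c ≠ 0) (h4 : 4 ∣ c) (hd : Odd d)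
    (h : c ∣ d - d') : kronecker c d = kronecker c d' := by
  obtain ⟨s, rfl⟩ := h4
  have hd' : Odd d' := by
    have : Even (d - d') := (even_iff_two_dvd.mpr (dvd_trans ⟨2 * s, by ring⟩ h))
    rcases Int.even_or_odd d' with h' | h'
    · exact absurd ((Int.even_sub.mp this).mpr h') (Int.not_even_iff_odd.mpr hd)
    · exact h'
  have hs : s ≠ 0 := by rintro rfl; simp at hc
  have hn := Int.natAbs_odd.mpr hd
  have hn' := Int.natAbs_odd.mpr hd'
  rw [kronecker_of_odd _ hd, kronecker_of_odd _ hd', jacobiSym_four_mul _ hn,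
    jacobiSym_four_mul _ hn', jacobiSym_eq_sign_mul s hn, jacobiSym_eq_sign_mul s hn']
  have hd0 : d ≠ 0 := by rintro rfl; simp at hd
  have hd0' : d' ≠ 0 := by rintro rfl; simp at hd'
  have h4s : (4 * s < 0) ↔ s < 0 := by omega
  simp only [h4s]
  -- Jacobi symbols see only absolute values: the congruence becomes one for their difference or for
  -- their sum, according as the signs agree or not.
  have key : ((d < 0 ↔ d' < 0) → ((4 * s.natAbs : ℕ) : ℤ) ∣ d.natAbs - d'.natAbs) ∧
      (¬(d < 0 ↔ d' < 0) → ((4 * s.natAbs : ℕ) : ℤ) ∣ d.natAbs + d'.natAbs) := by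
    have h' : ((4 * s.natAbs : ℕ) : ℤ) ∣ d - d' := by
      have : ((4 * s.natAbs : ℕ) : ℤ) = |4 * s| := by rw [abs_mul]; push_cast; simp
      rw [this, abs_dvd]; exact h
    constructor
    · intro hh
      rcases lt_or_gt_of_ne hd0 with h1 | h1
      · have h2 := hh.mp h1
        rw [show ((d.natAbs : ℤ) - d'.natAbs) = -(d - d') by omega]
        exact (dvd_neg.mpr h')
      · rw [show ((d.natAbs : ℤ) - d'.natAbs) = (d - d') by omega]
        exact h'
    · intro hh
      rcases lt_or_gt_of_ne hd0 with h1 | h1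
      · rw [show ((d.natAbs : ℤ) + d'.natAbs) = -(d - d') by omega]
        exact (dvd_neg.mpr h')
      · rw [show ((d.natAbs : ℤ) + d'.natAbs) = (d - d') by omega]
        exact h'
  by_cases hh : d < 0 ↔ d' < 0
  · have h1 := key.1 hh
    have h2 : d'.natAbs ≡ d.natAbs [MOD 4 * s.natAbs] := (Nat.modEq_iff_dvd).mpr h1
    have h3 : J(s.natAbs | d.natAbs) = J(s.natAbs | d'.natAbs) := by
      rw [jacobiSym.mod_right' _ hn, jacobiSym.mod_right' _ hn', h2]
    have h4 : ZMod.χ₄ d.natAbs = ZMod.χ₄ d'.natAbs := by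
      rw [ZMod.χ₄_nat_mod_four, ZMod.χ₄_nat_mod_four d'.natAbs]
      rw [show d.natAbs % 4 = d'.natAbs % 4 from (h2.symm.of_mul_right _)]
    simp only [h3, h4, hh]
  · have h1 : 4 * s.natAbs ∣ d.natAbs + d'.natAbs := by exact_mod_cast key.2 hh
    have h3 : J(s.natAbs | d.natAbs) = J(s.natAbs | d'.natAbs) :=
      (jacobiSym_eq_of_dvd_add (by omega) hn hn' h1).symm
    have h4 : ZMod.χ₄ d.natAbs = -ZMod.χ₄ d'.natAbs :=
      χ₄_eq_neg_of_dvd_add (dvd_trans ⟨_, rfl⟩ h1)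
    rw [h3, h4]
    rcases lt_or_gt_of_ne hd0 with h5 | h5 <;> rcases lt_or_gt_of_ne hd0' with h6 | h6
    · simp [h5, h6] at hh
    · by_cases hs' : s < 0 <;> simp [h5, hs', not_lt.mpr h6.le]
    · by_cases hs' : s < 0 <;> simp [h6, hs', not_lt.mpr h5.le]
    · simp [not_lt.mpr h5.le, not_lt.mpr h6.le] at hh

theorem kronecker_natCast_right (c : ℤ) {n : ℕ} (hn : Odd n) : kronecker c n = J(c | n) := by
  rw [kronecker_of_odd c (by exact_mod_cast hn)]
  simp

/-! ### The factor of automorphy and the Jacobi theta function -/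

theorem log_mul_of_arg_add_mem {u v : ℂ} (hu : u ≠ 0) (hv : v ≠ 0)
    (h : u.arg + v.arg ∈ Set.Ioc (-Real.pi) Real.pi) :
    Complex.log (u * v) = Complex.log u + Complex.log v := by
  rw [← Complex.log_exp (x := Complex.log u + Complex.log v), Complex.exp_add, Complex.exp_log hu,
    Complex.exp_log hv]
  · simpa [Complex.log_im] using h.1
  · simpa [Complex.log_im] using h.2

theorem log_mul_of_pi_lt_arg_add {u v : ℂ} (hu : u ≠ 0) (hv : v ≠ 0)
    (h : Real.pi < u.arg + v.arg) :
    Complex.log (u * v) = Complex.log u + Complex.log v - 2 * Real.pi * Complex.I := by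
  have h1 := Complex.arg_le_pi u
  have h2 := Complex.arg_le_pi v
  rw [← Complex.log_exp (x := Complex.log u + Complex.log v - 2 * Real.pi * Complex.I),
    Complex.exp_sub, Complex.exp_two_pi_mul_I, div_one, Complex.exp_add, Complex.exp_log hu,
    Complex.exp_log hv]
  · simp [Complex.log_im]; linarith
  · simp [Complex.log_im]; linarith [Real.pi_pos]

theorem sqrt_mul_of_arg_add_mem {u v : ℂ} (hu : u ≠ 0) (hv : v ≠ 0)
    (h : u.arg + v.arg ∈ Set.Ioc (-Real.pi) Real.pi) :
    (u * v) ^ (1 / 2 : ℂ) = u ^ (1 / 2 : ℂ) * v ^ (1 / 2 : ℂ) := by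
  rw [Complex.cpow_def_of_ne_zero (mul_ne_zero hu hv), Complex.cpow_def_of_ne_zero hu,
    Complex.cpow_def_of_ne_zero hv, log_mul_of_arg_add_mem hu hv h, ← Complex.exp_add, add_mul]

/-- The principal logarithm of the product drops by `2πi` once the arguments add up to more than
`π`, and half of this is a sign. -/
theorem sqrt_mul_of_pi_lt_arg_add {u v : ℂ} (hu : u ≠ 0) (hv : v ≠ 0)
    (h : Real.pi < u.arg + v.arg) :
    (u * v) ^ (1 / 2 : ℂ) = -(u ^ (1 / 2 : ℂ) * v ^ (1 / 2 : ℂ)) := by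
  rw [Complex.cpow_def_of_ne_zero (mul_ne_zero hu hv), Complex.cpow_def_of_ne_zero hu,
    Complex.cpow_def_of_ne_zero hv, log_mul_of_pi_lt_arg_add hu hv h, ← Complex.exp_add,
    ← neg_one_mul, ← Complex.exp_pi_mul_I, ← Complex.exp_add]
  apply Complex.exp_eq_exp_iff_exists_int.mpr
  exact ⟨-1, by push_cast; ring⟩

theorem sqrt_sq (u : ℂ) : (u ^ (1 / 2 : ℂ)) ^ 2 = u := by
  rw [← Complex.cpow_nat_mul]; simp

/-- The generator `(1, 0; 4, 1)` of `Γ₀(4)`. -/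
def lowerFour : SL(2, ℤ) := ⟨!![1, 0; 4, 1], by simp⟩

theorem smul_coe (γ : SL(2, ℤ)) (z : ℍ) :
    ((γ • z : ℍ) : ℂ) = ((γ 0 0 : ℤ) * (z : ℂ) + (γ 0 1 : ℤ)) / ((γ 1 0 : ℤ) * (z : ℂ) + (γ 1 1 : ℤ)) := by
  rw [UpperHalfPlane.coe_specialLinearGroup_apply]; simp

theorem coprime_row (γ : SL(2, ℤ)) : IsCoprime (γ 1 0) (γ 1 1) :=
  ⟨-γ 0 1, γ 0 0, by have := Matrix.det_fin_two γ.1; rw [γ.2] at this; linarith⟩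

theorem det_eq (γ : SL(2, ℤ)) : γ 0 0 * γ 1 1 - γ 0 1 * γ 1 0 = 1 := by
  have := Matrix.det_fin_two γ.1; rw [γ.2] at this; linarith

theorem row_ne_zero (γ : SL(2, ℤ)) (z : ℍ) : ((γ 1 0 : ℤ) * (z : ℂ) + (γ 1 1 : ℤ)) ≠ 0 := by
  intro h
  have h1 := congrArg Complex.im h
  have h2 := congrArg Complex.re h
  simp [z.im_ne_zero] at h1
  simp [h1] at h2
  have := coprime_row γ
  rw [h1, h2] at this
  exact not_isCoprime_zero_zero this

theorem odd_of_four_dvd {γ : SL(2, ℤ)} (h : 4 ∣ γ 1 0) : Odd (γ 1 1) := by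
  have h1 := coprime_row γ
  rcases Int.even_or_odd (γ 1 1) with h' | h'
  · have h2 := h1.isUnit_of_dvd' (dvd_trans ⟨2, by norm_num⟩ h : (2 : ℤ) ∣ _) (even_iff_two_dvd.mp h')
    rw [Int.isUnit_iff] at h2; omega
  · exact h'

theorem T_smul_coe (z : ℍ) : ((ModularGroup.T • z : ℍ) : ℂ) = z + 1 := by
  rw [smul_coe]; simp [ModularGroup.T]

theorem lowerFour_smul_coe (z : ℍ) : ((lowerFour • z : ℍ) : ℂ) = z / (4 * z + 1) := by
  rw [smul_coe]; simp [lowerFour]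

theorem four_mul_add_one_ne_zero (z : ℍ) : 4 * (z : ℂ) + 1 ≠ 0 := by
  have := row_ne_zero lowerFour z
  simpa [lowerFour] using this

theorem mul_entry (γ δ : SL(2, ℤ)) (i j : Fin 2) :
    (γ * δ) i j = γ i 0 * δ 0 j + γ i 1 * δ 1 j := by
  rw [Matrix.SpecialLinearGroup.coe_mul, Matrix.mul_apply, Fin.sum_univ_two]

theorem mul_T_row (γ : SL(2, ℤ)) : (γ * ModularGroup.T) 1 0 = γ 1 0 ∧
    (γ * ModularGroup.T) 1 1 = γ 1 0 + γ 1 1 := by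
  rw [mul_entry, mul_entry]; simp [ModularGroup.T]

theorem mul_lowerFour_row (γ : SL(2, ℤ)) : (γ * lowerFour) 1 0 = γ 1 0 + 4 * γ 1 1 ∧
    (γ * lowerFour) 1 1 = γ 1 1 := by
  rw [mul_entry, mul_entry]; simp [lowerFour]; ring

/-- Passing from `d` to `c + d` preserves `d` modulo `4` and the symbol `(c/d)`, which has period
`c` in `d`, while `cz + (c + d) = c(z + 1) + d`. No branch changes. -/
theorem autFactor_mul_T {γ : SL(2, ℤ)} (h : 4 ∣ γ 1 0) (z : ℍ) :
    autFactor (γ * ModularGroup.T) z = autFactor γ (ModularGroup.T • z) := by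
  have ho := odd_of_four_dvd h
  unfold autFactor
  rw [(mul_T_row γ).1, (mul_T_row γ).2, T_smul_coe]
  have h1 : epsilon (γ 1 0 + γ 1 1) = epsilon (γ 1 1) := by
    unfold epsilon
    congr 2
    omega
  have h2 : kronecker (γ 1 0) (γ 1 0 + γ 1 1) = kronecker (γ 1 0) (γ 1 1) := by
    by_cases hc : γ 1 0 = 0
    · rw [hc, zero_add]
    · exact (kronecker_eq_of_dvd_sub hc h ho (by simp)).symm
  rw [h1, h2]
  congr 2
  push_cast; ring

/-- The Jacobi symbol depends on `c` modulo `d` only, so all that can change is the sign convention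
for two negative arguments. The resulting sign is exactly the one that compensates the jump of the
principal square root in `autFactor_mul_lowerFour`. -/
theorem kronecker_add_four_mul {c d : ℤ} (hd : Odd d) : kronecker (c + 4 * d) d =
    (if d < 0 ∧ ¬(c < 0 ↔ c + 4 * d < 0) then -1 else 1) * kronecker c d := by
  rw [kronecker_of_odd _ hd, kronecker_of_odd _ hd, ← mul_assoc]
  congr 1
  · by_cases h1 : c < 0 <;> by_cases h2 : c + 4 * d < 0 <;> by_cases h3 : d < 0 <;>
      simp [h1, h2, h3]
  · apply jacobiSym.mod_left'
    refine Int.ModEq.symm (n := d.natAbs) ?_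
    rw [Int.modEq_iff_dvd, Int.natAbs_dvd]
    exact ⟨4, by ring⟩

theorem lin_arg_pos {c d : ℝ} {z : ℍ} (hc : 0 < c) :
    0 < (c * (z : ℂ) + d).arg ∧ (c * (z : ℂ) + d).arg < Real.pi := by
  have h : 0 < (c * (z : ℂ) + d).im := by
    simpa using mul_pos hc z.im_pos
  constructor
  · rcases lt_or_eq_of_le (Complex.arg_nonneg_iff.mpr h.le) with h1 | h1
    · exact h1
    · have := (Complex.arg_eq_zero_iff.mp h1.symm).2; linarith
  · rcases lt_or_eq_of_le (Complex.arg_le_pi (c * (z : ℂ) + d)) with h1 | h1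
    · exact h1
    · have := (Complex.arg_eq_pi_iff.mp h1).2; linarith

theorem lin_arg_neg {c d : ℝ} {z : ℍ} (hc : c < 0) : (c * (z : ℂ) + d).arg < 0 := by
  have h : (c * (z : ℂ) + d).im < 0 := by
    simpa using mul_neg_of_neg_of_pos hc z.im_pos
  exact Complex.arg_neg_iff.mpr h

/-- Write the new linear form as `uv` with `v = 4z + 1` and `u` the old form at the moved point. The
arguments of `u` and `v` exceed `π` in sum exactly if `c ≥ 0 > c + 4d`, because the signs of the
lower left entries decide in which half plane `u` and `uv` lie. This is also when the Kronecker
symbol changes sign. -/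
theorem autFactor_mul_lowerFour {γ : SL(2, ℤ)} (h : 4 ∣ γ 1 0) (z : ℍ) :
    autFactor (γ * lowerFour) z =
      autFactor γ (lowerFour • z) * (4 * (z : ℂ) + 1) ^ (1 / 2 : ℂ) := by
  have ho := odd_of_four_dvd h
  unfold autFactor
  rw [(mul_lowerFour_row γ).1, (mul_lowerFour_row γ).2, kronecker_add_four_mul ho]
  have hu0 := row_ne_zero γ (lowerFour • z)
  set u := ((γ 1 0 : ℤ) : ℂ) * ((lowerFour • z : ℍ) : ℂ) + ((γ 1 1 : ℤ) : ℂ) with hu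
  have hv0 := four_mul_add_one_ne_zero z
  set v := 4 * (z : ℂ) + 1 with hv
  have hw : ((γ 1 0 + 4 * γ 1 1 : ℤ) : ℂ) * z + (γ 1 1 : ℤ) = u * v := by
    rw [hu, lowerFour_smul_coe, ← hv]
    field_simp
    rw [hv]; push_cast; ring
  rw [hw]
  have hvarg : 0 < v.arg ∧ v.arg < Real.pi := by
    have := lin_arg_pos (c := 4) (d := 1) (z := z) (by norm_num)
    simpa [hv] using this
  have hu1 : 0 < γ 1 0 → 0 < u.arg ∧ u.arg < Real.pi := fun hc => by
    have := lin_arg_pos (c := γ 1 0) (d := γ 1 1) (z := lowerFour • z) (by exact_mod_cast hc)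
    simpa [hu] using this
  have hu2 : γ 1 0 < 0 → u.arg < 0 := fun hc => by
    have := lin_arg_neg (c := γ 1 0) (d := γ 1 1) (z := lowerFour • z) (by exact_mod_cast hc)
    simpa [hu] using this
  have hw1 : 0 < γ 1 0 + 4 * γ 1 1 → 0 < (u * v).arg := fun hc => by
    have := lin_arg_pos (c := (γ 1 0 + 4 * γ 1 1 : ℤ)) (d := γ 1 1) (z := z) (by exact_mod_cast hc)
    rw [← hw]; simpa using this.1
  have hw2 : γ 1 0 + 4 * γ 1 1 < 0 → (u * v).arg < 0 := fun hc => by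
    have := lin_arg_neg (c := (γ 1 0 + 4 * γ 1 1 : ℤ)) (d := γ 1 1) (z := z) (by exact_mod_cast hc)
    rw [← hw]; simpa using this
  have hlow := Complex.neg_pi_lt_arg u
  have hup := Complex.arg_le_pi u
  have hcase1 : u.arg + v.arg ≤ Real.pi →
      (u * v) ^ (1 / 2 : ℂ) = u ^ (1 / 2 : ℂ) * v ^ (1 / 2 : ℂ) ∧ (u * v).arg = u.arg + v.arg := by
    intro hle
    have hm : u.arg + v.arg ∈ Set.Ioc (-Real.pi) Real.pi := ⟨by linarith, hle⟩
    refine ⟨sqrt_mul_of_arg_add_mem hu0 hv0 hm, ?_⟩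
    have := congrArg Complex.im (log_mul_of_arg_add_mem hu0 hv0 hm)
    simpa [Complex.log_im] using this
  have hcase2 : Real.pi < u.arg + v.arg →
      (u * v) ^ (1 / 2 : ℂ) = -(u ^ (1 / 2 : ℂ) * v ^ (1 / 2 : ℂ)) ∧
        (u * v).arg = u.arg + v.arg - 2 * Real.pi := by
    intro hle
    refine ⟨sqrt_mul_of_pi_lt_arg_add hu0 hv0 hle, ?_⟩
    have := congrArg Complex.im (log_mul_of_pi_lt_arg_add hu0 hv0 hle)
    simpa [Complex.log_im] using this
  have hmain : (((if γ 1 1 < 0 ∧ ¬(γ 1 0 < 0 ↔ γ 1 0 + 4 * γ 1 1 < 0) then -1 else 1 : ℤ)) : ℂ) *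
      (u * v) ^ (1 / 2 : ℂ) = u ^ (1 / 2 : ℂ) * v ^ (1 / 2 : ℂ) := by
    by_cases hle : u.arg + v.arg ≤ Real.pi
    · obtain ⟨h1, h2⟩ := hcase1 hle
      rw [if_neg, h1]
      · simp
      · rintro ⟨hd, hiff⟩
        have h3 : γ 1 0 + 4 * γ 1 1 < 0 := by omega
        have h4 : 0 ≤ γ 1 0 := by omega
        have h5 := hw2 h3
        rcases h4.lt_or_eq with h6 | h6
        · have := (hu1 h6).1; linarith [hvarg.1]
        -- The boundary case `c = 0`, `d < 0`: here `u` is a negative real number.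
        · have : u.arg = Real.pi := by
            rw [hu, ← h6]
            rw [Complex.arg_eq_pi_iff]
            simp [hd]
          linarith [hvarg.1]
    · push Not at hle
      obtain ⟨h1, h2⟩ := hcase2 hle
      have h3 : 0 ≤ γ 1 0 := by
        by_contra hneg
        have := hu2 (by omega); linarith [hvarg.2]
      have h4 : ¬ (0 < γ 1 0 + 4 * γ 1 1) := fun hp => by
        have := hw1 hp; linarith [hvarg.2]
      have h5 : (u * v).arg < 0 := by linarith [hvarg.2]
      have h6 : γ 1 0 + 4 * γ 1 1 ≠ 0 := fun h0 => by
        have h7 : γ 1 1 < 0 := by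
          rcases Int.lt_trichotomy (γ 1 1) 0 with h | h | h
          · exact h
          · rw [h] at ho; simp at ho
          · omega
        have : (u * v).arg = Real.pi := by
          rw [← hw, h0, Complex.arg_eq_pi_iff]
          simp [h7]
        linarith [Real.pi_pos]
      rw [if_pos, h1]
      · simp
      · constructor <;> omega
  push_cast at hmain ⊢
  linear_combination (epsilon (γ 1 1))⁻¹ * (kronecker (γ 1 0) (γ 1 1) : ℂ) * hmain

/-- The theta series `∑ e^{2πi n² z}`. -/
noncomputable def thetaZ (z : ℍ) : ℂ := jacobiTheta (2 * z)

theorem thetaZ_eq_tsum (z : ℍ) :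
    thetaZ z = ∑' n : ℤ, Complex.exp (2 * Real.pi * Complex.I * n ^ 2 * z) := by
  rw [thetaZ, jacobiTheta]
  congr 1; ext n; congr 1; ring

theorem thetaZ_T_smul (z : ℍ) : thetaZ (ModularGroup.T • z) = thetaZ z := by
  rw [thetaZ, thetaZ, T_smul_coe, mul_add, mul_one, add_comm, jacobiTheta_two_add]

/-- On the variable `2z` of the Jacobi theta function this matrix acts as `S T⁻² S`. The two
inversions give two square roots; their radicands `-iw` have positive real part, so the roots
multiply without a sign. -/
theorem thetaZ_lowerFour_smul (z : ℍ) :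
    thetaZ (lowerFour • z) = (4 * (z : ℂ) + 1) ^ (1 / 2 : ℂ) * thetaZ z := by
  have hz : (z : ℂ) ≠ 0 := z.ne_zero
  set τ : ℍ := ⟨2 * z, by simpa using z.im_pos⟩ with hτ
  have hτc : (τ : ℂ) = 2 * z := rfl
  set σ : ℍ := ModularGroup.S • τ with hσ
  have hσc : (σ : ℂ) = -1 / (2 * z) := by
    rw [hσ, UpperHalfPlane.modular_S_smul]
    simp [hτc]; field_simp
  set ρ : ℍ := (-2 : ℝ) +ᵥ σ with hρ
  have hρc : (ρ : ℂ) = -2 + σ := by rw [hρ, UpperHalfPlane.coe_vadd]; simp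
  have h4 := four_mul_add_one_ne_zero z
  have hS : ((ModularGroup.S • ρ : ℍ) : ℂ) = 2 * (lowerFour • z : ℍ) := by
    rw [UpperHalfPlane.modular_S_smul, lowerFour_smul_coe]
    simp only [hρc, hσc]
    have : -2 + -1 / (2 * (z : ℂ)) ≠ 0 := by
      intro h; apply h4; field_simp at h; linear_combination -h
    rw [inv_eq_one_div, ← mul_div_assoc, div_eq_div_iff (neg_ne_zero.mpr this) h4]
    field_simp; ring
  have hinv : jacobiTheta ρ = jacobiTheta σ := by
    rw [← jacobiTheta_two_add, hρc]; congr 1; ring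
  rw [thetaZ, ← hS, jacobiTheta_S_smul, hinv, hσ, jacobiTheta_S_smul, ← mul_assoc, thetaZ]
  congr 1
  have hre : ∀ w : ℍ, |(-Complex.I * (w : ℂ)).arg| < Real.pi / 2 := by
    intro w
    rw [Complex.abs_arg_lt_pi_div_two_iff]
    left; simpa using w.im_pos
  have hne : ∀ w : ℍ, -Complex.I * (w : ℂ) ≠ 0 := fun w =>
    mul_ne_zero (neg_ne_zero.mpr Complex.I_ne_zero) w.ne_zero
  rw [← sqrt_mul_of_arg_add_mem (hne _) (hne _)]
  · congr 1
    rw [hρc, hσc, hτc]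
    field_simp
    linear_combination -(4 * (z : ℂ) + 1) * Complex.I_sq
  · have h1 := abs_lt.mp (hre ρ)
    have h2 := abs_lt.mp (hre τ)
    constructor <;> linarith [h1.1, h1.2, h2.1, h2.2]

theorem epsilon_sq (d : ℤ) : epsilon d ^ 2 = if d % 4 = 1 then 1 else -1 := by
  unfold epsilon; split_ifs <;> simp

theorem epsilon_ne_zero (d : ℤ) : epsilon d ≠ 0 := by
  unfold epsilon; split_ifs <;> simp

theorem kronecker_sq {c d : ℤ} (hd : Odd d) (h : IsCoprime c d) : kronecker c d ^ 2 = 1 := by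
  rw [kronecker_of_odd _ hd, mul_pow, jacobiSym.sq_one, mul_one]
  · split_ifs <;> simp
  · rw [Int.isCoprime_iff_gcd_eq_one] at h
    simpa [Int.gcd, Int.natAbs_abs] using h

theorem autFactor_sq {γ : SL(2, ℤ)} (h : 4 ∣ γ 1 0) (z : ℍ) :
    autFactor γ z ^ 2 = (if γ 1 1 % 4 = 1 then 1 else -1) * ((γ 1 0 : ℤ) * (z : ℂ) + (γ 1 1 : ℤ)) := by
  have ho := odd_of_four_dvd h
  have hk : ((kronecker (γ 1 0) (γ 1 1) : ℤ) : ℂ) ^ 2 = 1 := by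
    exact_mod_cast kronecker_sq ho (coprime_row γ)
  rw [autFactor, mul_pow, mul_pow, sqrt_sq, hk, inv_pow, epsilon_sq]
  split_ifs <;> norm_num

theorem autFactor_ne_zero {γ : SL(2, ℤ)} (h : 4 ∣ γ 1 0) (z : ℍ) : autFactor γ z ≠ 0 := by
  intro h0
  have := autFactor_sq h z
  rw [h0, zero_pow two_ne_zero] at this
  exact mul_ne_zero (by split_ifs <;> norm_num) (row_ne_zero γ z) this.symm

theorem norm_autFactor_sq {γ : SL(2, ℤ)} (h : 4 ∣ γ 1 0) (z : ℍ) :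
    ‖autFactor γ z‖ ^ 2 = ‖((γ 1 0 : ℤ) : ℂ) * (z : ℂ) + (γ 1 1 : ℤ)‖ := by
  rw [← norm_pow, autFactor_sq h, norm_mul]
  split_ifs <;> simp

theorem lin_mem_slitPlane {c d : ℝ} (hc : c ≠ 0) (z : ℍ) : (c * (z : ℂ) + d) ∈ Complex.slitPlane := by
  rw [Complex.mem_slitPlane_iff]
  right
  simp [hc, z.im_ne_zero]

theorem continuous_autFactor (γ : SL(2, ℤ)) : Continuous (autFactor γ) := by
  unfold autFactor
  apply Continuous.mul continuous_const
  by_cases hc : γ 1 0 = 0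
  · simp [hc, continuous_const]
  · apply Continuous.cpow (by fun_prop) continuous_const
    intro z
    have := lin_mem_slitPlane (c := (γ 1 0 : ℤ)) (d := (γ 1 1 : ℤ)) (by exact_mod_cast hc) z
    simpa using this

theorem T_inv_mul (γ : SL(2, ℤ)) : γ * ModularGroup.T⁻¹ * ModularGroup.T = γ := by group

theorem row_T_inv (γ : SL(2, ℤ)) : (γ * ModularGroup.T⁻¹) 1 0 = γ 1 0 ∧
    (γ * ModularGroup.T⁻¹) 1 1 = γ 1 1 - γ 1 0 := by
  have h := mul_T_row (γ * ModularGroup.T⁻¹)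
  rw [T_inv_mul] at h
  omega

theorem row_lowerFour_inv (γ : SL(2, ℤ)) : (γ * lowerFour⁻¹) 1 0 = γ 1 0 - 4 * γ 1 1 ∧
    (γ * lowerFour⁻¹) 1 1 = γ 1 1 := by
  have h := mul_lowerFour_row (γ * lowerFour⁻¹)
  rw [inv_mul_cancel_right] at h
  omega

/-- The equivalence allows the descent in `thetaZ_smul_aux` to multiply by `T` as well as by `T⁻¹`.
-/
theorem thetaZ_smul_mul_T {γ : SL(2, ℤ)} (h : 4 ∣ γ 1 0) :
    (∀ z, thetaZ ((γ * ModularGroup.T) • z) = autFactor (γ * ModularGroup.T) z * thetaZ z) ↔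
      ∀ z, thetaZ (γ • z) = autFactor γ z * thetaZ z := by
  simp only [autFactor_mul_T h, mul_smul]
  constructor
  · intro H z
    have := H (ModularGroup.T⁻¹ • z)
    rw [← thetaZ_T_smul (ModularGroup.T⁻¹ • z)] at this
    simpa using this
  · intro H z
    rw [H, thetaZ_T_smul]

theorem thetaZ_smul_mul_lowerFour {γ : SL(2, ℤ)} (h : 4 ∣ γ 1 0) :
    (∀ z, thetaZ ((γ * lowerFour) • z) = autFactor (γ * lowerFour) z * thetaZ z) ↔
      ∀ z, thetaZ (γ • z) = autFactor γ z * thetaZ z := by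
  simp only [autFactor_mul_lowerFour h, mul_smul, mul_assoc, ← thetaZ_lowerFour_smul]
  constructor
  · intro H z
    have := H (lowerFour⁻¹ • z)
    simpa using this
  · intro H z
    rw [H]

theorem autFactor_of_lower_zero {γ : SL(2, ℤ)} (h : γ 1 0 = 0) (z : ℍ) : autFactor γ z = 1 := by
  have hd := det_eq γ
  rw [h, mul_zero, sub_zero] at hd
  rcases Int.eq_one_or_neg_one_of_mul_eq_one (by rwa [mul_comm] at hd) with h1 | h1
  · simp [autFactor, h, h1, epsilon, kronecker_of_odd]
  · have : kronecker 0 (-1) = 1 := by rw [kronecker_of_odd _ (by decide)]; simp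
    simp only [autFactor, h, h1, this, epsilon]
    norm_num
    rw [Complex.cpow_def_of_ne_zero (by norm_num), Complex.log_neg_one,
      show (Real.pi : ℂ) * Complex.I * (1 / 2) = Real.pi / 2 * Complex.I by ring,
      Complex.exp_pi_div_two_mul_I]
    simp

theorem thetaZ_vadd (m : ℤ) (z w : ℍ) (h : (w : ℂ) = z + m) : thetaZ w = thetaZ z := by
  rw [thetaZ_eq_tsum, thetaZ_eq_tsum]
  congr 1; ext n
  rw [h, mul_add, Complex.exp_add]
  have : Complex.exp (2 * Real.pi * Complex.I * n ^ 2 * m) = 1 := by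
    rw [Complex.exp_eq_one_iff]
    exact ⟨n ^ 2 * m, by push_cast; ring⟩
  rw [this, mul_one]

theorem smul_coe_of_lower_zero {γ : SL(2, ℤ)} (h : γ 1 0 = 0) (z : ℍ) :
    ((γ • z : ℍ) : ℂ) = z + (γ 0 1 * γ 1 1 : ℤ) := by
  have hd := det_eq γ
  rw [h, mul_zero, sub_zero] at hd
  rw [smul_coe, h]
  rcases Int.eq_one_or_neg_one_of_mul_eq_one (by rwa [mul_comm] at hd) with h1 | h1
  · have h0 : γ 0 0 = 1 := by rw [h1] at hd; omega
    simp [h0, h1]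
  · have h0 : γ 0 0 = -1 := by rw [h1] at hd; omega
    simp [h0, h1]; ring

/-- Euclidean descent on `|c| + |d|`. Since `4 ∣ c` and `d` is odd, `|c| ≠ 2|d|`: if `|c| > 2|d|`,
adding `4d` to `c` or subtracting it shortens `c`; if `|c| < 2|d|` and `c ≠ 0`, adding `c` to `d` or
subtracting it shortens `d`. -/
theorem thetaZ_smul_aux (n : ℕ) : ∀ γ : SL(2, ℤ), 4 ∣ γ 1 0 →
    (γ 1 0).natAbs + (γ 1 1).natAbs = n → ∀ z, thetaZ (γ • z) = autFactor γ z * thetaZ z := by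
  induction n using Nat.strong_induction_on with
  | _ n ih =>
  intro γ h hn
  by_cases hc : γ 1 0 = 0
  · intro z
    rw [autFactor_of_lower_zero hc, one_mul]
    exact thetaZ_vadd _ _ _ (smul_coe_of_lower_zero hc z)
  have ho := odd_of_four_dvd h
  have hne : (γ 1 0).natAbs ≠ 2 * (γ 1 1).natAbs := by
    intro h1
    have h2 := Int.natAbs_odd.mpr ho
    rw [Nat.odd_iff] at h2
    omega
  have h0 : γ 1 1 ≠ 0 := by intro h1; rw [h1] at ho; simp at ho
  by_cases hlt : 2 * (γ 1 1).natAbs < (γ 1 0).natAbs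
  · have hr := mul_lowerFour_row γ
    have hr' := row_lowerFour_inv γ
    by_cases hs : 0 < γ 1 0 * γ 1 1
    · have hsg : (γ 1 0 - 4 * γ 1 1).natAbs < (γ 1 0).natAbs := by
        rcases (mul_pos_iff.mp hs) with h1 | h1 <;> omega
      rw [← inv_mul_cancel_right γ lowerFour, thetaZ_smul_mul_lowerFour (by rw [hr'.1]; omega)]
      exact ih _ (by rw [← hn, ← hr'.1] at *; omega) _ (by rw [hr'.1]; omega) rfl
    · have hs' : γ 1 0 * γ 1 1 < 0 := lt_of_le_of_ne (not_lt.mp hs) (mul_ne_zero hc h0)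
      have hsg : (γ 1 0 + 4 * γ 1 1).natAbs < (γ 1 0).natAbs := by
        rcases (mul_neg_iff.mp hs') with h1 | h1 <;> omega
      rw [← thetaZ_smul_mul_lowerFour h]
      exact ih _ (by rw [hr.1, hr.2]; omega) _ (by rw [hr.1]; omega) rfl
  · have hr := mul_T_row γ
    have hr' := row_T_inv γ
    by_cases hs : 0 < γ 1 0 * γ 1 1
    · have hsg : (γ 1 1 - γ 1 0).natAbs < (γ 1 1).natAbs := by
        rcases (mul_pos_iff.mp hs) with h1 | h1 <;> omega
      rw [← T_inv_mul γ, thetaZ_smul_mul_T (by rw [hr'.1]; omega)]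
      exact ih _ (by rw [hr'.1, hr'.2]; omega) _ (by rw [hr'.1]; omega) rfl
    · have hs' : γ 1 0 * γ 1 1 < 0 := lt_of_le_of_ne (not_lt.mp hs) (mul_ne_zero hc h0)
      have hsg : (γ 1 0 + γ 1 1).natAbs < (γ 1 1).natAbs := by
        rcases (mul_neg_iff.mp hs') with h1 | h1 <;> omega
      rw [← thetaZ_smul_mul_T h]
      exact ih _ (by rw [hr.1, hr.2]; omega) _ (by rw [hr.1]; omega) rfl

theorem thetaZ_smul {γ : SL(2, ℤ)} (h : 4 ∣ γ 1 0) (z : ℍ) :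
    thetaZ (γ • z) = autFactor γ z * thetaZ z := thetaZ_smul_aux _ γ h rfl z

/-- A single point where the theta function does not vanish suffices to cancel it from identities
between automorphy factors. -/
theorem thetaZ_I_ne_zero : thetaZ UpperHalfPlane.I ≠ 0 := by
  intro h
  have h1 := norm_jacobiTheta_sub_one_le (τ := 2 * (UpperHalfPlane.I : ℂ)) (by simp)
  rw [thetaZ] at h
  rw [h] at h1
  -- For `x < 1/3` the bound `2x/(1 - x)` on `|θ - 1|` is less than `1`.
  have h2 : Real.exp (-Real.pi * (2 * (UpperHalfPlane.I : ℂ)).im) < 1 / 3 := by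
    have h3 : (-Real.pi * (2 * (UpperHalfPlane.I : ℂ)).im) = -(2 * Real.pi) := by simp; ring
    rw [h3, Real.exp_neg, one_div]
    apply inv_strictAnti₀ (by norm_num)
    have := Real.add_one_le_exp (2 * Real.pi)
    linarith [Real.pi_gt_three]
  set x := Real.exp (-Real.pi * (2 * (UpperHalfPlane.I : ℂ)).im)
  have hx : 0 < x := Real.exp_pos _
  rw [zero_sub, norm_neg, norm_one, div_mul_eq_mul_div, le_div_iff₀ (by linarith)] at h1
  linarith

theorem four_dvd_mul {γ γ' : SL(2, ℤ)} (h : 4 ∣ γ 1 0) (h' : 4 ∣ γ' 1 0) : 4 ∣ (γ * γ') 1 0 := by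
  rw [mul_entry]
  exact dvd_add (h.mul_right _) (h'.mul_left _)

/-- Both sides are continuous and have the same square, and the right side has no zeros; as `ℍ` is
connected, they agree up to one global sign. The law of the theta function at `z = i` shows that the
sign is `+`. -/
theorem autFactor_mul {γ γ' : SL(2, ℤ)} (h : 4 ∣ γ 1 0) (h' : 4 ∣ γ' 1 0) (z : ℍ) :
    autFactor (γ * γ') z = autFactor γ (γ' • z) * autFactor γ' z := by
  have hm := four_dvd_mul h h'
  have key := isPreconnected_univ.eq_of_sq_eq (S := (Set.univ : Set ℍ))
    (f := autFactor (γ * γ')) (g := fun z => autFactor γ (γ' • z) * autFactor γ' z)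
    (continuous_autFactor _).continuousOn
    (((continuous_autFactor γ).comp (continuous_const_smul (mapGL ℝ γ'))).mul
      (continuous_autFactor γ')).continuousOn ?_ ?_ (Set.mem_univ UpperHalfPlane.I) ?_
  · exact key (Set.mem_univ z)
  · intro w _
    simp only [Pi.pow_apply, mul_pow]
    rw [autFactor_sq h, autFactor_sq h', autFactor_sq hm, smul_coe γ' w, mul_entry, mul_entry]
    have hw := row_ne_zero γ' w
    have hd : ((γ 1 0 * γ' 0 1 + γ 1 1 * γ' 1 1) % 4 = 1) ↔ (γ 1 1 % 4 = 1 ↔ γ' 1 1 % 4 = 1) := by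
      have h1 := odd_of_four_dvd h
      have h2 := odd_of_four_dvd h'
      rw [Int.odd_iff] at h1 h2
      have h3 : (γ 1 0 * γ' 0 1) % 4 = 0 := Int.emod_eq_zero_of_dvd (h.mul_right _)
      rw [Int.add_emod, h3, Int.mul_emod]
      have h4 : γ 1 1 % 4 = 1 ∨ γ 1 1 % 4 = 3 := by omega
      have h5 : γ' 1 1 % 4 = 1 ∨ γ' 1 1 % 4 = 3 := by omega
      rcases h4 with h4 | h4 <;> rcases h5 with h5 | h5 <;> simp [h4, h5]
    have hs : (if (γ 1 0 * γ' 0 1 + γ 1 1 * γ' 1 1) % 4 = 1 then (1 : ℂ) else -1) =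
        (if γ 1 1 % 4 = 1 then 1 else -1) * (if γ' 1 1 % 4 = 1 then 1 else -1) := by
      simp only [hd]
      by_cases h4 : γ 1 1 % 4 = 1 <;> by_cases h5 : γ' 1 1 % 4 = 1 <;> simp [h4, h5]
    rw [hs]
    generalize (if γ 1 1 % 4 = 1 then (1 : ℂ) else -1) = s
    generalize (if γ' 1 1 % 4 = 1 then (1 : ℂ) else -1) = s'
    have hD : ∀ x y u D : ℂ, D ≠ 0 → (x * (u / D) + y) * D = x * u + y * D := fun x y u D h0 => by
      field_simp
    have := hD (γ 1 0 : ℤ) (γ 1 1 : ℤ) ((γ' 0 0 : ℤ) * (w : ℂ) + (γ' 0 1 : ℤ)) _ hw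
    push_cast
    linear_combination -s * s' * this
  · intro w _
    exact mul_ne_zero (autFactor_ne_zero h _) (autFactor_ne_zero h' _)
  · have h1 := thetaZ_smul hm UpperHalfPlane.I
    rw [mul_smul, thetaZ_smul h, thetaZ_smul h', ← mul_assoc] at h1
    exact (mul_right_cancel₀ thetaZ_I_ne_zero h1).symm

theorem comp_assoc (x y z : Pair) : (x.comp y).comp z = x.comp (y.comp z) := by
  simp only [Pair.comp, mul_assoc, mul_smul]

theorem lift_mul {γ γ' : SL(2, ℤ)} (h : 4 ∣ γ 1 0) (h' : 4 ∣ γ' 1 0) :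
    lift (γ * γ') = (lift γ).comp (lift γ') := by
  ext1
  · simp [lift, Pair.comp]
  · funext z
    exact autFactor_mul h h' z

theorem lift_one_comp (x : Pair) : (lift 1).comp x = x := by
  ext1
  · simp [lift, Pair.comp]
  · funext z
    simp [lift, Pair.comp, autFactor_of_lower_zero]

theorem slash_comp (k : ℕ) (f : ℍ → ℂ) (x y : Pair) :
    slash k f (x.comp y) = slash k (slash k f x) y := by
  funext z
  simp only [slash, Pair.comp, mul_smul, mul_pow, mul_inv]
  ring

/-! ### Poisson summation in several variables -/

theorem hasSum_prod_pi {f : ℤ → ℝ} (hf0 : ∀ n, 0 ≤ f n) {s : ℝ} (hf : HasSum f s) (k : ℕ) :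
    HasSum (fun n : Fin k → ℤ => ∏ i, f (n i)) (s ^ k) := by
  induction k with
  | zero => simp
  | succ k ih =>
    have hnn : (0 : (Fin k → ℤ) → ℝ) ≤ fun n => ∏ i, f (n i) :=
      fun n => Finset.prod_nonneg fun i _ => hf0 _
    have hsm : Summable fun x : ℤ × (Fin k → ℤ) => f x.1 * ∏ i, f (x.2 i) :=
      Summable.mul_of_nonneg (f := f) (g := fun n : Fin k → ℤ => ∏ i, f (n i)) hf.summable
        ih.summable hf0 hnn
    have h := hf.mul ih hsm
    rw [pow_succ']
    refine (Fin.consEquiv (fun _ => ℤ)).hasSum_iff.mp ?_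
    refine h.congr_fun ?_
    intro x
    simp [Fin.consEquiv, Fin.prod_univ_succ]

theorem hasSum_pow_natAbs {r : ℝ} (h0 : 0 ≤ r) (h1 : r < 1) :
    HasSum (fun n : ℤ => r ^ n.natAbs) ((1 - r)⁻¹ + r * (1 - r)⁻¹) := by
  apply HasSum.of_nat_of_neg_add_one
  · simpa using hasSum_geometric_of_lt_one h0 h1
  · have := (hasSum_geometric_of_lt_one h0 h1).mul_left r
    convert! this using 1
    funext n
    have : (-((n : ℤ) + 1)).natAbs = n + 1 := by omega
    rw [this, pow_succ']

section Poisson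

variable {ι : Type*} [Fintype ι]

/-- The vector of real numbers underlying an integral vector. -/
abbrev toReal (n : ι → ℤ) : ι → ℝ := fun i => n i

open MeasureTheory in
theorem hasSum_integral_cubes {g : (ι → ℝ) → ℂ} (hg : Integrable g) :
    HasSum (fun n : ι → ℤ => ∫ x in {x : ι → ℝ | ∀ i, x i ∈ Set.Ioc (0 : ℝ) (0 + 1)}, g (x + toReal n))
      (∫ x, g x) := by
  classical
  set s : (ι → ℤ) → Set (ι → ℝ) := fun n => {x | ∀ i, x i - n i ∈ Set.Ioc (0 : ℝ) (0 + 1)} with hs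
  have hm : ∀ n, MeasurableSet (s n) := fun n => by
    have : s n = Set.univ.pi fun i => Set.Ioc (n i : ℝ) (n i + 1) := by
      ext x; simp only [hs, Set.mem_ofPred_eq, Set.mem_pi, Set.mem_univ, true_imp_iff, Set.mem_Ioc]
      refine forall_congr' fun i => ?_
      constructor <;> rintro ⟨h1, h2⟩ <;> constructor <;> linarith
    rw [this]
    exact MeasurableSet.univ_pi fun i => measurableSet_Ioc
  have hd : Pairwise (Function.onFun Disjoint s) := by
    intro m n hmn
    rw [Function.onFun, Set.disjoint_left]
    intro x hx hx'
    apply hmn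
    funext i
    have h1 := hx i
    have h2 := hx' i
    simp only [Set.mem_Ioc] at h1 h2
    have h3 : (m i : ℝ) < n i + 1 := by linarith
    have h4 : (n i : ℝ) < m i + 1 := by linarith
    have h3' : m i < n i + 1 := by exact_mod_cast h3
    have h4' : n i < m i + 1 := by exact_mod_cast h4
    omega
  have hu : (⋃ n, s n) = Set.univ := by
    rw [Set.eq_univ_iff_forall]
    intro x
    rw [Set.mem_iUnion]
    -- The cubes are open on the left and closed on the right, hence the ceiling minus one.
    refine ⟨fun i => ⌈x i⌉ - 1, fun i => ?_⟩
    have h1 := Int.le_ceil (x i)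
    have h2 := Int.ceil_lt_add_one (x i)
    push_cast
    constructor <;> linarith
  have h := hasSum_integral_iUnion (μ := volume) (f := g) hm hd (by rw [hu]; exact hg.integrableOn)
  rw [hu, setIntegral_univ] at h
  convert! h using 1
  funext n
  have hpre : {x : ι → ℝ | ∀ i, x i ∈ Set.Ioc (0 : ℝ) (0 + 1)} = (fun x => x + toReal n) ⁻¹' (s n) := by
    ext x; simp [hs]
  rw [hpre]
  exact (measurePreserving_add_right volume (toReal n)).setIntegral_preimage_emb
    (measurableEmbedding_addRight _) g (s n)

open MeasureTheory UnitAddTorus in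
-- Poisson summation: the periodization of `f` is continuous by the local majorants and descends to
-- the torus. Unfolding the integral over the unit cube identifies its Fourier coefficients with the
-- Fourier transform of `f`, and since these are summable, the Fourier series represents the
-- function at every point.
theorem tsum_eq_tsum_integral {f : (ι → ℝ) → ℂ} (hf : Continuous f) (hfi : Integrable f)
    (hb : ∀ R : ℝ, ∃ u : (ι → ℤ) → ℝ, Summable u ∧
      ∀ x : ι → ℝ, (∀ i, |x i| ≤ R) → ∀ n, ‖f (x + toReal n)‖ ≤ u n)
    (hs : Summable fun m : ι → ℤ =>
      ∫ x, Complex.exp (-(2 * Real.pi * Complex.I * ∑ i, (m i : ℂ) * x i)) * f x) (x : ι → ℝ) :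
    ∑' n, f (x + toReal n) = ∑' m : ι → ℤ,
      (∫ x, Complex.exp (-(2 * Real.pi * Complex.I * ∑ i, (m i : ℂ) * x i)) * f x) *
        Complex.exp (2 * Real.pi * Complex.I * ∑ i, (m i : ℂ) * x i) := by
  classical
  set P : (ι → ℝ) → ℂ := fun x => ∑' n, f (x + toReal n) with hP
  have hPper : ∀ x (n : ι → ℤ), P (x + toReal n) = P x := by
    intro x n
    simp only [hP]
    refine Eq.trans ?_ ((Equiv.addLeft n).tsum_eq fun m => f (x + toReal m))
    congr 1; funext m
    congr 1; funext i; simp [toReal]; ring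
  have hPcont : Continuous P := by
    rw [continuous_iff_continuousAt]
    intro x
    obtain ⟨u, hu, hub⟩ := hb (‖x‖ + 1)
    have hco : ContinuousOn P (Metric.ball x 1) := by
      refine continuousOn_tsum (fun n => (hf.comp (by fun_prop)).continuousOn) hu ?_
      intro n y hy
      refine hub y (fun i => ?_) n
      have h1 : ‖y‖ ≤ ‖x‖ + 1 := by
        have := norm_sub_norm_le y x
        rw [mem_ball_iff_norm] at hy; linarith
      exact (norm_le_pi_norm y i).trans h1
    exact hco.continuousAt (Metric.ball_mem_nhds x one_pos)
  let q : (ι → ℝ) → UnitAddTorus ι := fun x i => (x i : UnitAddCircle)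
  have hq : IsOpenQuotientMap q :=
    IsOpenQuotientMap.piMap (fun _ => QuotientAddGroup.isOpenQuotientMap_mk)
  have hqP : ∀ x y, q x = q y → P x = P y := by
    intro x y h
    have h1 : ∀ i, ∃ n : ℤ, x i = y i + n := by
      intro i
      have := congrFun h i
      have h0 : ((x i - y i : ℝ) : UnitAddCircle) = 0 := by
        rw [AddCircle.coe_sub]; exact sub_eq_zero.mpr this
      obtain ⟨n, hn⟩ := AddCircle.coe_eq_zero_iff (1 : ℝ) |>.mp h0
      exact ⟨n, by simp at hn; linarith⟩
    choose n hn using h1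
    rw [← hPper y n]
    congr 1; funext i; simp [toReal, hn]
  -- The descended function is evaluated at a chosen preimage, and its continuity is tested after
  -- composition with the quotient map.
  let F : C(UnitAddTorus ι, ℂ) := ⟨fun t => P (hq.surjective t).choose, by
    rw [hq.isQuotientMap.continuous_iff]
    convert! hPcont using 1
    funext x
    exact hqP _ _ (hq.surjective (q x)).choose_spec⟩
  have hF : ∀ x, F (q x) = P x := fun x => hqP _ _ (hq.surjective (q x)).choose_spec
  have hmF : ∀ (m : ι → ℤ) (x : ι → ℝ), mFourier m (q x) =
      Complex.exp (2 * Real.pi * Complex.I * ∑ i, (m i : ℂ) * x i) := by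
    intro m x
    simp only [mFourier, ContinuousMap.coe_mk, q, fourier_coe_apply]
    rw [← Complex.exp_sum, Finset.mul_sum]
    congr 1
    refine Finset.sum_congr rfl fun i _ => ?_
    push_cast; ring
  have hcoeff : ∀ m, mFourierCoeff F m =
      ∫ x, Complex.exp (-(2 * Real.pi * Complex.I * ∑ i, (m i : ℂ) * x i)) * f x := by
    intro m
    rw [mFourierCoeff_eq_integral (F : UnitAddTorus ι → ℂ) m 0]
    set g : (ι → ℝ) → ℂ := fun x =>
      Complex.exp (-(2 * Real.pi * Complex.I * ∑ i, (m i : ℂ) * x i)) * f x with hg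
    have hgn : ∀ x, ‖g x‖ = ‖f x‖ := by
      intro x
      rw [hg]
      simp only [norm_mul]
      rw [show (-(2 * Real.pi * Complex.I * ∑ i, (m i : ℂ) * x i)) =
        ((-(2 * Real.pi * ∑ i, (m i : ℝ) * x i) : ℝ) : ℂ) * Complex.I by push_cast; ring,
        Complex.norm_exp_ofReal_mul_I, one_mul]
    have hgc : Continuous g := by fun_prop
    have hgi : Integrable g := by
      rw [← integrable_norm_iff hgc.aestronglyMeasurable]
      simp only [hgn]
      exact hfi.norm
    rw [← (hasSum_integral_cubes hgi).tsum_eq]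
    set cube : Set (ι → ℝ) := {x | ∀ i, x i ∈ Set.Ioc (0 : ℝ) (0 + 1)} with hcube
    have hcm : MeasurableSet cube := by
      have : cube = Set.univ.pi fun i => Set.Ioc (0 : ℝ) (0 + 1) := by ext x; simp [hcube]
      rw [this]
      exact MeasurableSet.univ_pi fun i => measurableSet_Ioc
    have hvol : volume cube = 1 := by
      have : cube = Set.univ.pi fun i => Set.Ioc (0 : ℝ) (0 + 1) := by ext x; simp [hcube]
      rw [this, Real.volume_pi_Ioc]; simp
    obtain ⟨u, hu, hub⟩ := hb 1
    have hbd : ∀ n, ∀ x ∈ cube, ‖g (x + toReal n)‖ ≤ u n := by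
      intro n x hx
      rw [hgn]
      refine hub x (fun i => ?_) n
      have := hx i
      rw [abs_le]; constructor <;> linarith [this.1, this.2]
    have hint : ∀ n, Integrable (fun x => g (x + toReal n)) (volume.restrict cube) := by
      intro n
      exact (hgi.comp_add_right (toReal n)).integrableOn
    have hsum := hasSum_integral_of_summable_integral_norm (μ := volume.restrict cube)
      (F := fun (n : ι → ℤ) x => g (x + toReal n)) hint ?_
    · rw [hsum.tsum_eq]
      refine setIntegral_congr_fun hcm fun x _ => ?_
      change mFourier (-m) (q x) • F (q x) = _
      rw [hF, hmF, hP, smul_eq_mul, ← tsum_mul_left]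
      congr 1; funext n
      rw [hg]
      simp only
      congr 1
      apply Complex.exp_eq_exp_iff_exists_int.mpr
      refine ⟨∑ i, m i * n i, ?_⟩
      simp only [Pi.neg_apply, Pi.add_apply, toReal]
      push_cast
      simp only [neg_mul, mul_add, Finset.sum_neg_distrib, Finset.sum_add_distrib]
      ring
    · refine Summable.of_nonneg_of_le (fun n => by positivity) (fun n => ?_) hu
      have : ∫ x in cube, ‖g (x + toReal n)‖ ≤ ∫ x in cube, u n := by
        refine setIntegral_mono_on (hint n).norm ?_ hcm (hbd n)
        rw [integrableOn_const_iff]; right; rw [hvol]; simp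
      simpa [Measure.real, hvol] using this
  have hsum : Summable (mFourierCoeff (F : UnitAddTorus ι → ℂ)) := by
    convert! hs using 1
    funext m; exact hcoeff m
  have := (hasSum_mFourier_series_apply_of_summable hsum (q x)).tsum_eq
  rw [hF] at this
  change P x = _
  rw [← this]
  congr 1; funext m
  rw [hcoeff, hmF, smul_eq_mul]

end Poisson

/-! ### Gaussians of several variables and their Poisson formula -/

section Gaussian

variable {k : ℕ}

/-- The Gaussian `e^{2πi |Px|² z}`. -/
noncomputable def gaussian (P : Matrix (Fin k) (Fin k) ℝ) (z : ℂ) (x : Fin k → ℝ) : ℂ :=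
  Complex.exp (2 * Real.pi * Complex.I * ((∑ i, (P.mulVec x) i ^ 2 : ℝ) : ℂ) * z)

theorem norm_gaussian (P : Matrix (Fin k) (Fin k) ℝ) (z : ℂ) (x : Fin k → ℝ) :
    ‖gaussian P z x‖ = Real.exp (-(2 * Real.pi * z.im * ∑ i, (P.mulVec x) i ^ 2)) := by
  rw [gaussian, Complex.norm_exp]
  congr 1
  generalize (∑ i, (P.mulVec x) i ^ 2) = s
  simp [Complex.mul_re, Complex.mul_im]
  ring

/-- Apply Cauchy–Schwarz to the rows in `x = P⁻¹(Px)`. The square sum `C` of the entries of `P⁻¹` is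
increased by `1` so that it can be inverted. -/
theorem exists_pos_mul_sum_sq_le {P : Matrix (Fin k) (Fin k) ℝ} (hP : P.det ≠ 0) :
    ∃ δ : ℝ, 0 < δ ∧ ∀ x : Fin k → ℝ, δ * ∑ i, x i ^ 2 ≤ ∑ i, (P.mulVec x) i ^ 2 := by
  set C : ℝ := ∑ i, ∑ j, (P⁻¹ i j) ^ 2 with hC
  have hC0 : 0 ≤ C := Finset.sum_nonneg fun i _ => Finset.sum_nonneg fun j _ => sq_nonneg _
  refine ⟨(C + 1)⁻¹, by positivity, fun x => ?_⟩
  have hx : P⁻¹.mulVec (P.mulVec x) = x := by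
    rw [Matrix.mulVec_mulVec, Matrix.nonsing_inv_mul _ (isUnit_iff_ne_zero.mpr hP), Matrix.one_mulVec]
  set y := P.mulVec x
  have h1 : ∑ i, x i ^ 2 ≤ C * ∑ i, y i ^ 2 := by
    rw [hC, Finset.sum_mul]
    refine Finset.sum_le_sum fun i _ => ?_
    rw [← hx]
    exact Finset.sum_mul_sq_le_sq_mul_sq Finset.univ (fun j => P⁻¹ i j) y
  have h2 : 0 ≤ ∑ i, y i ^ 2 := Finset.sum_nonneg fun i _ => sq_nonneg _
  rw [inv_mul_le_iff₀ (by positivity)]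
  nlinarith

/-- From `2(x + n)² ≥ n² - 2x²` and `n² ≥ |n|` one gets a product of geometric terms, uniform for
`Im z ≥ y` and bounded `x`. That `δ` does not depend on `y` is what later gives polynomial growth as
`Im z → 0`. -/
theorem exists_pos_norm_gaussian_le {P : Matrix (Fin k) (Fin k) ℝ} (hP : P.det ≠ 0) :
    ∃ δ : ℝ, 0 < δ ∧ ∀ y : ℝ, 0 < y → ∀ R : ℝ, ∀ z : ℂ, y ≤ z.im → ∀ x : Fin k → ℝ,
      (∀ i, |x i| ≤ R) → ∀ n, ‖gaussian P z (x + toReal n)‖ ≤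
        ∏ i, (Real.exp (2 * (y * δ) * R ^ 2) * Real.exp (-(y * δ)) ^ (n i).natAbs) := by
  obtain ⟨δ, hδ, hb⟩ := exists_pos_mul_sum_sq_le hP
  refine ⟨Real.pi * δ, by have := Real.pi_pos; positivity, ?_⟩
  intro y hy R z hz x hx n
  set t : ℝ := y * (Real.pi * δ) with ht
  have ht0 : 0 < t := by have := Real.pi_pos; positivity
  set r : ℝ := Real.exp (-t)
  rw [norm_gaussian]
  have h1 := hb (x + toReal n)
  have h2 : ∀ i, Real.exp (2 * t * R ^ 2) * r ^ (n i).natAbs =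
      Real.exp (2 * t * R ^ 2 - t * (n i).natAbs) := by
    intro i
    rw [← Real.exp_nat_mul, ← Real.exp_add]
    congr 1; ring
  simp only [h2]
  rw [← Real.exp_sum]
  apply Real.exp_le_exp.mpr
  have hpi := Real.pi_pos
  have h3 : 2 * t * ∑ i, (x + toReal n) i ^ 2 ≤
      2 * Real.pi * z.im * ∑ i, (P.mulVec (x + toReal n)) i ^ 2 := by
    have h0 : 0 ≤ ∑ i, (x + toReal n) i ^ 2 := Finset.sum_nonneg fun i _ => sq_nonneg _
    calc 2 * t * ∑ i, (x + toReal n) i ^ 2 = 2 * Real.pi * y * (δ * ∑ i, (x + toReal n) i ^ 2) := by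
          rw [ht]; ring
      _ ≤ 2 * Real.pi * z.im * (δ * ∑ i, (x + toReal n) i ^ 2) := by gcongr
      _ ≤ _ := by
        have : 0 ≤ z.im := by linarith
        gcongr
  refine le_trans (neg_le_neg h3) ?_
  rw [Finset.mul_sum, ← Finset.sum_neg_distrib]
  refine Finset.sum_le_sum fun i _ => ?_
  have h4 : (x i) ^ 2 ≤ R ^ 2 := by
    rw [← sq_abs]; exact pow_le_pow_left₀ (abs_nonneg _) (hx i) 2
  have h5 : ((n i).natAbs : ℝ) ≤ (n i : ℝ) ^ 2 := by
    have : ((n i).natAbs : ℤ) ≤ (n i) ^ 2 := by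
      rw [← Int.natAbs_sq]; exact_mod_cast Nat.le_self_pow two_ne_zero _
    rw [Nat.cast_natAbs]
    exact_mod_cast this
  have h6 : (x + toReal n) i = x i + n i := rfl
  rw [h6]
  nlinarith [sq_nonneg (2 * x i + n i)]

theorem hasSum_prod_exp {t : ℝ} (ht : 0 < t) (A : ℝ) (hA : 0 ≤ A) (k : ℕ) :
    HasSum (fun n : Fin k → ℤ => ∏ i, (A * Real.exp (-t) ^ (n i).natAbs))
      ((A * ((1 - Real.exp (-t))⁻¹ + Real.exp (-t) * (1 - Real.exp (-t))⁻¹)) ^ k) :=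
  hasSum_prod_pi (f := fun n : ℤ => A * Real.exp (-t) ^ n.natAbs) (fun n => by positivity)
    ((hasSum_pow_natAbs (Real.exp_pos _).le (by rw [Real.exp_lt_one_iff]; linarith)).mul_left _) k

theorem exists_summable_bound {P : Matrix (Fin k) (Fin k) ℝ} (hP : P.det ≠ 0) {y : ℝ} (hy : 0 < y)
    (R : ℝ) : ∃ u : (Fin k → ℤ) → ℝ, Summable u ∧ ∀ z : ℂ, y ≤ z.im →
      ∀ x : Fin k → ℝ, (∀ i, |x i| ≤ R) → ∀ n, ‖gaussian P z (x + toReal n)‖ ≤ u n := by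
  obtain ⟨δ, hδ, hb⟩ := exists_pos_norm_gaussian_le hP
  exact ⟨_, (hasSum_prod_exp (mul_pos hy hδ) (Real.exp (2 * (y * δ) * R ^ 2))
    (Real.exp_pos _).le k).summable, hb y hy R⟩

theorem summable_gaussian {P : Matrix (Fin k) (Fin k) ℝ} (hP : P.det ≠ 0) {z : ℂ} (hz : 0 < z.im)
    (h : Fin k → ℝ) : Summable fun n : Fin k → ℤ => gaussian P z (h + toReal n) := by
  obtain ⟨u, hu, hb⟩ := exists_summable_bound hP hz ‖h‖
  exact hu.of_norm_bounded (hb z le_rfl h fun i => norm_le_pi_norm h i)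

theorem continuous_gaussian (P : Matrix (Fin k) (Fin k) ℝ) (z : ℂ) : Continuous (gaussian P z) := by
  unfold gaussian
  have : Continuous fun x => P.mulVec x := by fun_prop
  fun_prop

open MeasureTheory in
theorem integrable_comp_mulVec {P : Matrix (Fin k) (Fin k) ℝ} (hP : P.det ≠ 0)
    {g : (Fin k → ℝ) → ℂ} (hg : Integrable g) : Integrable fun x => g (P.mulVec x) := by
  have hmap := Real.map_matrix_volume_pi_eq_smul_volume_pi hP
  have he : MeasurableEmbedding (Matrix.toLin' P) :=
    ((Matrix.toLin' P).equivOfDetNeZero (by simpa using hP)).toContinuousLinearEquiv.toHomeomorph.measurableEmbedding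
  have : Integrable g (Measure.map (Matrix.toLin' P) volume) := by
    rw [hmap]
    exact hg.smul_measure ENNReal.ofReal_ne_top
  exact (he.integrable_map_iff).mp this

open MeasureTheory in
theorem integral_comp_mulVec {P : Matrix (Fin k) (Fin k) ℝ} (hP : P.det ≠ 0)
    (g : (Fin k → ℝ) → ℂ) : ∫ x, g (P.mulVec x) = ((|P.det|⁻¹ : ℝ) : ℂ) * ∫ x, g x := by
  have hmap := Real.map_matrix_volume_pi_eq_smul_volume_pi hP
  have he : MeasurableEmbedding (Matrix.toLin' P) :=
    ((Matrix.toLin' P).equivOfDetNeZero (by simpa using hP)).toContinuousLinearEquiv.toHomeomorph.measurableEmbedding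
  have h1 := he.integral_map (μ := volume) g
  rw [hmap, integral_smul_measure] at h1
  simp only [Matrix.toLin'_apply] at h1
  rw [← h1, ENNReal.toReal_ofReal (abs_nonneg _), abs_inv]
  simp

theorem transpose_inv_mulVec_dot {P : Matrix (Fin k) (Fin k) ℝ} (hP : P.det ≠ 0) (m x : Fin k → ℝ) :
    ∑ i, (P⁻¹.transpose.mulVec m) i * (P.mulVec x) i = ∑ i, m i * x i := by
  change dotProduct _ _ = dotProduct _ _
  rw [Matrix.mulVec_transpose, ← Matrix.dotProduct_mulVec, Matrix.mulVec_mulVec,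
    Matrix.nonsing_inv_mul _ (isUnit_iff_ne_zero.mpr hP), Matrix.one_mulVec]

/-- In the variable `v = Px` the quadratic form is the standard one and the frequency `m` becomes
`P⁻ᵀm`. -/
theorem fourier_gaussian_aux {P : Matrix (Fin k) (Fin k) ℝ} (hP : P.det ≠ 0) (z : ℂ)
    (m : Fin k → ℤ) (x : Fin k → ℝ) :
    Complex.exp (-(2 * Real.pi * Complex.I * ∑ i, (m i : ℂ) * x i)) * gaussian P z x =
    (fun v : Fin k → ℝ => Complex.exp (-(-(2 * Real.pi * Complex.I * z)) * ∑ i, (v i : ℂ) ^ 2 +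
      ∑ i, (-(2 * Real.pi * Complex.I) * (((P⁻¹.transpose.mulVec (toReal m)) i : ℝ) : ℂ)) * v i))
      (P.mulVec x) := by
  simp only
  rw [gaussian, ← Complex.exp_add]
  congr 1
  have h := congrArg (fun t : ℝ => (t : ℂ)) (transpose_inv_mulVec_dot hP (toReal m) x)
  simp only [toReal] at h
  push_cast at h
  simp only [mul_assoc]
  rw [← Finset.mul_sum, h]
  push_cast
  ring

theorem re_gaussian_pos {z : ℂ} (hz : 0 < z.im) : 0 < (-(2 * Real.pi * Complex.I * z)).re := by
  have := Real.pi_pos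
  simp [Complex.mul_re, Complex.mul_im]
  positivity

open MeasureTheory in
theorem integral_gaussian_mul_exp {P : Matrix (Fin k) (Fin k) ℝ} (hP : P.det ≠ 0) {z : ℂ}
    (hz : 0 < z.im) (m : Fin k → ℤ) :
    ∫ x, Complex.exp (-(2 * Real.pi * Complex.I * ∑ i, (m i : ℂ) * x i)) * gaussian P z x =
      ((|P.det|⁻¹ : ℝ) : ℂ) * (((-2 * Complex.I * z)⁻¹) ^ (1 / 2 : ℂ)) ^ k *
        gaussian P⁻¹.transpose (-1 / (4 * z)) (toReal m) := by
  have hz0 : z ≠ 0 := by rintro rfl; simp at hz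
  simp_rw [fourier_gaussian_aux hP]
  rw [integral_comp_mulVec hP (fun v : Fin k → ℝ => Complex.exp
    (-(-(2 * Real.pi * Complex.I * z)) * ∑ i, (v i : ℂ) ^ 2 +
      ∑ i, (-(2 * Real.pi * Complex.I) * (((P⁻¹.transpose.mulVec (toReal m)) i : ℝ) : ℂ)) * v i)),
    GaussianFourier.integral_cexp_neg_mul_sum_add (re_gaussian_pos hz)]
  have hpi : (Real.pi : ℂ) ≠ 0 := by exact_mod_cast Real.pi_ne_zero
  have hI := Complex.I_ne_zero
  have e1 : ((Real.pi : ℂ) / (-(2 * Real.pi * Complex.I * z))) ^ ((Fintype.card (Fin k) : ℂ) / 2) =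
      (((-2 * Complex.I * z)⁻¹) ^ (1 / 2 : ℂ)) ^ k := by
    rw [← Complex.cpow_mul_nat]
    congr 1
    · field_simp
    · simp; ring
  have e2 : Complex.exp ((∑ i, (-(2 * Real.pi * Complex.I) *
      (((P⁻¹.transpose.mulVec (toReal m)) i : ℝ) : ℂ)) ^ 2) / (4 * -(2 * Real.pi * Complex.I * z))) =
      gaussian P⁻¹.transpose (-1 / (4 * z)) (toReal m) := by
    rw [gaussian]
    congr 1
    push_cast
    simp only [mul_pow]
    rw [← Finset.mul_sum]
    generalize (∑ i, ((P⁻¹.transpose.mulVec (toReal m) i : ℝ) : ℂ) ^ 2) = s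
    field_simp
  rw [e1, e2, ← mul_assoc]

theorem neg_inv_four_mul_im_pos {z : ℂ} (hz : 0 < z.im) : 0 < (-1 / (4 * z)).im := by
  have hz0 : z ≠ 0 := by rintro rfl; simp at hz
  have : (-1 / (4 * z)) = ((1 / 4 : ℝ) : ℂ) * -(z⁻¹) := by push_cast; field_simp
  rw [this, Complex.im_ofReal_mul, Complex.neg_im, Complex.inv_im]
  have := Complex.normSq_pos.mpr hz0
  have h : -(-z.im / Complex.normSq z) = z.im / Complex.normSq z := by ring
  rw [h]; positivity

theorem tsum_gaussian {P : Matrix (Fin k) (Fin k) ℝ} (hP : P.det ≠ 0) {z : ℂ} (hz : 0 < z.im)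
    (h : Fin k → ℝ) : ∑' n : Fin k → ℤ, gaussian P z (h + toReal n) =
      ((|P.det|⁻¹ : ℝ) : ℂ) * (((-2 * Complex.I * z)⁻¹) ^ (1 / 2 : ℂ)) ^ k *
        ∑' m : Fin k → ℤ, gaussian P⁻¹.transpose (-1 / (4 * z)) (toReal m) *
          Complex.exp (2 * Real.pi * Complex.I * ∑ i, (m i : ℂ) * h i) := by
  have hP' : P⁻¹.transpose.det ≠ 0 := by
    rw [Matrix.det_transpose]
    exact ((Matrix.isUnit_nonsing_inv_det_iff).mpr (isUnit_iff_ne_zero.mpr hP)).ne_zero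
  have hs : Summable fun m : Fin k → ℤ =>
      gaussian P⁻¹.transpose (-1 / (4 * z)) (toReal m) := by
    simpa using summable_gaussian hP' (neg_inv_four_mul_im_pos hz) 0
  rw [tsum_eq_tsum_integral (continuous_gaussian P z)]
  · simp_rw [integral_gaussian_mul_exp hP hz]
    rw [← tsum_mul_left]
    simp only [mul_assoc]
  -- Integrability of the Gaussian itself is the case of frequency `0`.
  · have := integrable_comp_mulVec hP (GaussianFourier.integrable_cexp_neg_mul_sum_add
      (ι := Fin k) (re_gaussian_pos hz)
      fun i => (-(2 * Real.pi * Complex.I) * (((P⁻¹.transpose.mulVec (toReal 0)) i : ℝ) : ℂ)))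
    refine this.congr (Filter.Eventually.of_forall fun x => ?_)
    have h0 := fourier_gaussian_aux hP z 0 x
    simp only [Pi.zero_apply, Int.cast_zero, zero_mul, Finset.sum_const_zero, mul_zero, neg_zero,
      Complex.exp_zero, one_mul] at h0
    exact h0.symm
  · intro R
    obtain ⟨u, hu, hb⟩ := exists_summable_bound hP hz R
    exact ⟨u, hu, hb z le_rfl⟩
  · simp_rw [integral_gaussian_mul_exp hP hz]
    exact hs.mul_left _

end Gaussian

/-! ### Quadratic forms and theta series of several variables -/

section QuadraticForm

variable {k : ℕ} {R : Type*} [CommRing R]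

/-- The value `xᵗ S x`. -/
def quadVal (S : Matrix (Fin k) (Fin k) R) (x : Fin k → R) : R := dotProduct x (S.mulVec x)

theorem dotProduct_mulVec_comm {S : Matrix (Fin k) (Fin k) R} (hS : S.IsSymm) (x y : Fin k → R) :
    dotProduct x (S.mulVec y) = dotProduct y (S.mulVec x) := by
  rw [Matrix.dotProduct_mulVec, ← Matrix.mulVec_transpose, hS.eq, dotProduct_comm]

theorem quadVal_add {S : Matrix (Fin k) (Fin k) R} (hS : S.IsSymm) (x y : Fin k → R) :
    quadVal S (x + y) = quadVal S x + 2 * dotProduct x (S.mulVec y) + quadVal S y := by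
  simp only [quadVal, Matrix.mulVec_add, dotProduct_add, add_dotProduct]
  rw [dotProduct_mulVec_comm hS y x]; ring

theorem quadVal_smul (S : Matrix (Fin k) (Fin k) R) (t : R) (x : Fin k → R) :
    quadVal S (t • x) = t ^ 2 * quadVal S x := by
  simp only [quadVal, Matrix.mulVec_smul, dotProduct_smul, smul_dotProduct, smul_eq_mul]; ring

theorem map_dotProduct_mulVec {R' : Type*} [CommRing R'] (f : R →+* R') (S : Matrix (Fin k) (Fin k) R)
    (x y : Fin k → R) : f (dotProduct x (S.mulVec y)) =
      dotProduct (fun i => f (x i)) ((S.map f).mulVec fun i => f (y i)) := by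
  simp [dotProduct, Matrix.mulVec]

theorem intCast_dotProduct_mulVec (S : Matrix (Fin k) (Fin k) ℤ) (x y : Fin k → ℤ) :
    ((dotProduct x (S.mulVec y) : ℤ) : R) =
      dotProduct (fun i => (x i : R)) ((S.map (Int.cast : ℤ → R)).mulVec fun i => (y i : R)) :=
  map_dotProduct_mulVec (Int.castRingHom R) S x y

theorem intCast_quadVal (S : Matrix (Fin k) (Fin k) ℤ) (x : Fin k → ℤ) :
    ((quadVal S x : ℤ) : R) = quadVal (S.map (Int.cast : ℤ → R)) (fun i => (x i : R)) :=
  intCast_dotProduct_mulVec S x x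

/-- Completing the square: as `SC = c` and `4bc = -1`, a shift by `-2Cm` creates precisely the
linear term `m · r`. -/
theorem quadVal_sub_two_mul {S C : Matrix (Fin k) (Fin k) R} (hS : S.IsSymm) {c b : R}
    (hSC : S * C = c • (1 : Matrix (Fin k) (Fin k) R)) (hb : b * (4 * c) = -1) (r m : Fin k → R) :
    b * quadVal S (r + -(2 : R) • C.mulVec m) =
      b * quadVal S r + dotProduct m r - quadVal C m := by
  have h1 : S.mulVec (C.mulVec m) = c • m := by
    rw [Matrix.mulVec_mulVec, hSC, Matrix.smul_mulVec, Matrix.one_mulVec]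
  have h2 : quadVal S (C.mulVec m) = c * quadVal C m := by
    rw [quadVal, h1, dotProduct_smul, quadVal, dotProduct_comm, smul_eq_mul]
  rw [quadVal_add hS, quadVal_smul, h2, Matrix.mulVec_smul, h1, dotProduct_smul, dotProduct_smul,
    dotProduct_comm r m, smul_eq_mul, smul_eq_mul]
  linear_combination (quadVal C m - dotProduct m r) * hb

end QuadraticForm

section Theta

variable {k : ℕ}

theorem sum_sq_eq_quadVal (P : Matrix (Fin k) (Fin k) ℝ) (x : Fin k → ℝ) :
    ∑ i, (P.mulVec x) i ^ 2 = quadVal (P.transpose * P) x := by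
  rw [quadVal, ← Matrix.mulVec_mulVec, Matrix.dotProduct_mulVec, Matrix.vecMul_transpose]
  simp [dotProduct, sq]

/-- The quotient-remainder decomposition of integral vectors modulo `D`. -/
def residueEquiv (k D : ℕ) [NeZero D] : (Fin k → ZMod D) × (Fin k → ℤ) ≃ (Fin k → ℤ) where
  toFun x := fun i => (x.1 i).val + D * x.2 i
  invFun n := (fun i => (n i : ZMod D), fun i => n i / D)
  left_inv x := by
    have hD : (D : ℤ) ≠ 0 := by exact_mod_cast NeZero.ne D
    ext i
    · simp
    · have h1 : ((x.1 i).val : ℤ) / D = 0 :=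
        Int.ediv_eq_zero_of_lt (by positivity) (by exact_mod_cast ZMod.val_lt _)
      simp only
      rw [Int.add_mul_ediv_left _ _ hD, h1, zero_add]
  right_inv n := by
    funext i
    simp only
    rw [ZMod.val_intCast, Int.emod_add_mul_ediv]

/-- The theta series `∑ e^{2πi |P(h + n)|² z}` over integral vectors `n`. -/
noncomputable def thetaVec (P : Matrix (Fin k) (Fin k) ℝ) (h : Fin k → ℝ) (z : ℂ) : ℂ :=
  ∑' n : Fin k → ℤ, gaussian P z (h + toReal n)

/-- The Gauss sum `∑_r e(b r^t S r / D)` over vectors `r` modulo `D`. -/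
noncomputable def quadGaussSum (D : ℕ) [NeZero D] (S : Matrix (Fin k) (Fin k) ℤ) (b : ℤ) : ℂ :=
  ∑ r : Fin k → ZMod D, ZMod.stdAddChar ((b : ZMod D) * quadVal (S.map (Int.cast : ℤ → ZMod D)) r)

theorem thetaVec_eq_sum {P : Matrix (Fin k) (Fin k) ℝ} (hP : P.det ≠ 0) (h : Fin k → ℝ) {z : ℂ}
    (hz : 0 < z.im) (D : ℕ) [NeZero D] :
    thetaVec P h z = ∑ r : Fin k → ZMod D, ∑' l : Fin k → ℤ,
      gaussian P z (h + toReal (residueEquiv k D (r, l))) := by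
  have hs := summable_gaussian hP hz h
  rw [thetaVec, ← (residueEquiv k D).tsum_eq]
  have hs' := (residueEquiv k D).summable_iff.mpr hs
  exact hs'.tsum_prod.trans (tsum_fintype _)

theorem stdAddChar_intCast_eq (D : ℕ) [NeZero D] (j : ℤ) :
    ZMod.stdAddChar (j : ZMod D) = Complex.exp (2 * Real.pi * Complex.I * (j / D : ℂ)) := by
  rw [ZMod.stdAddChar_coe]; congr 1; ring

/-- Data of an integral symmetric matrix `S = PᵗP` together with a matrix `C` such that `SC` is the
scalar matrix `c` and a vector `h` with `S h` and `hᵗ S h` integral. -/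
structure ThetaDatum (S C : Matrix (Fin k) (Fin k) ℤ) (P : Matrix (Fin k) (Fin k) ℝ) (c : ℤ)
    (h : Fin k → ℝ) : Prop where
  map_eq : S.map (Int.cast : ℤ → ℝ) = P.transpose * P
  det_ne_zero : P.det ≠ 0
  mul_eq : S * C = c • (1 : Matrix (Fin k) (Fin k) ℤ)
  exists_mulVec_eq : ∃ w : Fin k → ℤ, (S.map (Int.cast : ℤ → ℝ)).mulVec h = toReal w
  exists_quadVal_eq : ∃ t : ℤ, quadVal (S.map (Int.cast : ℤ → ℝ)) h = t

variable {S C : Matrix (Fin k) (Fin k) ℤ} {P : Matrix (Fin k) (Fin k) ℝ} {c' : ℤ} {h : Fin k → ℝ}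

theorem ThetaDatum.isSymm (T : ThetaDatum S C P c' h) : S.IsSymm := by
  have h1 : (S.map (Int.cast : ℤ → ℝ)).transpose = S.map (Int.cast : ℤ → ℝ) := by
    rw [T.map_eq]; simp
  ext i j
  have := congrFun (congrFun h1 i) j
  simpa using this

theorem ThetaDatum.gaussian_eq (T : ThetaDatum S C P c' h) (z : ℂ) (x : Fin k → ℝ) :
    gaussian P z x =
      Complex.exp (2 * Real.pi * Complex.I * (quadVal (S.map (Int.cast : ℤ → ℝ)) x : ℝ) * z) := by
  rw [gaussian, sum_sq_eq_quadVal, ← T.map_eq]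

/-- The vector is expanded in two ways. As `r + D(h + l)` it has a value congruent to that of `r`
modulo `D`, by the integrality of `Sh` and `hᵗSh`, so the phase at `b/D` depends on `r` alone. As
`D(h + r/D + l)` it has `D²` times the value of a shifted integral vector, which handles `w`. -/
theorem ThetaDatum.gaussian_residue (T : ThetaDatum S C P c' h) (D : ℕ) [NeZero D] (b : ℤ) (w : ℂ)
    (r : Fin k → ZMod D) (l : Fin k → ℤ) :
    gaussian P (b / D + w) ((D : ℝ) • h + toReal (residueEquiv k D (r, l))) =
      ZMod.stdAddChar ((b : ZMod D) * quadVal (S.map (Int.cast : ℤ → ZMod D)) r) *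
        gaussian P (D ^ 2 * w) ((h + (D : ℝ)⁻¹ • toReal fun i => (r i).val) + toReal l) := by
  obtain ⟨v, hv⟩ := T.exists_mulVec_eq
  obtain ⟨t, ht⟩ := T.exists_quadVal_eq
  have hD : (D : ℝ) ≠ 0 := by exact_mod_cast NeZero.ne D
  have hDc : (D : ℂ) ≠ 0 := by exact_mod_cast NeZero.ne D
  set r' : Fin k → ℤ := fun i => (r i).val with hr'
  set SR := S.map (Int.cast : ℤ → ℝ) with hSR
  have hsymm : SR.IsSymm := by
    rw [hSR, Matrix.IsSymm, ← Matrix.transpose_map, T.isSymm.eq]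
  have hx1 : (D : ℝ) • h + toReal (residueEquiv k D (r, l)) =
      (D : ℝ) • ((h + (D : ℝ)⁻¹ • toReal r') + toReal l) := by
    funext i
    simp [residueEquiv, toReal, hr']
    field_simp
    ring
  have hx2 : (D : ℝ) • h + toReal (residueEquiv k D (r, l)) =
      toReal r' + (D : ℝ) • (h + toReal l) := by
    funext i
    simp [residueEquiv, toReal, hr']
    ring
  have hq1 : quadVal SR ((D : ℝ) • h + toReal (residueEquiv k D (r, l))) =
      (D : ℝ) ^ 2 * quadVal SR ((h + (D : ℝ)⁻¹ • toReal r') + toReal l) := by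
    rw [hx1, quadVal_smul]
  have hi1 : dotProduct (toReal r') (SR.mulVec (h + toReal l)) =
      ((dotProduct r' v + dotProduct r' (S.mulVec l) : ℤ) : ℝ) := by
    rw [Matrix.mulVec_add, hv, dotProduct_add]
    push_cast
    rw [intCast_dotProduct_mulVec]
    congr 1
    simp [dotProduct]
  have hi2 : quadVal SR (h + toReal l) = ((t + 2 * dotProduct l v + quadVal S l : ℤ) : ℝ) := by
    rw [quadVal_add hsymm, ht, dotProduct_mulVec_comm hsymm, hv]
    push_cast
    rw [intCast_quadVal]
    congr 2
    simp [dotProduct]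
  have hq2 : quadVal SR ((D : ℝ) • h + toReal (residueEquiv k D (r, l))) =
      ((quadVal S r' + D * (2 * (dotProduct r' v + dotProduct r' (S.mulVec l)) +
        D * (t + 2 * dotProduct l v + quadVal S l)) : ℤ) : ℝ) := by
    rw [hx2, quadVal_add hsymm, Matrix.mulVec_smul, dotProduct_smul, hi1, quadVal_smul, hi2]
    push_cast
    rw [intCast_quadVal, intCast_quadVal]
    simp only [smul_eq_mul]
    ring
  have hr : quadVal (S.map (Int.cast : ℤ → ZMod D)) r = ((quadVal S r' : ℤ) : ZMod D) := by
    rw [intCast_quadVal]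
    congr 1
    funext i; simp [hr']
  rw [T.gaussian_eq, T.gaussian_eq, mul_add, Complex.exp_add, hr, ← Int.cast_mul,
    stdAddChar_intCast_eq]
  congr 1
  · rw [hq2]
    apply Complex.exp_eq_exp_iff_exists_int.mpr
    refine ⟨b * (2 * (dotProduct r' v + dotProduct r' (S.mulVec l)) +
        D * (t + 2 * dotProduct l v + quadVal S l)), ?_⟩
    push_cast
    field_simp
  · rw [hq1, ← hSR]
    push_cast
    ring_nf

/-- The dual form `S⁻¹` scaled by `c` is `C`; its integral values make the phases on the dual side
roots of unity of order dividing `D`. -/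
theorem ThetaDatum.mul_sum_sq_inv (T : ThetaDatum S C P c' h) (m : Fin k → ℤ) :
    (c' : ℝ) * ∑ i, (P⁻¹.transpose.mulVec (toReal m)) i ^ 2 = ((quadVal C m : ℤ) : ℝ) := by
  have hu := isUnit_iff_ne_zero.mpr T.det_ne_zero
  have hut : IsUnit P.transpose.det := by rwa [Matrix.det_transpose]
  have h1 : (c' : ℝ) • (P⁻¹ * P.transpose⁻¹) = C.map (Int.cast : ℤ → ℝ) := by
    have h2 := congrArg (fun M : Matrix (Fin k) (Fin k) ℤ => M.map (Int.castRingHom ℝ)) T.mul_eq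
    simp only [Matrix.map_mul] at h2
    have h3 : ((c' • (1 : Matrix (Fin k) (Fin k) ℤ)).map (Int.castRingHom ℝ)) =
        (c' : ℝ) • (1 : Matrix (Fin k) (Fin k) ℝ) := by
      ext i j
      simp only [Matrix.map_apply, Matrix.smul_apply, Matrix.one_apply]
      split_ifs <;> simp
    rw [h3] at h2
    have h4 : P.transpose * P * C.map (Int.cast : ℤ → ℝ) = (c' : ℝ) • 1 := by
      rw [← T.map_eq]; exact h2
    calc (c' : ℝ) • (P⁻¹ * P.transpose⁻¹) = P⁻¹ * P.transpose⁻¹ * ((c' : ℝ) • 1) := by simp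
      _ = P⁻¹ * (P.transpose⁻¹ * P.transpose) * P * C.map (Int.cast : ℤ → ℝ) := by
          rw [← h4]; simp only [Matrix.mul_assoc]
      _ = _ := by
          rw [Matrix.nonsing_inv_mul _ hut, Matrix.mul_one, Matrix.nonsing_inv_mul _ hu,
            Matrix.one_mul]
  rw [sum_sq_eq_quadVal, Matrix.transpose_transpose, Matrix.transpose_nonsing_inv, intCast_quadVal,
    ← h1]
  simp only [quadVal, Matrix.smul_mulVec, dotProduct_smul, smul_eq_mul]

/-- Both `-2ix` and `-2iz` lie in the right half plane, so the root of their quotient `u` splits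
without a sign. -/
theorem sqrt_inv_eq {x z u : ℂ} (hx : 0 < x.im) (hz : 0 < z.im) (hu : u * x = z) :
    ((-2 * Complex.I * x)⁻¹) ^ (1 / 2 : ℂ) =
      u ^ (1 / 2 : ℂ) * ((-2 * Complex.I * z)⁻¹) ^ (1 / 2 : ℂ) := by
  have hx0 : x ≠ 0 := by rintro rfl; simp at hx
  have hz0 : z ≠ 0 := by rintro rfl; simp at hz
  have hre : ∀ w : ℂ, 0 < w.im → |(-2 * Complex.I * w).arg| < Real.pi / 2 := by
    intro w hw
    rw [Complex.abs_arg_lt_pi_div_two_iff]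
    left
    simp [Complex.mul_re, hw]
  have hne : ∀ w : ℂ, w ≠ 0 → -2 * Complex.I * w ≠ 0 := fun w hw => by simp [hw]
  have hpi := Real.pi_pos
  have h1 := abs_lt.mp (hre x hx)
  have h2 := abs_lt.mp (hre z hz)
  have hinv : (-2 * Complex.I * x)⁻¹.arg = -(-2 * Complex.I * x).arg := by
    rw [Complex.arg_inv, if_neg (by linarith)]
  have hkey : u ^ (1 / 2 : ℂ) =
      ((-2 * Complex.I * x)⁻¹) ^ (1 / 2 : ℂ) * (-2 * Complex.I * z) ^ (1 / 2 : ℂ) := by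
    rw [← sqrt_mul_of_arg_add_mem (inv_ne_zero (hne x hx0)) (hne z hz0)]
    · congr 1
      rw [← hu]
      have := Complex.I_ne_zero
      field_simp
    · rw [hinv]
      constructor <;> linarith [h1.1, h1.2, h2.1, h2.2]
  have hn : (-2 * Complex.I * z) ^ (1 / 2 : ℂ) ≠ 0 := by
    rw [Complex.cpow_def_of_ne_zero (hne z hz0)]
    exact Complex.exp_ne_zero _
  rw [hkey, Complex.inv_cpow _ _ (by linarith : (-2 * Complex.I * z).arg ≠ Real.pi),
    mul_inv_cancel_right₀ hn]

end Theta

/-! ### Transformation of theta series with a positive lower right entry -/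

section Transformation

variable {k : ℕ} {S C : Matrix (Fin k) (Fin k) ℤ} {P : Matrix (Fin k) (Fin k) ℝ} {c' : ℤ}
  {h : Fin k → ℝ}

/-- By `quadVal_sub_two_mul` the extra phases amount to a translation of the summation variable. The
twisted sum is therefore independent of `m` and can be taken out of the dual theta series. -/
theorem ThetaDatum.sum_stdAddChar (T : ThetaDatum S C P c' h) (D : ℕ) [NeZero D] {b : ℤ}
    (hb : (b : ZMod D) * (4 * (c' : ZMod D)) = -1) (m : Fin k → ℤ) :
    ∑ r : Fin k → ZMod D, ZMod.stdAddChar ((b : ZMod D) * quadVal (S.map (Int.cast : ℤ → ZMod D)) r) *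
      (Complex.exp (-(2 * Real.pi * Complex.I * ((quadVal C m : ℤ) / D : ℂ))) *
        Complex.exp (2 * Real.pi * Complex.I * ((∑ i, m i * ((r i).val : ℤ) : ℤ) / D : ℂ))) =
      quadGaussSum D S b := by
  have hSC : S.map (Int.cast : ℤ → ZMod D) * C.map (Int.cast : ℤ → ZMod D) =
      (c' : ZMod D) • (1 : Matrix (Fin k) (Fin k) (ZMod D)) := by
    have h2 := congrArg (fun M : Matrix (Fin k) (Fin k) ℤ => M.map (Int.castRingHom (ZMod D))) T.mul_eq
    simp only [Matrix.map_mul] at h2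
    refine h2.trans ?_
    ext i j
    simp only [Matrix.map_apply, Matrix.smul_apply, Matrix.one_apply]
    split_ifs <;> simp
  have hsymm : (S.map (Int.cast : ℤ → ZMod D)).IsSymm := by
    rw [Matrix.IsSymm, ← Matrix.transpose_map, T.isSymm.eq]
  refine Eq.trans (Finset.sum_congr rfl fun r _ => ?_) (Equiv.sum_comp (Equiv.addRight
    (-(2 : ZMod D) • (C.map (Int.cast : ℤ → ZMod D)).mulVec fun i => (m i : ZMod D)))
    fun r => ZMod.stdAddChar ((b : ZMod D) * quadVal (S.map (Int.cast : ℤ → ZMod D)) r))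
  rw [Equiv.coe_addRight, quadVal_sub_two_mul hsymm hSC hb, ← mul_neg, ← Complex.exp_add,
    ← mul_add, ← neg_div, ← add_div, sub_eq_add_neg, add_assoc, AddChar.map_add_eq_mul]
  congr 1
  rw [← Int.cast_neg, ← Int.cast_add, ← stdAddChar_intCast_eq]
  congr 1
  push_cast
  rw [intCast_quadVal, add_comm]
  congr 1
  simp [dotProduct]

/-- With `J = cz + D` one has `γz = b/D + w`, where `w = z/(DJ)`. The residue classes modulo `D`
contribute Gaussians at `D²w`, whose Poisson dual is at `-1/(4D²w) = -c'/D - 1/(4z)`. The phase from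
`-c'/D` and the one from the shift `r/D` combine with the quadratic phase to the Gauss sum, and what
remains is the Poisson dual of the theta series at `z`. -/
theorem ThetaDatum.thetaVec_smul (T : ThetaDatum S C P c' h) {γ : SL(2, ℤ)}
    (hc : γ 1 0 = 4 * c') (D : ℕ) [NeZero D] (hd : γ 1 1 = D) (z : ℍ) :
    thetaVec P ((D : ℝ) • h) (γ • z : ℍ) = quadGaussSum D S (γ 0 1) *
      ((((γ 1 0 : ℤ) * (z : ℂ) + (γ 1 1 : ℤ)) / D) ^ (1 / 2 : ℂ)) ^ k * thetaVec P h z := by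
  have hD : (D : ℝ) ≠ 0 := by exact_mod_cast NeZero.ne D
  have hDc : (D : ℂ) ≠ 0 := by exact_mod_cast NeZero.ne D
  have hz0 : (z : ℂ) ≠ 0 := z.ne_zero
  have hrow := row_ne_zero γ z
  set J := ((γ 1 0 : ℤ) * (z : ℂ) + (γ 1 1 : ℤ)) with hJ
  have hdet := det_eq γ
  have hdetc : ((γ 0 0 : ℤ) : ℂ) * D - (γ 0 1 : ℤ) * (γ 1 0 : ℤ) = 1 := by
    rw [hd] at hdet; exact_mod_cast hdet
  set w : ℂ := z / (D * J) with hw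
  have hsm : ((γ • z : ℍ) : ℂ) = (γ 0 1 : ℤ) / D + w := by
    rw [smul_coe, ← hJ, hw]
    field_simp
    rw [hJ, hd]
    push_cast
    linear_combination (z : ℂ) * hdetc
  have hx : 0 < ((D : ℂ) ^ 2 * w).im := by
    have h1 : (D : ℂ) ^ 2 * w = ((D ^ 2 : ℝ) : ℂ) * ((γ • z : ℍ) : ℂ) - ((D * γ 0 1 : ℝ) : ℂ) := by
      rw [hsm]; push_cast; field_simp; ring
    rw [h1, Complex.sub_im, Complex.im_ofReal_mul, Complex.ofReal_im, sub_zero]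
    have := (γ • z).im_pos
    have h2 : (0 : ℝ) < D := by exact_mod_cast Nat.pos_of_ne_zero (NeZero.ne D)
    exact mul_pos (by positivity) this
  have hbmod : ((γ 0 1 : ℤ) : ZMod D) * (4 * (c' : ZMod D)) = -1 := by
    have h1 : ((γ 0 0 : ℤ) : ZMod D) * (D : ZMod D) - (γ 0 1 : ℤ) * (γ 1 0 : ℤ) = 1 := by
      rw [hd] at hdet; exact_mod_cast congrArg (Int.cast : ℤ → ZMod D) hdet
    rw [ZMod.natCast_self, mul_zero, zero_sub, hc] at h1
    push_cast at h1
    linear_combination -h1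
  have hfinv : -1 / (4 * ((D : ℂ) ^ 2 * w)) = -(c' : ℂ) / D + -1 / (4 * z) := by
    rw [hw]
    field_simp
    rw [hJ, hc, hd]
    push_cast
    ring
  have hg : ∀ m : Fin k → ℤ, gaussian P⁻¹.transpose (-1 / (4 * ((D : ℂ) ^ 2 * w))) (toReal m) =
      Complex.exp (-(2 * Real.pi * Complex.I * ((quadVal C m : ℤ) / D : ℂ))) *
        gaussian P⁻¹.transpose (-1 / (4 * z)) (toReal m) := by
    intro m
    have h1 := congrArg (fun t : ℝ => (t : ℂ)) (T.mul_sum_sq_inv m)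
    simp only [gaussian]
    rw [hfinv, mul_add, Complex.exp_add]
    congr 2
    rw [show (((quadVal C m : ℤ) : ℂ)) = (((quadVal C m : ℤ) : ℝ) : ℂ) by push_cast; rfl, ← h1]
    push_cast
    field_simp
  have hexp : ∀ (m : Fin k → ℤ) (r : Fin k → ZMod D),
      Complex.exp (2 * Real.pi * Complex.I * ∑ i, (m i : ℂ) *
        ((h + (D : ℝ)⁻¹ • toReal fun i => ((r i).val : ℤ)) i : ℝ)) =
      Complex.exp (2 * Real.pi * Complex.I * ((∑ i, m i * ((r i).val : ℤ) : ℤ) / D : ℂ)) *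
        Complex.exp (2 * Real.pi * Complex.I * ∑ i, (m i : ℂ) * h i) := by
    intro m r
    rw [← Complex.exp_add, ← mul_add]
    congr 2
    push_cast
    rw [Finset.sum_div, ← Finset.sum_add_distrib]
    refine Finset.sum_congr rfl fun i _ => ?_
    simp only [toReal, Pi.add_apply, Pi.smul_apply, smul_eq_mul]
    push_cast
    field_simp
    ring
  have hP' : P⁻¹.transpose.det ≠ 0 := by
    rw [Matrix.det_transpose]
    exact ((Matrix.isUnit_nonsing_inv_det_iff).mpr (isUnit_iff_ne_zero.mpr T.det_ne_zero)).ne_zero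
  have hsum : Summable fun m : Fin k → ℤ => gaussian P⁻¹.transpose (-1 / (4 * (z : ℂ))) (toReal m) := by
    simpa using summable_gaussian hP' (neg_inv_four_mul_im_pos z.im_pos) 0
  have hnexp : ∀ t : ℝ, ‖Complex.exp (2 * Real.pi * Complex.I * t)‖ = 1 := by
    intro t
    rw [show (2 * Real.pi * Complex.I * t : ℂ) = ((2 * Real.pi * t : ℝ) : ℂ) * Complex.I by
      push_cast; ring, Complex.norm_exp_ofReal_mul_I]
  rw [thetaVec_eq_sum T.det_ne_zero _ (γ • z).im_pos D, hsm]
  simp_rw [T.gaussian_residue, tsum_mul_left, tsum_gaussian T.det_ne_zero hx, hg, hexp]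
  rw [thetaVec, tsum_gaussian T.det_ne_zero z.im_pos,
    sqrt_inv_eq hx z.im_pos (u := J / D) (by rw [hw]; field_simp)]
  have hswap : ∑ r : Fin k → ZMod D, ZMod.stdAddChar (((γ 0 1 : ℤ) : ZMod D) *
      quadVal (S.map (Int.cast : ℤ → ZMod D)) r) * ∑' m : Fin k → ℤ,
      Complex.exp (-(2 * Real.pi * Complex.I * ((quadVal C m : ℤ) / D : ℂ))) *
        gaussian P⁻¹.transpose (-1 / (4 * z)) (toReal m) *
        (Complex.exp (2 * Real.pi * Complex.I * ((∑ i, m i * ((r i).val : ℤ) : ℤ) / D : ℂ)) *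
        Complex.exp (2 * Real.pi * Complex.I * ∑ i, (m i : ℂ) * h i)) =
      quadGaussSum D S (γ 0 1) * ∑' m : Fin k → ℤ,
        gaussian P⁻¹.transpose (-1 / (4 * z)) (toReal m) *
        Complex.exp (2 * Real.pi * Complex.I * ∑ i, (m i : ℂ) * h i) := by
    simp_rw [← tsum_mul_left]
    rw [← Summable.tsum_finsetSum]
    · congr 1; funext m
      rw [← T.sum_stdAddChar D hbmod m, Finset.sum_mul]
      refine Finset.sum_congr rfl fun r _ => ?_
      ring
    · intro r _
      apply Summable.mul_left
      refine Summable.of_norm (hsum.norm.congr fun m => ?_)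
      have e1 := hnexp (-((quadVal C m : ℤ) / D : ℝ))
      have e2 := hnexp ((∑ i, m i * ((r i).val : ℤ) : ℤ) / D : ℝ)
      have e3 := hnexp (∑ i, (m i : ℝ) * h i)
      push_cast at e1 e2 e3 ⊢
      rw [mul_neg] at e1
      simp only [norm_mul]
      rw [e1, e2, e3]
      ring
  rw [mul_pow]
  generalize ((|P.det|⁻¹ : ℝ) : ℂ) = A
  simp_rw [← mul_assoc _ (A * _), mul_comm _ (A * _), mul_assoc (A * _)]
  rw [← Finset.mul_sum, hswap]
  ring

end Transformation

/-! ### Quadratic Gauss sums modulo a prime -/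

section GaussSum

variable (p : ℕ) [Fact p.Prime]

/-- The quadratic character modulo `p` with complex values. -/
noncomputable def quadChar : MulChar (ZMod p) ℂ := (quadraticChar (ZMod p)).ringHomComp (Int.castRingHom ℂ)

theorem quadChar_apply (x : ZMod p) : quadChar p x = (quadraticChar (ZMod p) x : ℂ) := rfl

theorem quadChar_intCast (x : ℤ) : quadChar p (x : ZMod p) = (J(x | p) : ℂ) := by
  rw [quadChar_apply, ← jacobiSym.legendreSym.to_jacobiSym, legendreSym]

/-- The quadratic Gauss sum modulo `p`. -/
noncomputable def primeGaussSum : ℂ := gaussSum (quadChar p) ZMod.stdAddChar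

theorem sum_quadChar_mul_stdAddChar (hp : p ≠ 2) (n : ZMod p) :
    ∑ x : ZMod p, quadChar p x * ZMod.stdAddChar (n * x) = quadChar p n * primeGaussSum p := by
  by_cases hn : n = 0
  · subst hn
    have h1 : ∑ x : ZMod p, quadChar p x = 0 := by
      have := quadraticChar_sum_zero (F := ZMod p) (by rwa [ZMod.ringChar_zmod_n])
      simp only [quadChar_apply]
      exact_mod_cast this
    simp [h1, MulChar.map_zero]
  · have h := gaussSum_mulShift (quadChar p) ZMod.stdAddChar (Units.mk0 n hn)
    have hsq : quadChar p n * quadChar p n = 1 := by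
      rw [quadChar_apply]
      have := quadraticChar_sq_one hn
      rw [sq] at this
      exact_mod_cast this
    rw [primeGaussSum, ← h, Units.val_mk0, ← mul_assoc, hsq, one_mul]
    simp [gaussSum, AddChar.mulShift_apply]

/-- Group by squares: `x` has `1 + (x/p)` square roots, and the constant `1` is killed by
orthogonality. -/
theorem sum_stdAddChar_sq (hp : p ≠ 2) {b : ZMod p} (hb : b ≠ 0) :
    ∑ t : ZMod p, ZMod.stdAddChar (b * t ^ 2) = quadChar p b * primeGaussSum p := by
  have h1 : ∑ t : ZMod p, ZMod.stdAddChar (b * t ^ 2) =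
      ∑ x : ZMod p, (quadChar p x + 1) * ZMod.stdAddChar (b * x) := by
    rw [← Finset.sum_fiberwise (s := Finset.univ) (g := fun t : ZMod p => t ^ 2)]
    refine Finset.sum_congr rfl fun x _ => ?_
    rw [Finset.sum_congr rfl (g := fun _ => ZMod.stdAddChar (b * x)), Finset.sum_const, nsmul_eq_mul]
    · congr 1
      have := quadraticChar_card_sqrts (F := ZMod p) (by rwa [ZMod.ringChar_zmod_n]) x
      rw [quadChar_apply]
      have h2 : (Finset.univ.filter fun t : ZMod p => t ^ 2 = x).card = {t : ZMod p | t ^ 2 = x}.toFinset.card := by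
        congr 1; ext; simp
      rw [h2]
      exact_mod_cast this
    · intro t ht
      rw [(Finset.mem_filter.mp ht).2]
  have h2 : ∑ x : ZMod p, (ZMod.stdAddChar (b * x) : ℂ) = 0 := by
    have := AddChar.sum_mulShift (R := ZMod p) (R' := ℂ) b (ZMod.isPrimitive_stdAddChar p)
    rw [if_neg hb, Nat.cast_zero] at this
    rw [← this]
    refine Finset.sum_congr rfl fun x _ => by rw [mul_comm]
  rw [h1]
  simp only [add_mul, one_mul, Finset.sum_add_distrib]
  rw [h2, add_zero, sum_quadChar_mul_stdAddChar p hp]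

theorem exists_diagonal {k : ℕ} (hp : p ≠ 2) {S : Matrix (Fin k) (Fin k) (ZMod p)} (hS : S.IsSymm) :
    ∃ (M : Matrix (Fin k) (Fin k) (ZMod p)) (w : Fin k → ZMod p), IsUnit M.det ∧
      M.transpose * S * M = Matrix.diagonal w := by
  have h2 : IsUnit (2 : ZMod p) := by
    rw [isUnit_iff_ne_zero]
    exact Ring.two_ne_zero (by rwa [ZMod.ringChar_zmod_n])
  let : Invertible (2 : ZMod p) := h2.invertible
  have hB : LinearMap.IsSymm (Matrix.toBilin' S) := by
    constructor
    intro x y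
    simp only [Matrix.toBilin'_apply', RingHom.id_apply]
    exact (dotProduct_mulVec_comm hS _ _).symm
  obtain ⟨v, hv⟩ := LinearMap.BilinForm.exists_orthogonal_basis hB
  have hk : Module.finrank (ZMod p) (Fin k → ZMod p) = k := by simp
  set v' := v.reindex (finCongr hk) with hv'
  refine ⟨(Pi.basisFun (ZMod p) (Fin k)).toMatrix v', fun i => Matrix.toBilin' S (v' i) (v' i), ?_, ?_⟩
  · have := (Pi.basisFun (ZMod p) (Fin k)).invertibleToMatrix v'
    exact (Matrix.isUnit_iff_isUnit_det _).mp (isUnit_of_invertible _)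
  · ext i j
    have h3 : (((Pi.basisFun (ZMod p) (Fin k)).toMatrix v').transpose * S *
        (Pi.basisFun (ZMod p) (Fin k)).toMatrix v') i j = Matrix.toBilin' S (v' i) (v' j) := by
      rw [Matrix.toBilin'_apply', Matrix.mul_assoc, Matrix.mul_apply]
      simp [dotProduct, Matrix.mulVec, Matrix.mul_apply, Module.Basis.toMatrix_apply]
    rw [h3, Matrix.diagonal_apply]
    split_ifs with hij
    · rw [hij]
    · have := hv (i := (finCongr hk).symm i) (j := (finCongr hk).symm j) (by simpa using hij)
      simpa [hv'] using this

theorem addChar_sum {ι A : Type*} [AddCommMonoid A] (φ : AddChar A ℂ) (s : Finset ι) (f : ι → A) :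
    φ (∑ i ∈ s, f i) = ∏ i ∈ s, φ (f i) := by
  classical
  induction s using Finset.induction_on with
  | empty => simp
  | insert i s hi ih => rw [Finset.sum_insert hi, Finset.prod_insert hi, AddChar.map_add_eq_mul, ih]

/-- In orthogonal coordinates the sum is a product of one-variable sums. The product of the diagonal
entries is `det S` times the square of the determinant of the base change, so their symbols multiply
to that of `det S`. -/
theorem quadGaussSum_eq {k : ℕ} (hp : p ≠ 2) {S : Matrix (Fin k) (Fin k) ℤ} (hS : S.IsSymm) {b : ℤ}
    (hb : ((b : ℤ) : ZMod p) ≠ 0) (hdet : ((S.det : ℤ) : ZMod p) ≠ 0) :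
    quadGaussSum p S b = (J(S.det | p) : ℂ) * (quadChar p b * primeGaussSum p) ^ k := by
  have hS' : (S.map (Int.cast : ℤ → ZMod p)).IsSymm := by
    rw [Matrix.IsSymm, ← Matrix.transpose_map, hS.eq]
  obtain ⟨M, w, hM, hMw⟩ := exists_diagonal p hp hS'
  have hdet' : (S.map (Int.cast : ℤ → ZMod p)).det = ((S.det : ℤ) : ZMod p) :=
    ((Int.castRingHom (ZMod p)).map_det S).symm
  have hprod : M.det ^ 2 * ((S.det : ℤ) : ZMod p) = ∏ i, w i := by
    have := congrArg Matrix.det hMw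
    rw [Matrix.det_mul, Matrix.det_mul, Matrix.det_transpose, Matrix.det_diagonal, hdet'] at this
    rw [← this]; ring
  have hw : ∀ i, w i ≠ 0 := by
    intro i
    have : ∏ i, w i ≠ 0 := by
      rw [← hprod]; exact mul_ne_zero (pow_ne_zero _ hM.ne_zero) hdet
    exact Finset.prod_ne_zero_iff.mp this i (Finset.mem_univ i)
  have hchar : ∏ i, quadChar p (w i) = (J(S.det | p) : ℂ) := by
    rw [← map_prod, ← hprod, map_mul, map_pow, quadChar_intCast]
    have : quadChar p M.det ^ 2 = 1 := by
      rw [quadChar_apply]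
      exact_mod_cast quadraticChar_sq_one hM.ne_zero
    rw [this, one_mul]
  have hbij : Function.Bijective M.mulVec := by
    rw [← Finite.injective_iff_bijective]
    exact Matrix.mulVec_injective_iff_isUnit.mpr ((Matrix.isUnit_iff_isUnit_det _).mpr hM)
  rw [quadGaussSum, ← hbij.sum_comp]
  have hq : ∀ y, quadVal (S.map (Int.cast : ℤ → ZMod p)) (M.mulVec y) = ∑ i, w i * y i ^ 2 := by
    intro y
    rw [quadVal, Matrix.mulVec_mulVec, ← Matrix.vecMul_transpose, ← Matrix.dotProduct_mulVec,
      Matrix.mulVec_mulVec, ← Matrix.mul_assoc, hMw, dotProduct]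
    refine Finset.sum_congr rfl fun i _ => ?_
    rw [Matrix.mulVec_diagonal]; ring
  simp only [hq, Finset.mul_sum, addChar_sum]
  rw [← Fintype.piFinset_univ, ← Finset.prod_univ_sum (fun _ : Fin k => Finset.univ)
    fun i t => (ZMod.stdAddChar ((b : ZMod p) * (w i * t ^ 2)) : ℂ)]
  have : ∀ i, ∑ t : ZMod p, (ZMod.stdAddChar ((b : ZMod p) * (w i * t ^ 2)) : ℂ) =
      quadChar p (w i) * (quadChar p b * primeGaussSum p) := by
    intro i
    simp only [← mul_assoc]
    rw [sum_stdAddChar_sq p hp (mul_ne_zero hb (hw i)), map_mul]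
    ring
  simp only [this]
  rw [Finset.prod_mul_distrib, hchar]
  simp

end GaussSum

/-! ### Prime lower right entry: Gauss sums through the Jacobi theta function -/

section PrimeLevel

variable (p : ℕ) [Fact p.Prime]

theorem thetaDatum_one (c' : ℤ) : ThetaDatum (1 : Matrix (Fin 1) (Fin 1) ℤ) (c' • 1) 1 c' 0 where
  map_eq := by ext i j; simp [Matrix.one_apply]
  det_ne_zero := by simp
  mul_eq := by simp
  exists_mulVec_eq := ⟨0, by ext i; simp [toReal]⟩
  exists_quadVal_eq := ⟨0, by simp [quadVal]⟩

theorem thetaVec_one (z : ℍ) : thetaVec (1 : Matrix (Fin 1) (Fin 1) ℝ) 0 z = thetaZ z := by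
  rw [thetaVec, thetaZ_eq_tsum, ← (Equiv.funUnique (Fin 1) ℤ).tsum_eq]
  congr 1
  funext n
  rw [gaussian]
  simp [toReal]

theorem cpow_half_ne_zero {u : ℂ} (hu : u ≠ 0) : u ^ (1 / 2 : ℂ) ≠ 0 := by
  rw [Complex.cpow_def_of_ne_zero hu]; exact Complex.exp_ne_zero _

theorem sqrt_div_natCast {u : ℂ} (hu : u ≠ 0) (n : ℕ) (hn : n ≠ 0) :
    (u / n) ^ (1 / 2 : ℂ) * (n : ℂ) ^ (1 / 2 : ℂ) = u ^ (1 / 2 : ℂ) := by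
  have hn0 : (n : ℂ) ≠ 0 := by exact_mod_cast hn
  rw [← sqrt_mul_of_arg_add_mem (div_ne_zero hu hn0) hn0]
  · rw [div_mul_cancel₀ _ hn0]
  · rw [Complex.natCast_arg, add_zero]
    exact ⟨Complex.neg_pi_lt_arg _, Complex.arg_le_pi _⟩

theorem det_one_fin_one : (1 : Matrix (Fin 1) (Fin 1) ℤ).det = 1 := by simp

theorem entry_ne_zero_mod {γ : SL(2, ℤ)} (hd : γ 1 1 = p) : ((γ 0 1 : ℤ) : ZMod p) ≠ 0 := by
  intro h
  have h1 := congrArg (Int.cast : ℤ → ZMod p) (det_eq γ)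
  rw [hd] at h1
  push_cast at h1
  rw [h] at h1
  simp at h1

/-- The theta function of the form `n²` obeys both the Gauss sum law `ThetaDatum.thetaVec_smul` and
`thetaZ_smul`; comparing them at `z = i` determines the Gauss sum. -/
theorem quadChar_mul_primeGaussSum (hp : p ≠ 2) {γ : SL(2, ℤ)} (h4 : 4 ∣ γ 1 0) (hd : γ 1 1 = p) :
    quadChar p (γ 0 1 : ℤ) * primeGaussSum p =
      (p : ℂ) ^ (1 / 2 : ℂ) * ((epsilon p)⁻¹ * (kronecker (γ 1 0) p : ℂ)) := by
  obtain ⟨c', hc⟩ := h4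
  have hb := entry_ne_zero_mod p hd
  have h1 := (thetaDatum_one c').thetaVec_smul hc p hd UpperHalfPlane.I
  rw [smul_zero, thetaVec_one, thetaVec_one, quadGaussSum_eq p hp Matrix.isSymm_one hb (by simp),
    det_one_fin_one, jacobiSym.one_left, pow_one, pow_one, thetaZ_smul ⟨c', hc⟩] at h1
  have h2 := mul_right_cancel₀ thetaZ_I_ne_zero h1
  have hr := row_ne_zero γ UpperHalfPlane.I
  have h3 := sqrt_div_natCast hr p (Fact.out : p.Prime).ne_zero
  rw [autFactor, ← h3] at h2
  have h4 := cpow_half_ne_zero (div_ne_zero hr (b := (p : ℂ))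
    (by exact_mod_cast (Fact.out : p.Prime).ne_zero))
  rw [← mul_assoc, mul_right_comm] at h2
  have h5 := mul_right_cancel₀ h4 h2
  rw [hd] at h5
  push_cast at h5
  rw [one_mul] at h5
  rw [← h5]; ring

theorem autFactor_eq_of_prime (hp : p ≠ 2) {γ : SL(2, ℤ)} (h4 : 4 ∣ γ 1 0) (hd : γ 1 1 = p) (z : ℍ) :
    autFactor γ z = quadChar p (γ 0 1 : ℤ) * primeGaussSum p *
      (((γ 1 0 : ℤ) * (z : ℂ) + (γ 1 1 : ℤ)) / p) ^ (1 / 2 : ℂ) := by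
  rw [quadChar_mul_primeGaussSum p hp h4 hd, autFactor,
    ← sqrt_div_natCast (row_ne_zero γ z) p (Fact.out : p.Prime).ne_zero, hd]
  ring

/-- Each of the `k` one-variable Gauss sums absorbs one square root into a copy of Shimura's factor.
-/
theorem ThetaDatum.thetaVec_smul_of_prime {k : ℕ} {S C : Matrix (Fin k) (Fin k) ℤ}
    {P : Matrix (Fin k) (Fin k) ℝ} {c' : ℤ} {h : Fin k → ℝ} (T : ThetaDatum S C P c' h)
    (hp : p ≠ 2) {γ : SL(2, ℤ)} (hc : γ 1 0 = 4 * c') (hd : γ 1 1 = p)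
    (hdet : ((S.det : ℤ) : ZMod p) ≠ 0) (z : ℍ) :
    thetaVec P ((p : ℝ) • h) (γ • z : ℍ) =
      (J(S.det | p) : ℂ) * autFactor γ z ^ k * thetaVec P h z := by
  rw [T.thetaVec_smul hc p hd, quadGaussSum_eq p hp T.isSymm (entry_ne_zero_mod p hd) hdet,
    autFactor_eq_of_prime p hp ⟨c', hc⟩ hd]
  ring

/-- Gauss's evaluation, sign included, read off from one matrix with lower row `(4, p)`. Its upper
right entry `-v` satisfies `-4v ≡ -1` modulo `p`, so its symbol is `χ₄(p)`. -/
theorem primeGaussSum_eq (hp : p ≠ 2) : primeGaussSum p = (p : ℂ) ^ (1 / 2 : ℂ) * epsilon p := by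
  have hodd : Odd p := (Fact.out : p.Prime).odd_of_ne_two hp
  have hcop : IsCoprime (p : ℤ) 4 := by
    have : Nat.Coprime p 4 := by
      rw [show 4 = 2 ^ 2 by norm_num]
      exact (Nat.coprime_pow_right_iff (by norm_num) _ _).mpr (Nat.coprime_two_right.mpr hodd)
    exact_mod_cast Nat.isCoprime_iff_coprime.mpr this
  obtain ⟨u, v, huv⟩ := hcop
  let γ : SL(2, ℤ) := ⟨!![u, -v; 4, p], by rw [Matrix.det_fin_two_of]; linarith⟩
  have h := quadChar_mul_primeGaussSum p hp (γ := γ) ⟨1, rfl⟩ rfl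
  have h01 : γ 0 1 = -v := rfl
  have h10 : γ 1 0 = 4 := rfl
  have hv : J(-v | p) = ZMod.χ₄ p := by
    have h1 : J(-v * 4 | p) = J(-1 | p) := by
      apply jacobiSym.mod_left'
      refine Int.ModEq.symm (n := p) ?_
      rw [Int.modEq_iff_dvd]
      exact ⟨u, by linarith⟩
    rwa [jacobiSym.mul_left, jacobiSym.at_four hodd, mul_one, jacobiSym.at_neg_one hodd] at h1
  rw [h01, h10, quadChar_intCast, hv, kronecker_natCast_right _ hodd, jacobiSym.at_four hodd] at h
  unfold epsilon at h ⊢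
  rcases Nat.odd_mod_four_iff.mp (Nat.odd_iff.mp hodd) with h4 | h4
  · have h5 : (p : ℤ) % 4 = 1 := by omega
    rw [ZMod.χ₄_nat_one_mod_four h4] at h
    simpa [h5] using h
  · have h5 : ¬ (p : ℤ) % 4 = 1 := by omega
    rw [ZMod.χ₄_nat_three_mod_four h4] at h
    rw [if_neg h5] at h ⊢
    simp at h ⊢
    linear_combination h

end PrimeLevel

/-! ### Periodicity of the character of a positive integer -/

theorem kronecker_pos_of_odd {c : ℤ} (hc : 0 < c) {d : ℤ} (hd : Odd d) :
    kronecker c d = J(c | d.natAbs) := by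
  rw [kronecker_of_odd _ hd, if_neg (by omega), one_mul]

/-- Only the squarefree part of `D` matters for arguments prime to `l`, and being squarefree it
divides `l`. The period `4l` is needed because the discriminant divides a power of the level, not
necessarily the level itself. -/
theorem kronecker_four_mul_periodic {D l : ℕ} (hD : D ≠ 0) {e : ℕ} (hDl : D ∣ l ^ e) {d d' : ℤ}
    (hd : Odd d) (hcop : IsCoprime (l : ℤ) d) (h : (4 * l : ℤ) ∣ d - d') :
    kronecker (4 * D) d = kronecker (4 * D) d' := by
  obtain ⟨s, m, -, -, hm, hs⟩ := Nat.sq_mul_squarefree_of_pos (Nat.pos_of_ne_zero hD)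
  have hsl : s ∣ l := hs.isRadical e l ((Dvd.intro_left _ hm).trans hDl)
  have hd' : Odd d' := by
    have : Even (d - d') := (even_iff_two_dvd.mpr (dvd_trans ⟨2 * l, by ring⟩ h))
    rcases Int.even_or_odd d' with h' | h'
    · exact absurd ((Int.even_sub.mp this).mpr h') (Int.not_even_iff_odd.mpr hd)
    · exact h'
  have hcop' : IsCoprime (l : ℤ) d' := by
    obtain ⟨t, ht⟩ := h
    have : d' = d + l * (-4 * t) := by linear_combination -ht
    rw [this]
    exact hcop.add_mul_left_right _
  have key : ∀ x : ℤ, Odd x → IsCoprime (l : ℤ) x → kronecker (4 * D) x = kronecker (4 * s) x := by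
    intro x hx hlx
    have hs1 : 0 < s := Nat.pos_of_ne_zero hs.ne_zero
    rw [kronecker_pos_of_odd (by positivity) hx, kronecker_pos_of_odd (by positivity) hx, ← hm]
    push_cast
    rw [show (4 * ((m : ℤ) ^ 2 * s)) = (m : ℤ) ^ 2 * (4 * s) by ring, jacobiSym.mul_left,
      jacobiSym.sq_one', one_mul]
    have h1 : IsCoprime (m : ℤ) x := by
      have h2 : m ∣ l ^ e := (dvd_trans ⟨m * s, by rw [← hm]; ring⟩ hDl : m ∣ l ^ e)
      exact (hlx.pow_left (m := e)).of_isCoprime_of_dvd_left (by exact_mod_cast h2)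
    rw [Int.isCoprime_iff_gcd_eq_one] at h1
    simpa [Int.gcd, Int.natAbs_abs] using h1
  rw [key d hd hcop, key d' hd' hcop']
  refine kronecker_eq_of_dvd_sub (by have := hs.ne_zero; positivity) ⟨s, rfl⟩ hd (dvd_trans ?_ h)
  exact mul_dvd_mul_left _ (by exact_mod_cast hsl)

/-! ### Lattices in coordinates -/

section LatticeCoordinates

open scoped Matrix

variable {V : Type*} [AddCommGroup V] [Module ℚ V] {B : LinearMap.BilinForm ℚ V}
  {L : Submodule ℤ V} {k : ℕ}

theorem bilin_basis (hint : IsIntegralLattice B L) (e : Module.Basis (Fin k) ℤ L) (i j : Fin k) :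
    B (e i : V) (e j : V) = (gram B e i j : ℚ) := by
  obtain ⟨m, hm⟩ := hint _ (e i).2 _ (e j).2
  simp [gram, hm]

theorem bilin_sum_smul (hint : IsIntegralLattice B L) (e : Module.Basis (Fin k) ℤ L)
    (x y : Fin k → ℚ) :
    B (∑ i, x i • (e i : V)) (∑ j, y j • (e j : V)) =
      x ⬝ᵥ ((gram B e).map (Int.cast : ℤ → ℚ)).mulVec y := by
  simp only [map_sum, LinearMap.sum_apply, map_smul, LinearMap.smul_apply, bilin_basis hint,
    dotProduct, Matrix.mulVec, Matrix.map_apply, smul_eq_mul, Finset.mul_sum]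
  rw [Finset.sum_comm]
  refine Finset.sum_congr rfl fun i _ => Finset.sum_congr rfl fun j _ => by ring

theorem coe_eq_sum_smul (e : Module.Basis (Fin k) ℤ L) (x : L) :
    (x : V) = ∑ i, ((e.equivFun x i : ℤ) : ℚ) • (e i : V) := by
  have h := congrArg (Subtype.val : L → V) (e.sum_equivFun x)
  rw [← h]
  simp only [Submodule.coe_sum, Submodule.coe_smul, Int.cast_smul_eq_zsmul]

theorem bilin_coe (hint : IsIntegralLattice B L) (e : Module.Basis (Fin k) ℤ L) (x y : L) :
    B (x : V) (y : V) = ((e.equivFun x ⬝ᵥ (gram B e).mulVec (e.equivFun y) : ℤ) : ℚ) := by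
  rw [coe_eq_sum_smul e x, coe_eq_sum_smul e y, bilin_sum_smul hint]
  simp [dotProduct, Matrix.mulVec]

theorem gram_det_ne_zero (hpos : ∀ x : V, x ≠ 0 → 0 < B x x) (hint : IsIntegralLattice B L)
    (e : Module.Basis (Fin k) ℤ L) : (gram B e).det ≠ 0 := by
  intro h
  obtain ⟨v, hv, hv0⟩ := Matrix.exists_mulVec_eq_zero_iff.mpr h
  have h1 := bilin_coe hint e (e.equivFun.symm v) (e.equivFun.symm v)
  rw [LinearEquiv.apply_symm_apply, hv0, dotProduct_zero] at h1
  have h2 : ((e.equivFun.symm v : L) : V) ≠ 0 := fun h0 =>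
    hv (e.equivFun.symm.map_eq_zero_iff.mp (Subtype.ext h0))
  have := hpos _ h2
  rw [h1] at this
  simp at this

/-- Positivity is known for rational vectors, and density passes on only semidefiniteness to real
ones. Definiteness is recovered from the nonzero determinant, which makes the factor `P` invertible.
-/
theorem exists_gram_eq (hsymm : B.IsSymm) (hpos : ∀ x : V, x ≠ 0 → 0 < B x x)
    (hint : IsIntegralLattice B L) (e : Module.Basis (Fin k) ℤ L) :
    ∃ P : Matrix (Fin k) (Fin k) ℝ,
      (gram B e).map (Int.cast : ℤ → ℝ) = P.transpose * P ∧ P.det ≠ 0 := by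
  set A := (gram B e).map (Int.cast : ℤ → ℝ) with hA
  have hherm : A.IsHermitian := by
    ext i j
    have h1 := bilin_basis hint e i j
    rw [hsymm.eq, bilin_basis hint] at h1
    have h2 : gram B e j i = gram B e i j := by exact_mod_cast h1
    simp [hA, h2]
  have hnn : ∀ x : Fin k → ℝ, 0 ≤ x ⬝ᵥ A.mulVec x := by
    have hd : DenseRange (fun q : Fin k → ℚ => fun i => (q i : ℝ)) :=
      DenseRange.piMap (fun _ => Rat.denseRange_cast)
    have hcl : IsClosed {x : Fin k → ℝ | 0 ≤ x ⬝ᵥ A.mulVec x} := by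
      refine isClosed_le continuous_const ?_
      simp only [dotProduct, Matrix.mulVec]
      fun_prop
    intro x
    refine hd.induction_on x hcl fun q => ?_
    have h1 := bilin_sum_smul hint e q q
    have h2 : 0 ≤ B (∑ i, q i • (e i : V)) (∑ i, q i • (e i : V)) := by
      by_cases h : ∑ i, q i • (e i : V) = 0
      · simp [h]
      · exact (hpos _ h).le
    rw [h1] at h2
    have h3 : ((q ⬝ᵥ ((gram B e).map (Int.cast : ℤ → ℚ)).mulVec q : ℚ) : ℝ) =
        (fun i => (q i : ℝ)) ⬝ᵥ A.mulVec (fun i => (q i : ℝ)) := by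
      simp [dotProduct, Matrix.mulVec, hA]
    rw [← h3]
    exact_mod_cast h2
  have hpsd : A.PosSemidef := Matrix.PosSemidef.of_dotProduct_mulVec_nonneg hherm (by simpa using hnn)
  have hdet : A.det ≠ 0 := by
    have h := gram_det_ne_zero hpos hint e
    have h1 : A.det = ((gram B e).det : ℝ) := by
      rw [hA]; exact (RingHom.map_det (Int.castRingHom ℝ) _).symm
    rw [h1]; exact_mod_cast h
  obtain ⟨P, hP⟩ : ∃ P : Matrix (Fin k) (Fin k) ℝ, A = P.transpose * P := by
    open scoped MatrixOrder in
    obtain ⟨P, hP⟩ := CStarAlgebra.nonneg_iff_eq_star_mul_self.mp (Matrix.nonneg_iff_posSemidef.mpr hpsd)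
    exact ⟨P, by rw [hP, Matrix.star_eq_conjTranspose, Matrix.conjTranspose_eq_transpose_of_trivial]⟩
  refine ⟨P, hP, fun h => hdet ?_⟩
  rw [hP, Matrix.det_mul, h, mul_zero]

theorem discr_pos (hsymm : B.IsSymm) (hpos : ∀ x : V, x ≠ 0 → 0 < B x x)
    (hint : IsIntegralLattice B L) (e : Module.Basis (Fin k) ℤ L) : 0 < discr B e := by
  obtain ⟨P, hP, h0⟩ := exists_gram_eq hsymm hpos hint e
  have h1 : (((gram B e).det : ℤ) : ℝ) = P.det ^ 2 := by
    rw [show (((gram B e).det : ℤ) : ℝ) = ((gram B e).map (Int.cast : ℤ → ℝ)).det from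
      RingHom.map_det (Int.castRingHom ℝ) _, hP, Matrix.det_mul, Matrix.det_transpose, sq]
  have h2 : (0 : ℝ) < ((gram B e).det : ℤ) := by rw [h1]; positivity
  exact_mod_cast h2

theorem level_spec (hsymm : B.IsSymm) (hpos : ∀ x : V, x ≠ 0 → 0 < B x x)
    (hint : IsIntegralLattice B L) (e : Module.Basis (Fin k) ℤ L) :
    0 < level B e ∧ ∃ C : Matrix (Fin k) (Fin k) ℤ, gram B e * C = (level B e : ℤ) • 1 := by
  set A := gram B e with hA
  have hd : 0 < A.det := discr_pos hsymm hpos hint e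
  have hdq : ((A.map (Int.cast : ℤ → ℚ)).det) = (A.det : ℚ) :=
    (RingHom.map_det (Int.castRingHom ℚ) _).symm
  have hunit : IsUnit (A.map (Int.cast : ℤ → ℚ)).det := by
    rw [hdq]; exact (isUnit_iff_ne_zero.mpr (by exact_mod_cast hd.ne'))
  have hne : {N : ℕ | 0 < N ∧ ∃ C : Matrix (Fin k) (Fin k) ℤ,
      (N : ℚ) • (A.map (Int.cast : ℤ → ℚ))⁻¹ = C.map (Int.cast : ℤ → ℚ)}.Nonempty := by
    -- The determinant is an admissible multiplier, with the adjugate as integral matrix.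
    refine ⟨A.det.toNat, by simpa using hd, A.adjugate, ?_⟩
    have h1 : ((A.det.toNat : ℕ) : ℚ) = (A.det : ℚ) := by
      exact_mod_cast congrArg (Int.cast : ℤ → ℚ) (Int.toNat_of_nonneg hd.le)
    have h2 : (A.adjugate).map (Int.cast : ℤ → ℚ) = (A.map (Int.cast : ℤ → ℚ)).adjugate :=
      RingHom.map_adjugate (Int.castRingHom ℚ) A
    rw [h1, h2, Matrix.inv_def, smul_smul, Ring.inverse_eq_inv', hdq,
      mul_inv_cancel₀ (by exact_mod_cast hd.ne'), one_smul]
  obtain ⟨h0, C, hC⟩ := Nat.sInf_mem hne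
  refine ⟨h0, C, ?_⟩
  have h3 : (A * C).map (Int.cast : ℤ → ℚ) =
      (((level B e : ℕ) : ℤ) • (1 : Matrix (Fin k) (Fin k) ℤ)).map (Int.cast : ℤ → ℚ) := by
    have h4 : (A * C).map (Int.cast : ℤ → ℚ) = A.map (Int.cast : ℤ → ℚ) * C.map (Int.cast : ℤ → ℚ) :=
      Matrix.map_mul (f := Int.castRingHom ℚ)
    rw [h4, ← hC, Matrix.mul_smul, Matrix.mul_nonsing_inv _ hunit]
    ext i j
    simp only [Matrix.map_apply, Matrix.smul_apply, smul_eq_mul, Int.cast_mul, Int.cast_natCast]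
    rw [Matrix.one_apply, Matrix.one_apply]
    push_cast
    rfl
  ext i j
  have := congrFun (congrFun h3 i) j
  simpa only [Matrix.map_apply, Int.cast_inj] using this

theorem discr_dvd_level_pow (hsymm : B.IsSymm) (hpos : ∀ x : V, x ≠ 0 → 0 < B x x)
    (hint : IsIntegralLattice B L) (e : Module.Basis (Fin k) ℤ L) :
    discr B e ∣ (level B e : ℤ) ^ k := by
  obtain ⟨-, C, hC⟩ := level_spec hsymm hpos hint e
  have := congrArg Matrix.det hC
  rw [Matrix.det_mul, Matrix.det_smul, Matrix.det_one, mul_one, Fintype.card_fin] at this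
  exact ⟨_, this.symm⟩

/-- The coset `aL + ν` is parametrized by integral vectors. -/
noncomputable def cosetEquiv (e : Module.Basis (Fin k) ℤ L) {a : ℕ} (ha : a ≠ 0) (ν : L) :
    (Fin k → ℤ) ≃ latticeCoset L a (ν : V) :=
  Equiv.ofBijective (fun n => ⟨((a • e.equivFun.symm n + ν : L) : V), e.equivFun.symm n,
      (e.equivFun.symm n).2, by simp⟩) (by
    constructor
    · intro n m h
      have h1 : a • e.equivFun.symm n + ν = a • e.equivFun.symm m + ν :=
        Subtype.ext (congrArg (fun x : latticeCoset L a (ν : V) => (x : V)) h : ((a • e.equivFun.symm n + ν : L) : V) =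
        ((a • e.equivFun.symm m + ν : L) : V))
      have h2 := congrArg e.equivFun (add_right_cancel h1)
      simp only [map_nsmul, LinearEquiv.apply_symm_apply] at h2
      exact nsmul_right_injective ha h2
    · rintro ⟨x, y, hy, rfl⟩
      refine ⟨e.equivFun ⟨y, hy⟩, Subtype.ext ?_⟩
      simp)

theorem cosetEquiv_apply (e : Module.Basis (Fin k) ℤ L) {a : ℕ} (ha : a ≠ 0) (ν : L)
    (n : Fin k → ℤ) :
    (cosetEquiv e ha ν n : V) = ((a • e.equivFun.symm n + ν : L) : V) := rfl

/-- As `aL + ν = a(L + ν/a)`, the matrix `P` is scaled by `a` and the shift is `ν/a`. -/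
theorem gaussian_coset (hint : IsIntegralLattice B L) (e : Module.Basis (Fin k) ℤ L)
    {a : ℕ} (ha : a ≠ 0) (ν : L) {P : Matrix (Fin k) (Fin k) ℝ}
    (hP : (gram B e).map (Int.cast : ℤ → ℝ) = P.transpose * P) (z : ℂ) (n : Fin k → ℤ) :
    gaussian ((a : ℝ) • P) z ((a : ℝ)⁻¹ • toReal (e.equivFun ν) + toReal n) =
      Complex.exp (2 * Real.pi * Complex.I *
        ((B (cosetEquiv e ha ν n : V) (cosetEquiv e ha ν n : V) : ℚ) : ℂ) * z) := by
  have ha' : (a : ℝ) ≠ 0 := by exact_mod_cast ha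
  rw [cosetEquiv_apply, bilin_coe hint e]
  unfold gaussian
  congr 3
  have h1 : ((a : ℝ) • P).mulVec ((a : ℝ)⁻¹ • toReal (e.equivFun ν) + toReal n) =
      P.mulVec (toReal (a • n + e.equivFun ν)) := by
    rw [Matrix.smul_mulVec, ← Matrix.mulVec_smul]
    congr 1
    ext i
    simp [toReal]
    field_simp
    ring
  rw [h1, sum_sq_eq_quadVal, ← hP, map_add, map_nsmul, LinearEquiv.apply_symm_apply]
  have h2 := intCast_quadVal (R := ℝ) (gram B e) (a • n + e.equivFun ν)
  rw [← h2]
  simp [quadVal]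

theorem theta_eq_thetaVec (hint : IsIntegralLattice B L) (e : Module.Basis (Fin k) ℤ L)
    {a : ℕ} (ha : a ≠ 0) (ν : L) {P : Matrix (Fin k) (Fin k) ℝ}
    (hP : (gram B e).map (Int.cast : ℤ → ℝ) = P.transpose * P) (z : ℍ) :
    theta B (latticeCoset L a (ν : V)) z =
      thetaVec ((a : ℝ) • P) ((a : ℝ)⁻¹ • toReal (e.equivFun ν)) (z : ℂ) := by
  unfold theta thetaVec
  rw [← (cosetEquiv e ha ν).tsum_eq]
  exact tsum_congr fun n => (gaussian_coset hint e ha ν hP z n).symm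

/-- For the form `a²A` and the shift `ν/a` the denominators disappear: the two integrality
conditions concern `aAν` and `νᵗAν`. The multiplier `t` provides every `c'` that is a multiple of
`N_L a²`, as needed for lower left entries `4c'`. -/
theorem thetaDatum_coset (e : Module.Basis (Fin k) ℤ L)
    {a : ℕ} (ha : a ≠ 0) (ν : L) {P : Matrix (Fin k) (Fin k) ℝ}
    (hP : (gram B e).map (Int.cast : ℤ → ℝ) = P.transpose * P) (hdet : P.det ≠ 0)
    {C : Matrix (Fin k) (Fin k) ℤ} (hC : gram B e * C = (level B e : ℤ) • 1) (t : ℤ) :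
    ThetaDatum ((a : ℤ) ^ 2 • gram B e) (t • C) ((a : ℝ) • P) (level B e * a ^ 2 * t)
      ((a : ℝ)⁻¹ • toReal (e.equivFun ν)) where
  map_eq := by
    have : ((a : ℤ) ^ 2 • gram B e).map (Int.cast : ℤ → ℝ) =
        (a : ℝ) ^ 2 • (gram B e).map (Int.cast : ℤ → ℝ) := by
      ext i j
      simp only [Matrix.map_apply, Matrix.smul_apply, smul_eq_mul]
      push_cast; rfl
    rw [this, hP, Matrix.transpose_smul, Matrix.smul_mul, Matrix.mul_smul, smul_smul, sq]
  det_ne_zero := by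
    rw [Matrix.det_smul]
    exact mul_ne_zero (pow_ne_zero _ (by exact_mod_cast ha)) hdet
  mul_eq := by
    rw [Matrix.smul_mul, Matrix.mul_smul, hC, smul_smul, smul_smul]
    congr 1; ring
  exists_mulVec_eq := by
    refine ⟨(a : ℤ) • (gram B e).mulVec (e.equivFun ν), ?_⟩
    ext i
    have ha' : (a : ℝ) ≠ 0 := by exact_mod_cast ha
    simp only [Matrix.mulVec, dotProduct, toReal, Matrix.map_apply, Matrix.smul_apply, smul_eq_mul,
      Pi.smul_apply, Int.cast_mul, Int.cast_sum, Finset.mul_sum]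
    refine Finset.sum_congr rfl fun j _ => ?_
    push_cast
    field_simp
  exists_quadVal_eq := by
    refine ⟨quadVal (gram B e) (e.equivFun ν), ?_⟩
    have ha' : (a : ℝ) ≠ 0 := by exact_mod_cast ha
    rw [intCast_quadVal]
    simp only [quadVal, Matrix.mulVec, dotProduct, toReal, Matrix.map_apply, Matrix.smul_apply,
      smul_eq_mul, Pi.smul_apply, Finset.mul_sum]
    refine Finset.sum_congr rfl fun i _ => Finset.sum_congr rfl fun j _ => ?_
    push_cast
    field_simp

end LatticeCoordinates

/-! ### The transformation law of theta series of lattice cosets -/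

/-- The matrix of the translation `z ↦ z + m`. -/
def translate (m : ℤ) : SL(2, ℤ) := ⟨!![1, m; 0, 1], by simp [Matrix.det_fin_two_of]⟩

theorem translate_smul_coe (m : ℤ) (z : ℍ) : ((translate m • z : ℍ) : ℂ) = z + m := by
  rw [smul_coe]; simp [translate]

section ThetaTransformation

variable {V : Type*} [AddCommGroup V]

theorem latticeCoset_eq_of_sub_mem {L : Submodule ℤ V} {a : ℕ} {μ ν x : V} (hx : x ∈ L)
    (h : μ - ν = a • x) : latticeCoset L a μ = latticeCoset L a ν := by
  have hμ : μ = a • x + ν := by rw [← h, sub_add_cancel]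
  ext y
  constructor
  · rintro ⟨w, hw, rfl⟩
    exact ⟨w + x, L.add_mem hw hx, by rw [hμ, smul_add, add_assoc]⟩
  · rintro ⟨w, hw, rfl⟩
    exact ⟨w - x, L.sub_mem hw hx, by rw [hμ, smul_sub]; abel⟩

theorem latticeCoset_zsmul_congr {L : Submodule ℤ V} {a : ℕ} {ν : V} (hν : ν ∈ L) {s t : ℤ}
    (h : (a : ℤ) ∣ s - t) : latticeCoset L a (s • ν) = latticeCoset L a (t • ν) := by
  obtain ⟨u, hu⟩ := h
  refine latticeCoset_eq_of_sub_mem (L.smul_mem u hν) ?_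
  rw [← sub_smul, hu, mul_smul, natCast_zsmul]

variable [Module ℚ V]

theorem theta_neg (B : LinearMap.BilinForm ℚ V) (L : Submodule ℤ V) (a : ℕ) (ν : V) (z : ℍ) :
    theta B (latticeCoset L a (-ν)) z = theta B (latticeCoset L a ν) z := by
  have key : ∀ μ x : V, x ∈ latticeCoset L a μ → -x ∈ latticeCoset L a (-μ) := by
    rintro μ x ⟨y, hy, rfl⟩
    exact ⟨-y, L.neg_mem hy, by rw [smul_neg, neg_add]⟩
  let E : latticeCoset L a ν ≃ latticeCoset L a (-ν) :=
    { toFun := fun x => ⟨-x, key _ _ x.2⟩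
      invFun := fun x => ⟨-x, by simpa using key _ _ x.2⟩
      left_inv := fun x => by simp
      right_inv := fun x => by simp }
  unfold theta
  rw [← E.tsum_eq]
  refine tsum_congr fun x => ?_
  simp [E]

theorem theta_eq_of_coe_eq_add_int {B : LinearMap.BilinForm ℚ V} {L : Submodule ℤ V}
    (hint : IsIntegralLattice B L) (a : ℕ) {ν : V} (hν : ν ∈ L) {z w : ℍ} {m : ℤ}
    (h : (w : ℂ) = z + m) :
    theta B (latticeCoset L a ν) w = theta B (latticeCoset L a ν) z := by
  unfold theta
  refine tsum_congr fun x => ?_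
  have hx : (x : V) ∈ L := by
    obtain ⟨y, hy, hxy⟩ := x.2
    rw [hxy]
    exact L.add_mem (L.smul_of_tower_mem a hy) hν
  obtain ⟨t, ht⟩ := hint _ hx _ hx
  rw [h, ht, Complex.exp_eq_exp_iff_exists_int]
  exact ⟨t * m, by push_cast; ring⟩

variable {B : LinearMap.BilinForm ℚ V} {L : Submodule ℤ V} {k : ℕ}

theorem theta_smul_of_prime (hsymm : B.IsSymm) (hpos : ∀ x : V, x ≠ 0 → 0 < B x x)
    (hint : IsIntegralLattice B L) (e : Module.Basis (Fin k) ℤ L) {a : ℕ} (ha : a ≠ 0) (ν : L)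
    {p : ℕ} (hp : p.Prime) {γ : SL(2, ℤ)} (hc : (4 * level B e * a ^ 2 : ℤ) ∣ γ 1 0)
    (hd : γ 1 1 = p) (z : ℍ) :
    theta B (latticeCoset L a (((p : ℤ) • ν : L) : V)) (γ • z) =
      (kronecker (4 * discr B e) p : ℂ) * autFactor γ z ^ k *
        theta B (latticeCoset L a (ν : V)) z := by
  have : Fact p.Prime := ⟨hp⟩
  obtain ⟨P, hP, hdet⟩ := exists_gram_eq hsymm hpos hint e
  obtain ⟨hl, C, hC⟩ := level_spec hsymm hpos hint e
  obtain ⟨t, ht⟩ := hc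
  have hcop := coprime_row γ
  rw [hd] at hcop
  have hl1 : IsCoprime (level B e : ℤ) p :=
    hcop.of_isCoprime_of_dvd_left ⟨4 * a ^ 2 * t, by rw [ht]; ring⟩
  have ha1 : IsCoprime (a : ℤ) p :=
    hcop.of_isCoprime_of_dvd_left ⟨4 * level B e * a * t, by rw [ht]; ring⟩
  have h41 : IsCoprime (4 : ℤ) p :=
    hcop.of_isCoprime_of_dvd_left ⟨level B e * a ^ 2 * t, by rw [ht]; ring⟩
  have hp2 : p ≠ 2 := by
    rintro rfl
    rw [Int.isCoprime_iff_gcd_eq_one] at h41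
    norm_num at h41
  have hodd := hp.odd_of_ne_two hp2
  have hD1 : IsCoprime (discr B e) p :=
    (hl1.pow_left (m := k)).of_isCoprime_of_dvd_left (discr_dvd_level_pow hsymm hpos hint e)
  -- Scaling by `a²` changes the determinant by a square prime to `p`, so only `d_L` is seen by the
  -- symbol.
  have hS : (((a : ℤ) ^ 2 • gram B e).det : ℤ) = ((a : ℤ) ^ k) ^ 2 * discr B e := by
    rw [Matrix.det_smul, Fintype.card_fin, discr]; ring
  have hS1 : IsCoprime ((((a : ℤ) ^ 2 • gram B e).det : ℤ)) p := by
    rw [hS]; exact IsCoprime.mul_left (ha1.pow_left.pow_left) hD1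
  have key := (thetaDatum_coset e ha ν hP hdet hC t).thetaVec_smul_of_prime p hp2
    (γ := γ) (by rw [ht]; ring) hd (by
      intro h0
      rw [ZMod.intCast_zmod_eq_zero_iff_dvd] at h0
      have := hS1.isUnit_of_dvd' h0 dvd_rfl
      rw [Int.isUnit_iff] at this
      have := hp.two_le
      omega) z
  rw [theta_eq_thetaVec hint e ha _ hP, theta_eq_thetaVec hint e ha _ hP]
  have h1 : (a : ℝ)⁻¹ • toReal (e.equivFun ((p : ℤ) • ν)) =
      (p : ℝ) • ((a : ℝ)⁻¹ • toReal (e.equivFun ν)) := by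
    ext i
    simp [toReal]
    ring
  rw [h1, key, hS, jacobiSym.mul_left, jacobiSym.sq_one', one_mul,
    kronecker_natCast_right _ hodd, jacobiSym_four_mul _ hodd]
  · exact Int.isCoprime_iff_gcd_eq_one.mp ha1.pow_left

theorem kronecker_four_discr_periodic (hsymm : B.IsSymm) (hpos : ∀ x : V, x ≠ 0 → 0 < B x x)
    (hint : IsIntegralLattice B L) (e : Module.Basis (Fin k) ℤ L) {d d' : ℤ} (hd : Odd d)
    (hcop : IsCoprime (level B e : ℤ) d) (h : (4 * level B e : ℤ) ∣ d - d') :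
    kronecker (4 * discr B e) d = kronecker (4 * discr B e) d' := by
  have hD := discr_pos hsymm hpos hint e
  obtain ⟨D, hD'⟩ := Int.eq_ofNat_of_zero_le hD.le
  have h1 := discr_dvd_level_pow hsymm hpos hint e
  rw [hD'] at h1 hD ⊢
  exact kronecker_four_mul_periodic (e := k) (by omega) (by exact_mod_cast h1) hd hcop h

theorem isCoprime_four_discr (hsymm : B.IsSymm) (hpos : ∀ x : V, x ≠ 0 → 0 < B x x)
    (hint : IsIntegralLattice B L) (e : Module.Basis (Fin k) ℤ L) {d : ℤ} (hd : Odd d)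
    (hcop : IsCoprime (level B e : ℤ) d) : IsCoprime (4 * discr B e) d := by
  refine IsCoprime.mul_left ?_ ((hcop.pow_left (m := k)).of_isCoprime_of_dvd_left
    (discr_dvd_level_pow hsymm hpos hint e))
  rw [show (4 : ℤ) = 2 ^ 2 by norm_num]
  exact ((Int.isCoprime_two_left).mpr hd).pow_left

/-- The theta series of the cosets `aL + ν` under `Γ₀(4 N_L a²)`. -/
theorem theta_smul (hsymm : B.IsSymm) (hpos : ∀ x : V, x ≠ 0 → 0 < B x x)
    (hint : IsIntegralLattice B L) (e : Module.Basis (Fin k) ℤ L) {a : ℕ} (ha : a ≠ 0) {ν : V}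
    (hν : ν ∈ L) {γ : SL(2, ℤ)} (hc : (4 * level B e * a ^ 2 : ℤ) ∣ γ 1 0) (z : ℍ) :
    theta B (latticeCoset L a (γ 1 1 • ν)) (γ • z) =
      (kronecker (4 * discr B e) (γ 1 1) : ℂ) * autFactor γ z ^ k *
        theta B (latticeCoset L a ν) z := by
  have h4 : 4 ∣ γ 1 0 := dvd_trans ⟨level B e * a ^ 2, by ring⟩ hc
  have hodd := odd_of_four_dvd h4
  -- For `c = 0` there is no progression to use, but then `d = ±1`, and `aL - ν` has the same theta
  -- series as `aL + ν`.
  by_cases h0 : γ 1 0 = 0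
  · have hdet := det_eq γ
    rw [h0, mul_zero, sub_zero] at hdet
    have hu : IsUnit (γ 1 1) := IsUnit.of_mul_eq_one_right _ hdet
    have hk1 : kronecker (4 * discr B e) (γ 1 1) = 1 := by
      rw [kronecker_pos_of_odd (by have := discr_pos hsymm hpos hint e; omega) hodd,
        Int.natAbs_of_isUnit hu, jacobiSym.one_right]
    rw [autFactor_of_lower_zero h0, hk1,
      theta_eq_of_coe_eq_add_int hint a (L.smul_mem _ hν) (smul_coe_of_lower_zero h0 z)]
    rcases Int.isUnit_iff.mp hu with h | h
    · rw [h]; simp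
    · rw [h, neg_one_smul, theta_neg]; simp
  -- Dirichlet's theorem gives a prime `p = d + mc`. Multiplying `γ` on the right by the translation
  -- by `m` replaces `d` by `p`, and neither the theta series, the coset nor the character notices.
  · obtain ⟨p, hpgt, hp, hpc⟩ : ∃ p > 0, Nat.Prime p ∧ (γ 1 0) ∣ (p : ℤ) - γ 1 1 := by
      have : NeZero (γ 1 0).natAbs := ⟨by simpa using h0⟩
      have hu : IsUnit ((γ 1 1 : ℤ) : ZMod (γ 1 0).natAbs) := by
        rw [ZMod.coe_int_isUnit_iff_isCoprime]
        exact Int.isCoprime_iff_nat_coprime.mpr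
          (by simpa [Int.natAbs_abs] using Int.isCoprime_iff_nat_coprime.mp (coprime_row γ))
      obtain ⟨p, hp0, hp, hpe⟩ := Nat.forall_exists_prime_gt_and_eq_mod hu 0
      refine ⟨p, hp0, hp, ?_⟩
      rw [← Int.natAbs_dvd, ← ZMod.intCast_zmod_eq_zero_iff_dvd]
      push_cast
      rw [hpe, sub_self]
    obtain ⟨m, hm⟩ := hpc
    have hU0 : translate m 1 0 = 0 := rfl
    have hr0 : (γ * translate m) 1 0 = γ 1 0 := by rw [mul_entry]; simp [translate]
    have hr1 : (γ * translate m) 1 1 = p := by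
      rw [mul_entry]; simp [translate]; linarith
    set w : ℍ := (translate m)⁻¹ • z with hw
    have hz : translate m • w = z := by rw [hw, smul_inv_smul]
    have hzw : (z : ℂ) = w + m := by
      rw [← hz, translate_smul_coe]
    have h1 := theta_smul_of_prime hsymm hpos hint e ha ⟨ν, hν⟩ hp (hr0 ▸ hc) hr1 w
    rw [mul_smul, hz, autFactor_mul h4 (hU0 ▸ dvd_zero 4), hz, autFactor_of_lower_zero hU0, mul_one,
      ← theta_eq_of_coe_eq_add_int hint a hν hzw] at h1
    have h2 : latticeCoset L a (γ 1 1 • ν) = latticeCoset L a ((p : ℤ) • ν) := by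
      refine latticeCoset_zsmul_congr hν ?_
      rw [← dvd_neg, neg_sub, hm]
      have h3 : (a : ℤ) ∣ γ 1 0 := dvd_trans ⟨4 * level B e * a, by ring⟩ hc
      exact h3.mul_right m
    have h3 : kronecker (4 * discr B e) (γ 1 1) = kronecker (4 * discr B e) p := by
      refine kronecker_four_discr_periodic hsymm hpos hint e hodd
        ((coprime_row γ).of_isCoprime_of_dvd_left (dvd_trans ⟨4 * a ^ 2, by ring⟩ hc)) ?_
      rw [← dvd_neg, neg_sub, hm]
      have h4 : (4 * level B e : ℤ) ∣ γ 1 0 := dvd_trans ⟨a ^ 2, by ring⟩ hc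
      exact h4.mul_right m
    rw [h2, h3]
    exact h1

end ThetaTransformation

/-! ### Holomorphy and growth -/

section Growth

variable {k : ℕ}

theorem differentiableOn_thetaVec {P : Matrix (Fin k) (Fin k) ℝ} (hP : P.det ≠ 0)
    (h : Fin k → ℝ) : DifferentiableOn ℂ (thetaVec P h) {z | 0 < z.im} := by
  intro z hz
  have hz' : 0 < z.im := hz
  obtain ⟨u, hu, hb⟩ := exists_summable_bound hP (half_pos hz') ‖h‖
  have hU : IsOpen {w : ℂ | z.im / 2 < w.im} := isOpen_lt continuous_const Complex.continuous_im
  have h1 : DifferentiableOn ℂ (fun w : ℂ => ∑' n : Fin k → ℤ, gaussian P w (h + toReal n))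
      {w : ℂ | z.im / 2 < w.im} := by
    refine Complex.differentiableOn_tsum_of_summable_norm hu (fun n => ?_) hU
      fun n w hw => hb w (le_of_lt hw) h (fun i => norm_le_pi_norm h i) n
    unfold gaussian
    fun_prop
  have hzU : z ∈ {w : ℂ | z.im / 2 < w.im} := by
    change z.im / 2 < z.im
    linarith
  exact (h1.differentiableAt (hU.mem_nhds hzU)).differentiableWithinAt

theorem exists_norm_thetaVec_le {P : Matrix (Fin k) (Fin k) ℝ} (hP : P.det ≠ 0)
    (h : Fin k → ℝ) : ∃ C : ℝ, ∀ z : ℂ, 0 < z.im →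
      ‖thetaVec P h z‖ ≤ C * (1 + 1 / z.im) ^ k := by
  obtain ⟨δ, hδ, hb⟩ := exists_pos_norm_gaussian_le hP
  refine ⟨(Real.exp (2 * δ * ‖h‖ ^ 2) * (2 * (1 + 1 / δ))) ^ k, fun z hz => ?_⟩
  -- Truncating at `1` keeps the exponential prefactor of the majorant bounded when `Im z` is large.
  set y := min z.im 1 with hy
  have hy0 : 0 < y := lt_min hz one_pos
  have hy1 : y ≤ 1 := min_le_right _ _
  set t := y * δ with ht
  have ht0 : 0 < t := mul_pos hy0 hδ
  set r := Real.exp (-t) with hr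
  have hr0 : 0 < r := Real.exp_pos _
  have hrt : r * (1 + t) ≤ 1 := by
    have h1 : 1 + t ≤ Real.exp t := by linarith [Real.add_one_le_exp t]
    calc r * (1 + t) ≤ r * Real.exp t := by gcongr
      _ = 1 := by rw [hr, ← Real.exp_add]; simp
  have hr1 : r < 1 := by rw [hr, Real.exp_lt_one_iff]; linarith
  have hS := hasSum_prod_exp ht0 (Real.exp (2 * t * ‖h‖ ^ 2)) (Real.exp_pos _).le k
  have h1 := tsum_of_norm_bounded hS (hb y hy0 ‖h‖ z (min_le_left _ _) h
    fun i => norm_le_pi_norm h i)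
  refine h1.trans ?_
  rw [← mul_pow]
  have h2 : (1 - r)⁻¹ ≤ 1 + 1 / t := by
    rw [inv_le_iff_one_le_mul₀ (by linarith)]
    have : (1 + 1 / t) * (1 - r) = 1 + (1 - r * (1 + t)) / t := by field_simp; ring
    rw [this]
    have : 0 ≤ (1 - r * (1 + t)) / t := div_nonneg (by linarith) ht0.le
    linarith
  have h3 : 1 / y ≤ 1 + 1 / z.im := by
    rcases le_total z.im 1 with h' | h'
    · rw [hy, min_eq_left h']; linarith
    · rw [hy, min_eq_right h']; have := one_div_pos.mpr hz; linarith
  have h4 : 1 + 1 / t ≤ (1 + 1 / δ) * (1 + 1 / z.im) := by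
    have h5 : 1 / t = 1 / y * (1 / δ) := by rw [ht]; field_simp
    have h6 : 1 / y * (1 / δ) ≤ (1 + 1 / z.im) * (1 / δ) := by gcongr
    have := one_div_pos.mpr hz
    rw [h5]
    linarith
  have h7 : (1 - r)⁻¹ + r * (1 - r)⁻¹ ≤ 2 * ((1 + 1 / δ) * (1 + 1 / z.im)) := by
    have h8 : 0 < (1 - r)⁻¹ := inv_pos.mpr (by linarith)
    have : r * (1 - r)⁻¹ ≤ 1 * (1 - r)⁻¹ := by gcongr
    linarith
  have h9 : Real.exp (2 * t * ‖h‖ ^ 2) ≤ Real.exp (2 * δ * ‖h‖ ^ 2) := by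
    have : t ≤ δ := by rw [ht]; exact mul_le_of_le_one_left hδ.le hy1
    gcongr
  have h10 : 0 < (1 - r)⁻¹ := inv_pos.mpr (by linarith)
  refine pow_le_pow_left₀ (by positivity) ?_ k
  calc _ ≤ Real.exp (2 * δ * ‖h‖ ^ 2) * (2 * ((1 + 1 / δ) * (1 + 1 / z.im))) := by gcongr
    _ = _ := by ring

theorem row_mul (γ γ' : SL(2, ℤ)) (z : ℍ) :
    (((γ * γ') 1 0 : ℤ) : ℂ) * (z : ℂ) + ((γ * γ') 1 1 : ℤ) =
      ((γ 1 0 : ℤ) * ((γ' • z : ℍ) : ℂ) + (γ 1 1 : ℤ)) *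
        ((γ' 1 0 : ℤ) * (z : ℂ) + (γ' 1 1 : ℤ)) := by
  have h := row_ne_zero γ' z
  rw [mul_entry, mul_entry, smul_coe]
  push_cast
  field_simp
  ring

theorem one_le_norm_row (γ : SL(2, ℤ)) {z : ℍ} (hz : 1 ≤ z.im) :
    1 ≤ ‖((γ 1 0 : ℤ) : ℂ) * (z : ℂ) + (γ 1 1 : ℤ)‖ := by
  by_cases h0 : γ 1 0 = 0
  · have hdet := det_eq γ
    rw [h0, mul_zero, sub_zero] at hdet
    rcases Int.isUnit_iff.mp (IsUnit.of_mul_eq_one_right _ hdet) with h | h <;> simp [h0, h]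
  · refine le_trans ?_ (Complex.abs_im_le_norm _)
    have h1 : (((γ 1 0 : ℤ) : ℂ) * (z : ℂ) + (γ 1 1 : ℤ)).im = (γ 1 0 : ℤ) * z.im := by simp
    rw [h1, abs_mul, abs_of_pos z.im_pos]
    have h2 : (1 : ℝ) ≤ |((γ 1 0 : ℤ) : ℝ)| := by exact_mod_cast Int.one_le_abs h0
    nlinarith

theorem im_smul_eq (γ : SL(2, ℤ)) (z : ℍ) :
    (γ • z).im = z.im / ‖((γ 1 0 : ℤ) : ℂ) * (z : ℂ) + (γ 1 1 : ℤ)‖ ^ 2 := by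
  rw [ModularGroup.im_smul_eq_div_normSq, ModularGroup.denom_apply, Complex.normSq_eq_norm_sq]

open Asymptotics in
/-- A function which is bounded by a polynomial in `1 + 1 / Im z`, and whose absolute value
transforms under `Γ(N)` like a modular form of weight `k/2`, has polynomial growth at all cusps. -/
theorem growth_of_norm_le {f : ℍ → ℂ} {N n : ℕ} (hN : 0 < N) {C : ℝ}
    (hb : ∀ z : ℍ, ‖f z‖ ≤ C * (1 + 1 / z.im) ^ n)
    (hinv : ∀ γ ∈ CongruenceSubgroup.Gamma N, ∀ z : ℍ, ‖f (γ • z)‖ ^ 2 =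
      ‖((γ 1 0 : ℤ) : ℂ) * (z : ℂ) + (γ 1 1 : ℤ)‖ ^ k * ‖f z‖ ^ 2) (γ : SL(2, ℤ)) :
    (fun z : ℍ => (((γ 1 0 : ℤ) : ℂ) * (z : ℂ) + ((γ 1 1 : ℤ) : ℂ)) ^ (-(k : ℂ) / 2) * f (γ • z))
      =O[atImInfty] (fun z : ℍ => z.im ^ n) := by
  set g : ℍ → ℝ := fun z => ‖(((γ 1 0 : ℤ) : ℂ) * (z : ℂ) + ((γ 1 1 : ℤ) : ℂ)) ^ (-(k : ℂ) / 2) *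
    f (γ • z)‖ with hg
  have hgsq : ∀ z : ℍ, ‖((γ 1 0 : ℤ) : ℂ) * (z : ℂ) + (γ 1 1 : ℤ)‖ ^ k * g z ^ 2 = ‖f (γ • z)‖ ^ 2 := by
    intro z
    have h0 := row_ne_zero γ z
    simp only [hg]
    set w := ((γ 1 0 : ℤ) : ℂ) * (z : ℂ) + (γ 1 1 : ℤ)
    have h1 : (w ^ (-(k : ℂ) / 2)) ^ 2 = (w ^ k)⁻¹ := by
      rw [← Complex.cpow_nat_mul, show ((2 : ℕ) : ℂ) * (-(k : ℂ) / 2) = -(k : ℂ) by push_cast; ring,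
        Complex.cpow_neg, Complex.cpow_natCast]
    rw [← norm_pow, ← norm_pow, ← norm_pow, ← norm_mul, mul_pow, h1, mul_inv_cancel_left₀]
    exact pow_ne_zero _ h0
  -- Since `Γ(N)` is normal, conjugating the translation by `γ` stays inside it; so `g` has period
  -- `N` in `Re z`, and a strip suffices.
  have hper : ∀ (j : ℤ) (z : ℍ), g (translate (N * j) • z) = g z := by
    intro j z
    set U := translate (N * j) with hU
    set δ := γ * U * γ⁻¹ with hδ
    have hUN : U ∈ CongruenceSubgroup.Gamma N := by
      rw [CongruenceSubgroup.Gamma_mem]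
      simp [hU, translate]
    have hδN : δ ∈ CongruenceSubgroup.Gamma N :=
      (CongruenceSubgroup.Gamma_normal N).conj_mem U hUN γ
    have hδγ : δ * γ = γ * U := by rw [hδ]; group
    have h1 := hgsq (U • z)
    have h2 := hgsq z
    have h3 := hinv δ hδN (γ • z)
    rw [← mul_smul, hδγ, mul_smul] at h3
    have h4 := row_mul δ γ z
    have h5 := row_mul γ U z
    rw [hδγ, h5] at h4
    have h6 : ((U 1 0 : ℤ) * (z : ℂ) + (U 1 1 : ℤ)) = 1 := by simp [hU, translate]
    rw [h6, mul_one] at h4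
    rw [h3, h4, norm_mul, mul_pow, ← h2, mul_assoc] at h1
    have h7 := norm_ne_zero_iff.mpr (row_ne_zero δ (γ • z))
    have h8 := norm_ne_zero_iff.mpr (row_ne_zero γ z)
    have h9 := mul_left_cancel₀ (pow_ne_zero k h7) h1
    have h10 := mul_left_cancel₀ (pow_ne_zero k h8) h9
    exact (pow_left_inj₀ (norm_nonneg _) (norm_nonneg _) two_ne_zero).mp h10
  have hC : 0 ≤ C := by
    have h1 := (norm_nonneg _).trans (hb UpperHalfPlane.I)
    have h2 : 0 < (1 + 1 / UpperHalfPlane.I.im) ^ n := by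
      have := UpperHalfPlane.I.im_pos; positivity
    exact nonneg_of_mul_nonneg_left h1 h2
  set K : ℝ := |((γ 1 0 : ℤ) : ℝ)| * (N + 1) + |((γ 1 1 : ℤ) : ℝ)| with hK
  -- On the strip `1 ≤ |cz + d| ≤ K Im z`. The lower bound disposes of the factor of automorphy, and
  -- the upper one gives `1 / Im γz ≤ K² Im z`.
  have hstrip : ∀ z : ℍ, 1 ≤ z.im → |z.re| ≤ N → g z ≤ C * (1 + K ^ 2) ^ n * z.im ^ n := by
    intro z hz hre
    have h1 := one_le_norm_row γ hz
    have hzn : ‖(z : ℂ)‖ ≤ (N + 1) * z.im := by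
      refine (Complex.norm_le_abs_re_add_abs_im _).trans ?_
      have h2 : |(z : ℂ).im| = z.im := abs_of_pos z.im_pos
      have h3 : |(z : ℂ).re| ≤ N := hre
      have h4 : (0 : ℝ) ≤ N := N.cast_nonneg
      nlinarith
    have h5 : ‖((γ 1 0 : ℤ) : ℂ) * (z : ℂ) + (γ 1 1 : ℤ)‖ ≤ K * z.im := by
      refine (norm_add_le _ _).trans ?_
      rw [norm_mul, Complex.norm_intCast, Complex.norm_intCast, hK]
      have h6 : |((γ 1 0 : ℤ) : ℝ)| * ‖(z : ℂ)‖ ≤ |((γ 1 0 : ℤ) : ℝ)| * ((N + 1) * z.im) := by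
        gcongr
      have h7 : |((γ 1 1 : ℤ) : ℝ)| * 1 ≤ |((γ 1 1 : ℤ) : ℝ)| * z.im := by gcongr
      linarith
    have h6 : g z ≤ ‖f (γ • z)‖ := by
      simp only [hg]
      rw [norm_mul]
      refine mul_le_of_le_one_left (norm_nonneg _) ?_
      have : (-(k : ℂ) / 2) = ((-(k : ℝ) / 2 : ℝ) : ℂ) := by push_cast; ring
      rw [this, Complex.norm_cpow_real]
      refine Real.rpow_le_one_of_one_le_of_nonpos h1 ?_
      have : (0 : ℝ) ≤ k := k.cast_nonneg
      linarith
    refine h6.trans ((hb _).trans ?_)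
    rw [mul_assoc, ← mul_pow, im_smul_eq]
    set W := ‖((γ 1 0 : ℤ) : ℂ) * (z : ℂ) + (γ 1 1 : ℤ)‖
    have h8 : 1 / (z.im / W ^ 2) ≤ K ^ 2 * z.im := by
      rw [one_div_div, div_le_iff₀ z.im_pos]
      calc W ^ 2 ≤ (K * z.im) ^ 2 := by gcongr
        _ = _ := by ring
    have h9 : 0 < z.im / W ^ 2 := by have := z.im_pos; positivity
    gcongr
    linarith
  refine IsBigO.of_bound (C * (1 + K ^ 2) ^ n) ?_
  rw [Filter.eventually_iff, UpperHalfPlane.atImInfty_mem]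
  refine ⟨1, fun z hz => ?_⟩
  have hN' : (0 : ℝ) < N := by exact_mod_cast hN
  set j : ℤ := -⌊z.re / N⌋ with hj
  have him : (translate (N * j) • z).im = z.im := by
    have := congrArg Complex.im (translate_smul_coe (N * j) z)
    rw [Complex.add_im, Complex.intCast_im, add_zero] at this
    exact this
  have hre : (translate (N * j) • z).re = z.re - N * ⌊z.re / N⌋ := by
    have := congrArg Complex.re (translate_smul_coe (N * j) z)
    rw [Complex.add_re, Complex.intCast_re] at this
    rw [hj] at this ⊢
    push_cast at this
    rw [UpperHalfPlane.coe_re, UpperHalfPlane.coe_re] at this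
    rw [this]; ring
  have hre' : |(translate (N * j) • z).re| ≤ N := by
    rw [hre]
    have h1 := Int.floor_le (z.re / N)
    have h2 := Int.lt_floor_add_one (z.re / N)
    rw [le_div_iff₀ hN'] at h1
    rw [div_lt_iff₀ hN'] at h2
    rw [abs_le]
    constructor <;> nlinarith
  have h1 := hstrip _ (him.symm ▸ hz) hre'
  rw [hper, him] at h1
  change g z ≤ C * (1 + K ^ 2) ^ n * ‖z.im ^ n‖
  rwa [Real.norm_of_nonneg (pow_nonneg z.im_pos.le n)]

end Growth

/-! ### Analytic properties and Fourier expansion of coset theta series -/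

section ThetaAnalytic

theorem det_natCast_smul_ne_zero {k a : ℕ} (ha : a ≠ 0) {P : Matrix (Fin k) (Fin k) ℝ}
    (hP : P.det ≠ 0) : ((a : ℝ) • P).det ≠ 0 := by
  rw [Matrix.det_smul]
  exact mul_ne_zero (pow_ne_zero _ (by exact_mod_cast ha)) hP

variable {V : Type*} [AddCommGroup V] [Module ℚ V] {B : LinearMap.BilinForm ℚ V}
  {L : Submodule ℤ V} {k : ℕ}

theorem mdifferentiable_theta (hsymm : B.IsSymm) (hpos : ∀ x : V, x ≠ 0 → 0 < B x x)
    (hint : IsIntegralLattice B L) (e : Module.Basis (Fin k) ℤ L) {a : ℕ} (ha : a ≠ 0) {ν : V}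
    (hν : ν ∈ L) : MDifferentiable 𝓘(ℂ) 𝓘(ℂ) (theta B (latticeCoset L a ν)) := by
  obtain ⟨P, hP, hdet⟩ := exists_gram_eq hsymm hpos hint e
  have hdet' := det_natCast_smul_ne_zero ha hdet
  rw [UpperHalfPlane.mdifferentiable_iff]
  refine (differentiableOn_thetaVec hdet' ((a : ℝ)⁻¹ • toReal (e.equivFun ⟨ν, hν⟩))).congr fun z hz => ?_
  rw [Function.comp_apply, theta_eq_thetaVec hint e ha ⟨ν, hν⟩ hP,
    UpperHalfPlane.ofComplex_apply_of_im_pos hz]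

theorem exists_norm_theta_le (hsymm : B.IsSymm) (hpos : ∀ x : V, x ≠ 0 → 0 < B x x)
    (hint : IsIntegralLattice B L) (e : Module.Basis (Fin k) ℤ L) {a : ℕ} (ha : a ≠ 0) {ν : V}
    (hν : ν ∈ L) : ∃ C : ℝ, ∀ z : ℍ,
      ‖theta B (latticeCoset L a ν) z‖ ≤ C * (1 + 1 / z.im) ^ k := by
  obtain ⟨P, hP, hdet⟩ := exists_gram_eq hsymm hpos hint e
  have hdet' := det_natCast_smul_ne_zero ha hdet
  obtain ⟨C, hC⟩ := exists_norm_thetaVec_le hdet' ((a : ℝ)⁻¹ • toReal (e.equivFun ⟨ν, hν⟩))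
  exact ⟨C, fun z => by
    rw [theta_eq_thetaVec hint e ha ⟨ν, hν⟩ hP]; exact hC z z.im_pos⟩

theorem summable_theta (hsymm : B.IsSymm) (hpos : ∀ x : V, x ≠ 0 → 0 < B x x)
    (hint : IsIntegralLattice B L) (e : Module.Basis (Fin k) ℤ L) {a : ℕ} (ha : a ≠ 0) {ν : V}
    (hν : ν ∈ L) (z : ℍ) : Summable fun x : latticeCoset L a ν =>
      Complex.exp (2 * Real.pi * Complex.I * ((B (x : V) (x : V) : ℚ) : ℂ) * (z : ℂ)) := by
  obtain ⟨P, hP, hdet⟩ := exists_gram_eq hsymm hpos hint e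
  have hdet' := det_natCast_smul_ne_zero ha hdet
  rw [← (cosetEquiv e ha ⟨ν, hν⟩).summable_iff]
  exact (summable_gaussian hdet' z.im_pos _).congr fun n => gaussian_coset hint e ha ⟨ν, hν⟩ hP z n

theorem latticeCoset_subset {a : ℕ} {ν : V} (hν : ν ∈ L) : latticeCoset L a ν ⊆ L := by
  rintro _ ⟨y, hy, rfl⟩
  exact L.add_mem (L.smul_of_tower_mem a hy) hν

theorem hasSum_theta (hsymm : B.IsSymm) (hpos : ∀ x : V, x ≠ 0 → 0 < B x x)
    (hint : IsIntegralLattice B L) (e : Module.Basis (Fin k) ℤ L) {a : ℕ} (ha : a ≠ 0) {ν : V}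
    (hν : ν ∈ L) (z : ℍ) : HasSum (fun n : ℕ => (repNum B (latticeCoset L a ν) n : ℂ) *
      Complex.exp (2 * Real.pi * Complex.I * n * (z : ℂ))) (theta B (latticeCoset L a ν) z) := by
  have hnat : ∀ x : latticeCoset L a ν, ∃ n : ℕ, B (x : V) (x : V) = n := by
    intro x
    have hx := latticeCoset_subset hν x.2
    obtain ⟨m, hm⟩ := hint _ hx _ hx
    have h0 : 0 ≤ B (x : V) (x : V) := by
      by_cases h : (x : V) = 0
      · simp [h]
      · exact (hpos _ h).le
    rw [hm] at h0
    obtain ⟨n, rfl⟩ := Int.eq_ofNat_of_zero_le (by exact_mod_cast h0 : 0 ≤ m)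
    exact ⟨n, by rw [hm]; simp⟩
  choose g hg using hnat
  have h1 := (summable_theta hsymm hpos hint e ha hν z).hasSum.tsum_fiberwise g
  convert! h1 using 1
  funext n
  have h2 : ∀ b : g ⁻¹' {n}, Complex.exp (2 * Real.pi * Complex.I *
      ((B ((b : latticeCoset L a ν) : V) ((b : latticeCoset L a ν) : V) : ℚ) : ℂ) * (z : ℂ)) =
      Complex.exp (2 * Real.pi * Complex.I * n * (z : ℂ)) := by
    intro b
    rw [hg, b.2]
    simp
  rw [tsum_congr h2, tsum_const, nsmul_eq_mul]
  congr 2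
  rw [repNum, ← Nat.card_coe_set_eq]
  refine Nat.card_congr
    { toFun := fun x => ⟨⟨x, x.2.1⟩, by
        have h3 : ((g ⟨x, x.2.1⟩ : ℕ) : ℚ) = n := (hg ⟨x, x.2.1⟩).symm.trans x.2.2
        exact Nat.cast_injective h3⟩
      invFun := fun x => ⟨x.1, x.1.2, by rw [hg, x.2]⟩
      left_inv := fun x => rfl
      right_inv := fun x => rfl }

end ThetaAnalytic

/-! ### Decomposition into forms with character -/

/-- A family of functions permuted by `Γ₀(N)`, through the lower right entry modulo `a`. -/
structure ThetaFamily (k N a : ℕ) (ψ : ℤ → ℂ) (θ : (ZMod a)ˣ → ℍ → ℂ) : Prop where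
  slash_eq : ∀ γ ∈ CongruenceSubgroup.Gamma0 N, ∀ u v : (ZMod a)ˣ,
    (v : ZMod a) = ((γ 1 1 : ℤ) : ZMod a) * u → ∀ z : ℍ,
      slash k (θ v) (lift γ) z = ψ (γ 1 1) * θ u z
  holo : ∀ u, MDifferentiable 𝓘(ℂ) 𝓘(ℂ) (θ u)
  growth : ∀ (u : (ZMod a)ˣ) (γ : SL(2, ℤ)),
    (fun z : ℍ => (((γ 1 0 : ℤ) : ℂ) * (z : ℂ) + ((γ 1 1 : ℤ) : ℂ)) ^ (-(k : ℂ) / 2) * θ u (γ • z))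
      =O[atImInfty] (fun z : ℍ => z.im ^ k)

/-- The component of `θ 1` with character `χ`. -/
noncomputable def charComponent {a : ℕ} [NeZero a] (θ : (ZMod a)ˣ → ℍ → ℂ)
    (χ : DirichletCharacter ℂ a) (z : ℍ) : ℂ :=
  (a.totient : ℂ)⁻¹ * ∑ u : (ZMod a)ˣ, χ (u : ZMod a) * θ u z

section CharDecomp

variable {k N a : ℕ} [NeZero a] {ψ : ℤ → ℂ} {θ : (ZMod a)ˣ → ℍ → ℂ}

/-- Orthogonality of characters. The components are formed with `χ`, not its conjugate, so weighting
by `χ(u)` selects the member at `u⁻¹`; this inverse becomes `p̄` in the Hecke formula. -/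
theorem sum_mul_charComponent (θ : (ZMod a)ˣ → ℍ → ℂ) (u : (ZMod a)ˣ) (z : ℍ) :
    ∑ χ : DirichletCharacter ℂ a, χ (u : ZMod a) * charComponent θ χ z = θ u⁻¹ z := by
  have h0 : (a.totient : ℂ) ≠ 0 := by
    exact_mod_cast (Nat.totient_pos.mpr (NeZero.pos a)).ne'
  have h1 : ∀ χ : DirichletCharacter ℂ a, χ (u : ZMod a) * charComponent θ χ z =
      (a.totient : ℂ)⁻¹ * ∑ v : (ZMod a)ˣ, χ ((u * v : (ZMod a)ˣ) : ZMod a) * θ v z := by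
    intro χ
    rw [charComponent, mul_left_comm, Finset.mul_sum]
    congr 1
    refine Finset.sum_congr rfl fun v _ => ?_
    rw [Units.val_mul, map_mul, mul_assoc]
  rw [Finset.sum_congr rfl fun χ _ => h1 χ, ← Finset.mul_sum, Finset.sum_comm]
  simp_rw [← Finset.sum_mul, DirichletCharacter.sum_characters_eq]
  rw [Finset.sum_eq_single u⁻¹]
  · rw [if_pos (by simp), inv_mul_cancel_left₀ h0]
  · intro v _ hv
    rw [if_neg, zero_mul]
    intro h
    exact hv (eq_inv_of_mul_eq_one_right (Units.ext h))
  · intro h; exact absurd (Finset.mem_univ _) h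

theorem isUnit_lower_right {γ : SL(2, ℤ)} (hγ : γ ∈ CongruenceSubgroup.Gamma0 N) (ha : a ∣ N) :
    IsUnit ((γ 1 1 : ℤ) : ZMod a) := by
  rw [ZMod.coe_int_isUnit_iff_isCoprime]
  rw [CongruenceSubgroup.Gamma0_mem, ZMod.intCast_zmod_eq_zero_iff_dvd] at hγ
  exact (coprime_row γ).of_isCoprime_of_dvd_left
    (dvd_trans (Int.natCast_dvd_natCast.mpr ha) hγ)

theorem exists_mem_Gamma0_of_isCoprime {d : ℤ} (h : IsCoprime (N : ℤ) d) :
    ∃ γ ∈ CongruenceSubgroup.Gamma0 N, γ 1 1 = d := by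
  obtain ⟨x, y, hxy⟩ := h
  refine ⟨⟨!![y, -x; (N : ℤ), d], by rw [Matrix.det_fin_two_of]; linarith⟩, ?_, rfl⟩
  exact CongruenceSubgroup.Gamma0_mem.mpr (by simp)

theorem exists_mem_Gamma0 [NeZero N] (ha : a ∣ N) (u : (ZMod a)ˣ) :
    ∃ γ ∈ CongruenceSubgroup.Gamma0 N, ((γ 1 1 : ℤ) : ZMod a) = u := by
  obtain ⟨w, hw⟩ := ZMod.unitsMap_surjective ha u
  have h1 : ((((w : ZMod N).val : ℤ)) : ZMod N) = w := by simp
  obtain ⟨γ, hγ, hd⟩ := exists_mem_Gamma0_of_isCoprime (N := N) (d := ((w : ZMod N).val : ℤ))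
    ((ZMod.coe_int_isUnit_iff_isCoprime _ _).mp (h1.symm ▸ w.isUnit :))
  refine ⟨γ, hγ, ?_⟩
  rw [hd, ← hw, ZMod.unitsMap_val]
  simp [ZMod.natCast_val]

theorem slash_sum {ι : Type*} (s : Finset ι) (c : ι → ℂ) (f : ι → ℍ → ℂ) (x : Pair) (z : ℍ) :
    slash k (fun z => ∑ i ∈ s, c i * f i z) x z = ∑ i ∈ s, c i * slash k (f i) x z := by
  simp only [slash, Finset.sum_mul, mul_assoc]

theorem charComponent_eq_sum (θ : (ZMod a)ˣ → ℍ → ℂ) (χ : DirichletCharacter ℂ a) :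
    charComponent θ χ = fun z => ∑ u : (ZMod a)ˣ, (a.totient : ℂ)⁻¹ * χ (u : ZMod a) * θ u z := by
  funext z
  rw [charComponent, Finset.mul_sum]
  simp only [mul_assoc]

/-- Slashing by `γ` sends the member at `du` to `ψ(d)` times the member at `u`; reindexing the sum
by `u ↦ du` brings out `χ(d)`. -/
theorem ThetaFamily.isModularForm_charComponent (h : ThetaFamily k N a ψ θ) (ha : a ∣ N)
    (χ : DirichletCharacter ℂ a) :
    IsModularForm k (CongruenceSubgroup.Gamma0 N) (fun d => χ (d : ZMod a) * ψ d)
      (charComponent θ χ) where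
  slash_eq γ hγ z := by
    obtain ⟨w, hw⟩ := isUnit_lower_right hγ ha
    rw [charComponent_eq_sum, slash_sum, Finset.mul_sum, ← Equiv.sum_comp (Equiv.mulLeft w)]
    refine Finset.sum_congr rfl fun u _ => ?_
    rw [Equiv.coe_mulLeft, h.slash_eq γ hγ u (w * u) (by rw [Units.val_mul, hw]), Units.val_mul,
      map_mul, hw]
    ring
  holo := by
    rw [charComponent_eq_sum]
    have := h.holo
    simp only [UpperHalfPlane.mdifferentiable_iff] at this ⊢
    exact DifferentiableOn.fun_sum fun u _ => (this u).const_mul _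
  growth γ := by
    refine ⟨k, ?_⟩
    have h1 : ∀ z : ℍ, (((γ 1 0 : ℤ) : ℂ) * (z : ℂ) + ((γ 1 1 : ℤ) : ℂ)) ^ (-(k : ℂ) / 2) *
        charComponent θ χ (γ • z) = ∑ u : (ZMod a)ˣ, (a.totient : ℂ)⁻¹ * χ (u : ZMod a) *
          ((((γ 1 0 : ℤ) : ℂ) * (z : ℂ) + ((γ 1 1 : ℤ) : ℂ)) ^ (-(k : ℂ) / 2) * θ u (γ • z)) := by
      intro z
      rw [charComponent_eq_sum, Finset.mul_sum]
      exact Finset.sum_congr rfl fun u _ => by ring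
    simp only [h1]
    exact Asymptotics.IsBigO.fun_sum fun u _ => (h.growth u γ).const_mul_left _

theorem ThetaFamily.isCharDecomp (h : ThetaFamily k N a ψ θ) (ha : a ∣ N) :
    IsCharDecomp k N a ψ (θ 1) (charComponent θ) := by
  refine ⟨h.isModularForm_charComponent ha, fun z => ?_⟩
  rw [finsum_eq_sum_of_fintype]
  have := sum_mul_charComponent θ 1 z
  simpa using this.symm

theorem eq_zero_of_sum_mul_eq_zero {c : DirichletCharacter ℂ a → ℂ}
    (h : ∀ u : (ZMod a)ˣ, ∑ χ, χ (u : ZMod a) * c χ = 0) : c = 0 := by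
  have hli := (linearIndependent_monoidHom (ZMod a) ℂ).comp
    (fun χ : DirichletCharacter ℂ a => χ.toMonoidHom) (fun χ χ' hχ => by
      ext u
      exact DFunLike.congr_fun hχ (u : ZMod a))
  rw [Fintype.linearIndependent_iff] at hli
  funext χ
  refine hli c ?_ χ
  funext x
  rw [Finset.sum_apply]
  by_cases hx : IsUnit x
  · obtain ⟨u, rfl⟩ := hx
    refine Eq.trans ?_ (h u)
    exact Finset.sum_congr rfl fun χ _ => mul_comm _ _
  · refine Finset.sum_eq_zero fun χ _ => ?_
    change c χ * χ x = 0
    rw [χ.map_nonunit hx, mul_zero]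

/-- Slashing a decomposition of `θ 1` by elements of `Γ₀(N)` with every possible `d` modulo `a`
determines all sums `∑ χ(u) G_χ`. By linear independence of characters these determine the `G_χ`. -/
theorem ThetaFamily.unique (h : ThetaFamily k N a ψ θ) [NeZero N] (ha : a ∣ N)
    (hψ : ∀ d : ℤ, IsCoprime (N : ℤ) d → ψ d ≠ 0) {G : DirichletCharacter ℂ a → ℍ → ℂ}
    (hG : IsCharDecomp k N a ψ (θ 1) G) : G = charComponent θ := by
  have key : ∀ z, (fun χ => G χ z - charComponent θ χ z) = 0 := by
    intro z
    refine eq_zero_of_sum_mul_eq_zero fun u => ?_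
    obtain ⟨γ, hγ, hu⟩ := exists_mem_Gamma0 ha u
    have hcop : IsCoprime (N : ℤ) (γ 1 1) := by
      have hγ' := hγ
      rw [CongruenceSubgroup.Gamma0_mem, ZMod.intCast_zmod_eq_zero_iff_dvd] at hγ'
      exact (coprime_row γ).of_isCoprime_of_dvd_left hγ'
    have h1 : slash k (θ 1) (lift γ) z =
        ψ (γ 1 1) * ∑ χ : DirichletCharacter ℂ a, χ (u : ZMod a) * G χ z := by
      have h2 : θ 1 = fun z => ∑ χ : DirichletCharacter ℂ a, 1 * G χ z := by
        funext z
        rw [hG.2 z, finsum_eq_sum_of_fintype]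
        simp
      rw [h2, slash_sum, Finset.mul_sum]
      refine Finset.sum_congr rfl fun χ _ => ?_
      rw [(hG.1 χ).slash_eq γ hγ z, hu]
      ring
    rw [h.slash_eq γ hγ u⁻¹ 1 (by rw [hu]; simp)] at h1
    have h3 := mul_left_cancel₀ (hψ _ hcop) h1
    simp only [mul_sub]
    rw [Finset.sum_sub_distrib, ← h3, sum_mul_charComponent, sub_self]
  funext χ z
  exact sub_eq_zero.mp (congrFun (key z) χ)

theorem ThetaFamily.hecke_eq (h : ThetaFamily k N a ψ θ) [NeZero N] (ha : a ∣ N)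
    (hψ : ∀ d : ℤ, IsCoprime (N : ℤ) d → ψ d ≠ 0) (m : ℕ) [NeZero m] (z : ℍ) :
    hecke k N a ψ m (θ 1) z =
      ∑ χ : DirichletCharacter ℂ a, shimuraHecke k N m (charComponent θ χ) z := by
  have hex : ∃ F, IsCharDecomp k N a ψ (θ 1) F := ⟨_, h.isCharDecomp ha⟩
  rw [hecke, dif_pos hex, finsum_eq_sum_of_fintype, h.unique ha hψ hex.choose_spec]

theorem ThetaFamily.isModularForm (h : ThetaFamily k N a ψ θ) :
    IsModularForm k (CongruenceSubgroup.Gamma0 N ⊓ CongruenceSubgroup.Gamma1 a) ψ (θ 1) where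
  slash_eq γ hγ z := h.slash_eq γ hγ.1 1 1 (by
    have := ((CongruenceSubgroup.Gamma1_mem _ _).mp hγ.2).2.1
    rw [this]; simp) z
  holo := h.holo 1
  growth γ := ⟨k, h.growth 1 γ⟩

end CharDecomp

/-! ### The family of coset theta series -/

section ThetaCoset

variable {V : Type*} [AddCommGroup V] [Module ℚ V] {B : LinearMap.BilinForm ℚ V}
  {L : Submodule ℤ V} {k : ℕ}

theorem thetaFamily_theta (hsymm : B.IsSymm) (hpos : ∀ x : V, x ≠ 0 → 0 < B x x)
    (hint : IsIntegralLattice B L) (e : Module.Basis (Fin k) ℤ L) {a : ℕ} (ha : a ≠ 0) {ν : V}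
    (hν : ν ∈ L) : ThetaFamily k (4 * level B e * a ^ 2) a (fun m => kronecker (4 * discr B e) m)
      (fun u => theta B (latticeCoset L a (((u : ZMod a).cast : ℤ) • ν))) where
  slash_eq γ hγ u v huv z := by
    rw [CongruenceSubgroup.Gamma0_mem, ZMod.intCast_zmod_eq_zero_iff_dvd] at hγ
    push_cast at hγ
    have h4 : 4 ∣ γ 1 0 := dvd_trans ⟨level B e * a ^ 2, by ring⟩ hγ
    have h1 : latticeCoset L a (((v : ZMod a).cast : ℤ) • ν) =
        latticeCoset L a (γ 1 1 • (((u : ZMod a).cast : ℤ) • ν)) := by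
      rw [smul_smul]
      refine latticeCoset_zsmul_congr hν ?_
      rw [← ZMod.intCast_zmod_eq_zero_iff_dvd]
      push_cast
      rw [huv, sub_self]
    have h2 := theta_smul hsymm hpos hint e ha (L.smul_mem ((u : ZMod a).cast : ℤ) hν) hγ z
    rw [slash, h1]
    change theta B _ (γ • z) * _ = _
    rw [h2]
    have h3 : autFactor γ z ^ k ≠ 0 := pow_ne_zero _ (autFactor_ne_zero h4 z)
    change _ * (autFactor γ z ^ k)⁻¹ = _
    field_simp
  holo u := mdifferentiable_theta hsymm hpos hint e ha (L.smul_mem _ hν)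
  growth u := by
    obtain ⟨C, hC⟩ := exists_norm_theta_le hsymm hpos hint e ha
      (L.smul_mem ((u : ZMod a).cast : ℤ) hν)
    have hl := (level_spec hsymm hpos hint e).1
    -- On `Γ(N)` the coset is fixed and the character is `±1`, so only the absolute value `|cz +
    -- d|^{k/2}` of the factor of automorphy remains.
    refine growth_of_norm_le (N := 4 * level B e * a ^ 2) (by positivity) hC fun γ hγ z => ?_
    rw [CongruenceSubgroup.Gamma_mem] at hγ
    obtain ⟨-, -, hc, hd⟩ := hγ
    rw [ZMod.intCast_zmod_eq_zero_iff_dvd] at hc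
    push_cast at hc
    have h4 : 4 ∣ γ 1 0 := dvd_trans ⟨level B e * a ^ 2, by ring⟩ hc
    have hodd := odd_of_four_dvd h4
    have h1 : latticeCoset L a (((u : ZMod a).cast : ℤ) • ν) =
        latticeCoset L a (γ 1 1 • (((u : ZMod a).cast : ℤ) • ν)) := by
      rw [smul_smul]
      refine latticeCoset_zsmul_congr hν ?_
      have h2 : ((4 * level B e * a ^ 2 : ℕ) : ℤ) ∣ γ 1 1 - 1 := by
        rw [← ZMod.intCast_zmod_eq_zero_iff_dvd]
        push_cast
        rw [hd, sub_self]
      have h3 : (a : ℤ) ∣ γ 1 1 - 1 := dvd_trans ⟨4 * level B e * a, by push_cast; ring⟩ h2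
      obtain ⟨t, ht⟩ := h3
      exact ⟨-t * ((u : ZMod a).cast : ℤ), by linear_combination (-((u : ZMod a).cast : ℤ)) * ht⟩
    have hk : ((kronecker (4 * discr B e) (γ 1 1) : ℤ) : ℂ) ^ 2 = 1 := by
      exact_mod_cast kronecker_sq hodd (isCoprime_four_discr hsymm hpos hint e hodd
        ((coprime_row γ).of_isCoprime_of_dvd_left (dvd_trans ⟨4 * a ^ 2, by ring⟩ hc)))
    have h5 := theta_smul hsymm hpos hint e ha (L.smul_mem ((u : ZMod a).cast : ℤ) hν) hc z
    rw [← h1] at h5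
    rw [h5, ← norm_pow, mul_pow, mul_pow, hk, one_mul, norm_mul, norm_pow, ← norm_autFactor_sq h4,
      norm_pow, norm_pow]
    ring

end ThetaCoset

/-! ### Coset representatives -/

section Cosets

variable {k N : ℕ}

theorem kronecker_sq_mul {q : ℕ} (hq : q ≠ 0) {c d : ℤ} (hd : Odd d) (h : IsCoprime (q : ℤ) d) :
    kronecker (q ^ 2 * c) d = kronecker c d := by
  have hq' : (0 : ℤ) < (q : ℤ) ^ 2 := by positivity
  rw [kronecker_of_odd _ hd, kronecker_of_odd _ hd, jacobiSym.mul_left, jacobiSym.sq_one', one_mul]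
  · have : (q : ℤ) ^ 2 * c < 0 ↔ c < 0 := by
      constructor
      · intro h; by_contra h'; exact absurd h (not_lt.mpr (mul_nonneg hq'.le (not_lt.mp h')))
      · exact fun h => mul_neg_of_pos_of_neg hq' h
    simp only [this]
  · rw [Int.isCoprime_iff_gcd_eq_one] at h
    simpa [Int.gcd, Int.natAbs_abs] using h

theorem coe_mapGL (γ : SL(2, ℤ)) (i j : Fin 2) :
    (mapGL ℝ γ : GL (Fin 2) ℝ) i j = ((γ i j : ℤ) : ℝ) := by
  simp [mapGL_coe_matrix]

theorem coe_xi (m : ℕ) [NeZero m] : ((xi m).1 : Matrix (Fin 2) (Fin 2) ℝ) = !![1, 0; 0, (m : ℝ)] :=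
  rfl

theorem xi_smul_coe (m : ℕ) [NeZero m] (z : ℍ) : (((xi m).1 • z : ℍ) : ℂ) = z / m := by
  have hm : (0 : ℝ) < m := by exact_mod_cast NeZero.pos m
  have hdet : 0 < (xi m).1.det.val := by
    rw [Matrix.GeneralLinearGroup.val_det_apply, coe_xi]
    simpa [Matrix.det_fin_two_of] using hm
  rw [UpperHalfPlane.coe_smul_of_det_pos hdet]
  simp [UpperHalfPlane.num, UpperHalfPlane.denom, coe_xi]

/-- The conjugate of `g` by `diag(1, m)`. -/
theorem exists_xi_comp_lift (hN : 4 ∣ N) (p : ℕ) [NeZero p] [NeZero (p ^ 2)] {g : SL(2, ℤ)}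
    (hg : g ∈ CongruenceSubgroup.Gamma1 N) (h : ((p ^ 2 : ℕ) : ℤ) ∣ g 0 1) :
    ∃ g' ∈ CongruenceSubgroup.Gamma1 N,
      (xi (p ^ 2)).comp (lift g) = (lift g').comp (xi (p ^ 2)) := by
  obtain ⟨b, hb⟩ := h
  have hdet := det_eq g
  rw [hb] at hdet
  let g' : SL(2, ℤ) := ⟨!![g 0 0, b; ((p ^ 2 : ℕ) : ℤ) * g 1 0, g 1 1], by
    rw [Matrix.det_fin_two_of]; linarith⟩
  have e00 : g' 0 0 = g 0 0 := rfl
  have e01 : g' 0 1 = b := rfl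
  have e10 : g' 1 0 = ((p ^ 2 : ℕ) : ℤ) * g 1 0 := rfl
  have e11 : g' 1 1 = g 1 1 := rfl
  rw [CongruenceSubgroup.Gamma1_mem] at hg
  have h4 : 4 ∣ g 1 0 := by
    have := (ZMod.intCast_zmod_eq_zero_iff_dvd _ _).mp hg.2.2
    exact dvd_trans (by exact_mod_cast hN) this
  refine ⟨g', ?_, ?_⟩
  · rw [CongruenceSubgroup.Gamma1_mem, e00, e11, e10, Int.cast_mul, hg.2.2, mul_zero]
    exact ⟨hg.1, hg.2.1, rfl⟩
  · ext1
    · change (xi (p ^ 2)).1 * mapGL ℝ g = mapGL ℝ g' * (xi (p ^ 2)).1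
      ext i j
      rw [Matrix.GeneralLinearGroup.coe_mul, Matrix.GeneralLinearGroup.coe_mul, Matrix.mul_apply,
        Matrix.mul_apply, Fin.sum_univ_two, Fin.sum_univ_two, coe_xi]
      simp only [coe_mapGL]
      fin_cases i <;> fin_cases j <;> simp [e00, e01, e10, e11, hb]
      · ring
      · ring
    · funext z
      change (xi (p ^ 2)).2 _ * autFactor g z = autFactor g' ((xi (p ^ 2)).1 • z) * (xi (p ^ 2)).2 z
      -- The lower left entry gains `p²`, which cancels against `z/p²` in the linear form and, being
      -- a square prime to `d`, does not change the Kronecker symbol.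
      have h1 : autFactor g' ((xi (p ^ 2)).1 • z) = autFactor g z := by
        unfold autFactor
        rw [e10, e11, xi_smul_coe]
        have hp0 : ((p : ℕ) : ℂ) ≠ 0 := by exact_mod_cast NeZero.ne p
        have hcop : IsCoprime (p : ℤ) (g 1 1) :=
          ⟨-(p * b * g 1 0), g 0 0, by push_cast at hdet; linear_combination hdet⟩
        congr 2
        · congr 1
          push_cast
          rw [kronecker_sq_mul (NeZero.ne p) (odd_of_four_dvd h4) hcop]
        · push_cast
          field_simp
      rw [h1, mul_comm]
      rfl

theorem lower_left_dvd_of_mem_Gamma1 {γ : SL(2, ℤ)} (h : γ ∈ CongruenceSubgroup.Gamma1 N) :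
    (N : ℤ) ∣ γ 1 0 :=
  (ZMod.intCast_zmod_eq_zero_iff_dvd _ _).mp ((CongruenceSubgroup.Gamma1_mem _ _).mp h).2.2

/-- The cosets `Δ₁ ξ g*` for `g` in `Γ₁(N)` exhaust the double coset, and two of them coincide
exactly if conjugating `g gⱼ⁻¹` by `ξ` stays integral, that is, if `p²` divides its upper right
entry. Invariance of `f` makes the chosen representatives irrelevant. -/
theorem shimuraHecke_eq_sum (hN : 4 ∣ N) (p : ℕ) [NeZero p] [NeZero (p ^ 2)] {f : ℍ → ℂ}
    (hf : ∀ γ ∈ CongruenceSubgroup.Gamma1 N, slash k f (lift γ) = f)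
    {ι : Type*} [Fintype ι] {g : ι → SL(2, ℤ)} (hg : ∀ i, g i ∈ CongruenceSubgroup.Gamma1 N)
    (hsurj : ∀ γ ∈ CongruenceSubgroup.Gamma1 N, ∃ i, ((p ^ 2 : ℕ) : ℤ) ∣ (γ * (g i)⁻¹) 0 1)
    (hinj : ∀ i j, ((p ^ 2 : ℕ) : ℤ) ∣ (g i * (g j)⁻¹) 0 1 → i = j) (z : ℍ) :
    shimuraHecke k N (p ^ 2) f z = ((((p ^ 2 : ℕ) : ℝ) ^ ((k : ℝ) / 4 - 1) : ℝ) : ℂ) *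
      ∑ i, slash k f ((xi (p ^ 2)).comp (lift (g i))) z := by
  have h4 : ∀ γ ∈ CongruenceSubgroup.Gamma1 N, 4 ∣ γ 1 0 := fun γ hγ =>
    dvd_trans (by exact_mod_cast hN) (lower_left_dvd_of_mem_Gamma1 hγ)
  let X : ι → Pair := fun i => (xi (p ^ 2)).comp (lift (g i))
  have hX : ∀ i, X i ∈ doubleCoset N (p ^ 2) := fun i =>
    ⟨1, one_mem _, g i, hg i, by rw [lift_one_comp]⟩
  let E : ι → cosetSpace N (p ^ 2) := fun i =>
    ⟨{y | ∃ γ ∈ CongruenceSubgroup.Gamma1 N, y = (lift γ).comp (X i)}, X i, hX i, rfl⟩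
  have hmem : ∀ i, X i ∈ (E i : Set Pair) := fun i => ⟨1, one_mem _, (lift_one_comp _).symm⟩
  have hEinj : Function.Injective E := by
    intro i j hij
    have h1 := hmem i
    rw [hij] at h1
    obtain ⟨γ, hγ, h2⟩ := h1
    apply hinj
    have h3 : (xi (p ^ 2)).1 * mapGL ℝ (g i) = mapGL ℝ γ * ((xi (p ^ 2)).1 * mapGL ℝ (g j)) :=
      congrArg Prod.fst h2
    have h5 : (xi (p ^ 2)).1 * mapGL ℝ (g i * (g j)⁻¹) = mapGL ℝ γ * (xi (p ^ 2)).1 := by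
      rw [map_mul, map_inv, ← mul_assoc, h3]
      group
    have h6 := congrArg (fun M : GL (Fin 2) ℝ => (M : Matrix (Fin 2) (Fin 2) ℝ) 0 1) h5
    simp only [Matrix.GeneralLinearGroup.coe_mul, Matrix.mul_apply, Fin.sum_univ_two, coe_xi,
      coe_mapGL] at h6
    simp only [Matrix.of_apply, Matrix.cons_val', Matrix.cons_val_zero, Matrix.cons_val_one,
      Matrix.cons_val_fin_one, one_mul, zero_mul, add_zero, mul_zero, zero_add] at h6
    refine ⟨γ 0 1, ?_⟩
    rw [mul_comm]
    exact_mod_cast h6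
  have hEsurj : Function.Surjective E := by
    rintro ⟨C, x, ⟨γ, hγ, γ', hγ', hx⟩, rfl⟩
    obtain ⟨i, hi⟩ := hsurj γ' hγ'
    have hh : γ' * (g i)⁻¹ ∈ CongruenceSubgroup.Gamma1 N := mul_mem hγ' (inv_mem (hg i))
    obtain ⟨h', hh', hcomm⟩ := exists_xi_comp_lift hN p hh hi
    have hxi : x = (lift (γ * h')).comp (X i) := by
      have h1 : lift γ' = (lift (γ' * (g i)⁻¹)).comp (lift (g i)) := by
        rw [← lift_mul (h4 _ hh) (h4 _ (hg i)), inv_mul_cancel_right]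
      rw [hx, h1, comp_assoc, ← comp_assoc (xi (p ^ 2)), hcomm, lift_mul (h4 _ hγ) (h4 _ hh')]
      simp only [X, comp_assoc]
    refine ⟨i, Subtype.ext ?_⟩
    change {y | _} = {y | _}
    ext y
    constructor
    · rintro ⟨δ, hδ, rfl⟩
      have hm : γ * h' ∈ CongruenceSubgroup.Gamma1 N := mul_mem hγ hh'
      refine ⟨δ * (γ * h')⁻¹, mul_mem hδ (inv_mem hm), ?_⟩
      rw [hxi, ← comp_assoc (lift _) (lift _) (X i), ← lift_mul (h4 _ (mul_mem hδ (inv_mem hm))) (h4 _ hm),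
        inv_mul_cancel_right]
    · rintro ⟨δ, hδ, rfl⟩
      have hm : γ * h' ∈ CongruenceSubgroup.Gamma1 N := mul_mem hγ hh'
      refine ⟨δ * (γ * h'), mul_mem hδ hm, ?_⟩
      rw [hxi, ← comp_assoc (lift _) (lift _) (X i), ← lift_mul (h4 _ hδ) (h4 _ hm)]
  rw [shimuraHecke]
  congr 1
  rw [← finsum_eq_sum_of_fintype]
  refine (finsum_eq_of_bijective E ⟨hEinj, hEsurj⟩ fun i => ?_).symm
  have hsp := (E i).2.choose_spec
  have h1 : (E i).2.choose ∈ (E i : Set Pair) :=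
    (Set.ext_iff.mp hsp.2 _).mpr ⟨1, one_mem _, (lift_one_comp _).symm⟩
  obtain ⟨γ, hγ, h2⟩ := h1
  rw [h2, slash_comp k f (lift γ) (X i), hf γ hγ]

theorem translate_mem_Gamma1 (t : ℤ) : translate t ∈ CongruenceSubgroup.Gamma1 N :=
  (CongruenceSubgroup.Gamma1_mem _ _).mpr (by simp [translate])

theorem translate_add (s t : ℤ) : translate (s + t) = translate s * translate t := by
  ext i j
  rw [mul_entry]
  fin_cases i <;> fin_cases j <;> simp [translate, add_comm]

theorem translate_neg (t : ℤ) : translate (-t) = (translate t)⁻¹ := by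
  rw [eq_inv_iff_mul_eq_one, ← translate_add, neg_add_cancel]
  ext i j
  fin_cases i <;> fin_cases j <;> simp [translate]

theorem exists_dvd_mul_translate_inv {m : ℕ} [NeZero m] {γ : SL(2, ℤ)}
    (h : IsCoprime (m : ℤ) (γ 0 0)) :
    ∃ t : ZMod m, (m : ℤ) ∣ (γ * (translate t.val)⁻¹) 0 1 := by
  have hu : IsUnit ((γ 0 0 : ℤ) : ZMod m) := (ZMod.coe_int_isUnit_iff_isCoprime _ _).mpr h
  obtain ⟨u, hu⟩ := hu
  refine ⟨(↑u⁻¹ : ZMod m) * (γ 0 1 : ℤ), ?_⟩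
  rw [← translate_neg, mul_entry, ← ZMod.intCast_zmod_eq_zero_iff_dvd]
  have h0 : translate (-((((↑u⁻¹ : ZMod m) * (γ 0 1 : ℤ)).val : ℕ) : ℤ)) 0 1 =
    -((((↑u⁻¹ : ZMod m) * (γ 0 1 : ℤ)).val : ℕ) : ℤ) := rfl
  have h1 : translate (-((((↑u⁻¹ : ZMod m) * (γ 0 1 : ℤ)).val : ℕ) : ℤ)) 1 1 = 1 := rfl
  rw [h0, h1]
  push_cast
  rw [ZMod.natCast_zmod_val, ← hu, mul_neg, Units.mul_inv_cancel_left]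
  ring

/-- The matrices `(1, t; 0, 1)` with `0 ≤ t < p²` represent the cosets if `p ∣ N`. -/
theorem shimuraHecke_eq_of_dvd (hN : 4 ∣ N) {p : ℕ} (hp : p.Prime) [NeZero (p ^ 2)] (hpN : p ∣ N)
    {f : ℍ → ℂ} (hf : ∀ γ ∈ CongruenceSubgroup.Gamma1 N, slash k f (lift γ) = f) (z : ℍ) :
    shimuraHecke k N (p ^ 2) f z = ((((p ^ 2 : ℕ) : ℝ) ^ ((k : ℝ) / 4 - 1) : ℝ) : ℂ) *
      ∑ t : ZMod (p ^ 2), slash k f ((xi (p ^ 2)).comp (lift (translate t.val))) z := by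
  have : NeZero p := ⟨hp.ne_zero⟩
  refine shimuraHecke_eq_sum hN p hf (fun t => translate_mem_Gamma1 _) (fun γ hγ => ?_)
    (fun i j h => ?_) z
  · have h1 : IsCoprime (p : ℤ) (γ 0 0) := by
      have h2 : IsCoprime (γ 1 0) (γ 0 0) := ⟨-γ 0 1, γ 1 1, by linear_combination det_eq γ⟩
      exact h2.of_isCoprime_of_dvd_left
        (dvd_trans (by exact_mod_cast hpN) (lower_left_dvd_of_mem_Gamma1 hγ))
    exact exists_dvd_mul_translate_inv (by push_cast; exact h1.pow_left)
  · rw [← translate_neg, ← translate_add] at h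
    have h1 : ((p ^ 2 : ℕ) : ℤ) ∣ (i.val : ℤ) + -j.val := h
    rw [← ZMod.intCast_zmod_eq_zero_iff_dvd] at h1
    push_cast at h1
    rw [ZMod.natCast_zmod_val, ZMod.natCast_zmod_val] at h1
    linear_combination h1

/-- Representatives `(p x, y; N, 1)` with prescribed `x` modulo `p`. -/
theorem exists_representative {p : ℕ} [Fact p.Prime] (hpN : IsCoprime (p : ℤ) N) (α : ZMod p) :
    ∃ x y : ℤ, p * x - N * y = 1 ∧ (x : ZMod p) = α := by
  have hu : IsUnit ((N : ℤ) : ZMod p) := (ZMod.coe_int_isUnit_iff_isCoprime _ _).mpr hpN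
  obtain ⟨x₀, y₀, h0⟩ := hpN
  set s : ZMod p := (α - x₀) * ((N : ℤ) : ZMod p)⁻¹ with hs
  refine ⟨x₀ + N * s.val, -y₀ + p * s.val, by linear_combination h0, ?_⟩
  push_cast
  rw [ZMod.natCast_zmod_val, hs]
  have := hu.ne_zero
  push_cast at this ⊢
  linear_combination (α - x₀) * mul_inv_cancel₀ this

/-- The matrix `(p x, y; N, 1)`. -/
def lowerRep (p N : ℕ) (x y : ℤ) (h : p * x - N * y = 1) : SL(2, ℤ) :=
  ⟨!![p * x, y; (N : ℤ), 1], by rw [Matrix.det_fin_two_of]; linarith⟩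

theorem lowerRep_mem_Gamma1 {p : ℕ} {x y : ℤ} (h : p * x - N * y = 1) :
    lowerRep p N x y h ∈ CongruenceSubgroup.Gamma1 N := by
  refine (CongruenceSubgroup.Gamma1_mem _ _).mpr ⟨?_, ?_, ?_⟩
  · change ((p * x : ℤ) : ZMod N) = 1
    rw [show (p * x : ℤ) = 1 + N * y by linarith]
    push_cast; simp
  · change ((1 : ℤ) : ZMod N) = 1
    simp
  · change ((N : ℤ) : ZMod N) = 0
    simp

theorem mul_inv_entry (γ δ : SL(2, ℤ)) :
    (γ * δ⁻¹) 0 1 = γ 0 1 * δ 0 0 - γ 0 0 * δ 0 1 := by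
  rw [mul_entry, Matrix.SpecialLinearGroup.SL2_inv_expl]
  change γ 0 0 * -δ 0 1 + γ 0 1 * δ 0 0 = _
  ring

theorem natCast_sq_dvd_mul_iff {p : ℕ} (hp : p ≠ 0) {n : ℤ} :
    ((p ^ 2 : ℕ) : ℤ) ∣ p * n ↔ (n : ZMod p) = 0 := by
  rw [ZMod.intCast_zmod_eq_zero_iff_dvd]
  push_cast
  rw [sq]
  exact mul_dvd_mul_iff_left (by exact_mod_cast hp)

/-- Representatives of the cosets if `p` does not divide `N`. -/
theorem shimuraHecke_eq_of_isCoprime (hN : 4 ∣ N) {p : ℕ} [Fact p.Prime] [NeZero (p ^ 2)]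
    (hpN : IsCoprime (p : ℤ) N)
    {f : ℍ → ℂ} (hf : ∀ γ ∈ CongruenceSubgroup.Gamma1 N, slash k f (lift γ) = f)
    {x y : ZMod p → ℤ} (hxy : ∀ j, p * x j - N * y j = 1)
    (hx : ∀ j, (x j : ZMod p) = ((N : ZMod p) * j)⁻¹) (z : ℍ) :
    shimuraHecke k N (p ^ 2) f z = ((((p ^ 2 : ℕ) : ℝ) ^ ((k : ℝ) / 4 - 1) : ℝ) : ℂ) *
      (∑ t : ZMod (p ^ 2), slash k f ((xi (p ^ 2)).comp (lift (translate t.val))) z +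
        ∑ j : ZMod p, slash k f ((xi (p ^ 2)).comp (lift (lowerRep p N (x j) (y j) (hxy j)))) z) := by
  have hp : p.Prime := Fact.out
  have : NeZero p := ⟨hp.ne_zero⟩
  have hN0 : (N : ZMod p) ≠ 0 := by
    have : IsUnit ((N : ℤ) : ZMod p) := (ZMod.coe_int_isUnit_iff_isCoprime _ _).mpr hpN
    simpa using this.ne_zero
  have hy : ∀ j, (N : ZMod p) * (y j : ZMod p) = -1 := by
    intro j
    have := congrArg (Int.cast : ℤ → ZMod p) (hxy j)
    push_cast at this
    rw [CharP.cast_eq_zero, zero_mul, zero_sub] at this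
    rw [← this, neg_neg]
  let g : ZMod (p ^ 2) ⊕ ZMod p → SL(2, ℤ) :=
    Sum.elim (fun t => translate t.val) (fun j => lowerRep p N (x j) (y j) (hxy j))
  have hgT : ∀ t, g (Sum.inl t) = translate t.val := fun _ => rfl
  have hgL : ∀ j, g (Sum.inr j) = lowerRep p N (x j) (y j) (hxy j) := fun _ => rfl
  have hg : ∀ i, g i ∈ CongruenceSubgroup.Gamma1 N := by
    rintro (t | j)
    · exact translate_mem_Gamma1 _
    · exact lowerRep_mem_Gamma1 (hxy j)
  have hT0 : ∀ t, translate t 0 0 = 1 := fun _ => rfl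
  have hT1 : ∀ t, translate t 0 1 = t := fun _ => rfl
  have hL0 : ∀ j, lowerRep p N (x j) (y j) (hxy j) 0 0 = p * x j := fun _ => rfl
  have hL1 : ∀ j, lowerRep p N (x j) (y j) (hxy j) 0 1 = y j := fun _ => rfl
  have hmixed : ∀ (t : ℤ) (j : ZMod p), ¬ ((p ^ 2 : ℕ) : ℤ) ∣ t * (p * x j) - 1 * y j := by
    intro t j h
    have h1 : (p : ℤ) ∣ t * (p * x j) - 1 * y j := dvd_trans ⟨p, by push_cast; ring⟩ h
    rw [← ZMod.intCast_zmod_eq_zero_iff_dvd] at h1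
    push_cast at h1
    rw [CharP.cast_eq_zero, zero_mul, mul_zero, one_mul, zero_sub, neg_eq_zero] at h1
    have := hy j
    rw [h1, mul_zero] at this
    exact one_ne_zero (neg_eq_zero.mp this.symm)
  have hsurj : ∀ γ ∈ CongruenceSubgroup.Gamma1 N, ∃ i, ((p ^ 2 : ℕ) : ℤ) ∣ (γ * (g i)⁻¹) 0 1 := by
    intro γ hγ
    -- If `p` does not divide the upper left entry, a translation works. Otherwise the required
    -- divisibility by `p²` has one factor `p` built in and leaves a linear condition on `x` modulo
    -- `p`, solved by `α`.
    by_cases h0 : (p : ℤ) ∣ γ 0 0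
    · obtain ⟨a', ha'⟩ := h0
      have hb : ((γ 0 1 : ℤ) : ZMod p) ≠ 0 := by
        rw [Ne, ZMod.intCast_zmod_eq_zero_iff_dvd]
        rintro ⟨b', hb'⟩
        have hdet := det_eq γ
        rw [ha', hb'] at hdet
        have : IsUnit (p : ℤ) :=
          IsUnit.of_mul_eq_one (a' * γ 1 1 - b' * γ 1 0) (by linear_combination hdet)
        exact (Nat.prime_iff_prime_int.mp hp).not_isUnit this
      set α : ZMod p := -(a' : ZMod p) * ((γ 0 1 : ℤ) * (N : ZMod p))⁻¹ with hα
      -- With `0⁻¹ = 0` in `ZMod p`, the labelling `j ↦ (Nj)⁻¹` is an involution, so every residue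
      -- `α`, including `0`, occurs.
      have hxα : (x ((N : ZMod p) * α)⁻¹ : ZMod p) = α := by
        rw [hx, mul_inv_rev, inv_inv, mul_comm (N : ZMod p) α, mul_inv_cancel_right₀ hN0]
      refine ⟨Sum.inr ((N : ZMod p) * α)⁻¹, ?_⟩
      rw [hgL, mul_inv_entry, hL0, hL1, ha',
        show γ 0 1 * (p * x ((N : ZMod p) * α)⁻¹) - p * a' * y ((N : ZMod p) * α)⁻¹ =
          p * (γ 0 1 * x ((N : ZMod p) * α)⁻¹ - a' * y ((N : ZMod p) * α)⁻¹) by ring,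
        natCast_sq_dvd_mul_iff hp.ne_zero]
      push_cast
      rw [hxα]
      refine (mul_eq_zero.mp ?_).resolve_left hN0
      have h2 := mul_inv_cancel₀ (mul_ne_zero hb hN0)
      rw [hα]
      linear_combination -(a' : ZMod p) * h2 - (a' : ZMod p) * hy ((N : ZMod p) * α)⁻¹
    · obtain ⟨t, ht⟩ := exists_dvd_mul_translate_inv (m := p ^ 2) (γ := γ) (by
        push_cast
        exact ((Nat.prime_iff_prime_int.mp hp).coprime_iff_not_dvd.mpr h0).pow_left)
      exact ⟨Sum.inl t, ht⟩
  have hinj : ∀ i j, ((p ^ 2 : ℕ) : ℤ) ∣ (g i * (g j)⁻¹) 0 1 → i = j := by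
    rintro (t | j) (t' | j') h
    · rw [hgT, hgT, mul_inv_entry, hT0, hT0, hT1, hT1, ← ZMod.intCast_zmod_eq_zero_iff_dvd] at h
      push_cast at h
      rw [ZMod.natCast_zmod_val, ZMod.natCast_zmod_val] at h
      congr 1
      linear_combination h
    · rw [hgT, hgL, mul_inv_entry, hT0, hT1, hL0, hL1] at h
      exact absurd h (hmixed _ _)
    · rw [hgT, hgL, mul_inv_entry, hT0, hT1, hL0, hL1] at h
      refine absurd ?_ (hmixed t'.val j)
      rw [← dvd_neg]
      convert! h using 1
      ring
    · rw [hgL, hgL, mul_inv_entry, hL0, hL0, hL1, hL1,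
        show y j * (p * x j') - p * x j * y j' = p * (y j * x j' - x j * y j') by ring,
        natCast_sq_dvd_mul_iff hp.ne_zero] at h
      push_cast at h
      congr 1
      have h1 : (x j : ZMod p) = x j' := by
        linear_combination (N : ZMod p) * h - (x j' : ZMod p) * hy j + (x j : ZMod p) * hy j'
      rw [hx, hx] at h1
      exact mul_left_cancel₀ hN0 (inv_injective h1)
  rw [shimuraHecke_eq_sum hN p hf hg hsurj hinj, Fintype.sum_sum_type]
  rfl

end Cosets

/-! ### Evaluation of the Hecke operators -/

section HeckeEval

variable {k N : ℕ}

theorem sqrt_natCast_mul {n : ℕ} (hn : n ≠ 0) {v : ℂ} (hv : v ≠ 0) :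
    (n * v) ^ (1 / 2 : ℂ) = (n : ℂ) ^ (1 / 2 : ℂ) * v ^ (1 / 2 : ℂ) := by
  have hn0 : (n : ℂ) ≠ 0 := by exact_mod_cast hn
  rw [← sqrt_div_natCast (mul_ne_zero hn0 hv) n hn, mul_div_cancel_left₀ _ hn0, mul_comm]

theorem xi_sq_snd (p : ℕ) [NeZero (p ^ 2)] (z : ℍ) :
    (xi (p ^ 2)).2 z = (p : ℂ) ^ (1 / 2 : ℂ) := by
  have h1 : (((p ^ 2 : ℕ) : ℝ) ^ (1 / 4 : ℝ)) = (p : ℝ) ^ (1 / 2 : ℝ) := by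
    push_cast
    rw [← Real.rpow_natCast, ← Real.rpow_mul p.cast_nonneg]
    norm_num
  change ((((p ^ 2 : ℕ) : ℝ) ^ (1 / 4 : ℝ) : ℝ) : ℂ) = _
  rw [h1, Complex.ofReal_cpow p.cast_nonneg]
  norm_num

theorem slash_xi_comp_lift (p : ℕ) [NeZero (p ^ 2)] (f : ℍ → ℂ) (g : SL(2, ℤ)) (z : ℍ) :
    slash k f ((xi (p ^ 2)).comp (lift g)) z =
      f ((xi (p ^ 2)).1 • (g • z)) * (((p : ℂ) ^ (1 / 2 : ℂ) * autFactor g z) ^ k)⁻¹ := by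
  have : ((xi (p ^ 2)).comp (lift g)).1 • z = (xi (p ^ 2)).1 • (g • z) := mul_smul _ _ _
  rw [slash, this]
  change _ * (((xi (p ^ 2)).2 _ * autFactor g z) ^ k)⁻¹ = _
  rw [xi_sq_snd]

theorem slash_xi_translate (p : ℕ) [NeZero (p ^ 2)] (f : ℍ → ℂ) (t : ℤ) {z w : ℍ}
    (hw : (w : ℂ) = (z + t) / (p : ℂ) ^ 2) :
    slash k f ((xi (p ^ 2)).comp (lift (translate t))) z =
      (((p : ℂ) ^ (1 / 2 : ℂ)) ^ k)⁻¹ * f w := by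
  have h1 : (xi (p ^ 2)).1 • (translate t • z) = w := by
    apply UpperHalfPlane.ext
    rw [xi_smul_coe, translate_smul_coe, hw]
    push_cast; rfl
  rw [slash_xi_comp_lift, h1, autFactor_of_lower_zero rfl, mul_one, mul_comm]

theorem lowerRep_smul_coe {p : ℕ} {x y : ℤ} (h : p * x - N * y = 1) (z : ℍ) :
    ((lowerRep p N x y h • z : ℍ) : ℂ) = (p * x * z + y) / (N * z + 1) := by
  rw [smul_coe]
  simp [lowerRep]

theorem autFactor_lowerRep {p : ℕ} {x y : ℤ} (h : p * x - N * y = 1) (z : ℍ) :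
    autFactor (lowerRep p N x y h) z = ((N : ℂ) * z + 1) ^ (1 / 2 : ℂ) := by
  have e10 : lowerRep p N x y h 1 0 = N := rfl
  have e11 : lowerRep p N x y h 1 1 = 1 := rfl
  rw [autFactor, e10, e11]
  simp [epsilon, kronecker_of_odd]

theorem natCast_mul_add_one_ne_zero (N : ℕ) (z : ℍ) : (N : ℂ) * z + 1 ≠ 0 := by
  intro h
  have h1 := congrArg Complex.im h
  have h2 := congrArg Complex.re h
  simp [z.im_ne_zero] at h1
  simp [h1] at h2

theorem epsilon_congr {d d' : ℤ} (h : (4 : ℤ) ∣ d - d') : epsilon d = epsilon d' := by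
  have : d % 4 = d' % 4 := by omega
  rw [epsilon, this, epsilon]

/-- The factor `N` contributes `(N/p)` by periodicity, and the factor `p` contributes `χ₄(p)(jN/p)`
by reciprocity; the two symbols `(N/p)` cancel. -/
theorem kronecker_mul_add {p : ℕ} (hp : Odd p) (hN : 4 ∣ N) (hN0 : 0 < N)
    (hpN : IsCoprime (p : ℤ) N) (j : ℕ) :
    kronecker (p * N) (p + j * N) = J(-j | p) := by
  obtain ⟨s, rfl⟩ := hN
  have hd : Odd (p + j * (4 * s)) := by
    rw [Nat.odd_iff] at hp ⊢
    have : j * (4 * s) = 2 * (2 * (j * s)) := by ring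
    omega
  have hd4 : (p + j * (4 * s)) % 4 = p % 4 := by
    have : j * (4 * s) = 4 * (j * s) := by ring
    omega
  have h1 : kronecker (((4 * s : ℕ) : ℤ)) ((p + j * (4 * s) : ℕ) : ℤ) =
      kronecker ((4 * s : ℕ) : ℤ) (p : ℤ) :=
    kronecker_eq_of_dvd_sub (by exact_mod_cast hN0.ne') ⟨s, by push_cast; ring⟩
      (by exact_mod_cast hd) ⟨j, by push_cast; ring⟩
  rw [kronecker_natCast_right _ hd, kronecker_natCast_right _ hp] at h1
  have h2 : J((p : ℤ) | p + j * (4 * s)) = ZMod.χ₄ p * (J((j : ℤ) | p) * J(((4 * s : ℕ) : ℤ) | p)) := by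
    have h3 : J(((p + j * (4 * s) : ℕ) : ℤ) | p) = J((j : ℤ) | p) * J(((4 * s : ℕ) : ℤ) | p) := by
      rw [← jacobiSym.mul_left]
      apply jacobiSym.mod_left'
      refine Int.ModEq.symm (n := p) ?_
      rw [Int.modEq_iff_dvd]
      exact ⟨1, by push_cast; ring⟩
    rw [← h3]
    rcases Nat.odd_mod_four_iff.mp (Nat.odd_iff.mp hp) with h4 | h4
    · rw [ZMod.χ₄_nat_one_mod_four h4, one_mul]
      exact jacobiSym.quadratic_reciprocity_one_mod_four h4 hd
    · rw [ZMod.χ₄_nat_three_mod_four h4, neg_one_mul]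
      exact jacobiSym.quadratic_reciprocity_three_mod_four h4 (hd4.trans h4)
  have h4 : J(((4 * s : ℕ) : ℤ) | p) ^ 2 = 1 :=
    jacobiSym.sq_one (Int.isCoprime_iff_gcd_eq_one.mp hpN.symm)
  have h5 : J(-(j : ℤ) | p) = ZMod.χ₄ p * J((j : ℤ) | p) := by
    rw [neg_eq_neg_one_mul, jacobiSym.mul_left, jacobiSym.at_neg_one hp]
  have h6 : ((p : ℤ) + j * ((4 * s : ℕ) : ℤ)) = ((p + j * (4 * s) : ℕ) : ℤ) := by push_cast; ring
  rw [h6, kronecker_natCast_right _ hd, jacobiSym.mul_left, h1, h2, h5]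
  linear_combination (ZMod.χ₄ p * J((j : ℤ) | p)) * h4

section

variable {ω : ℤ → ℂ} {f : ℍ → ℂ}

theorem apply_smul_of_slash_eq (hN : 4 ∣ N)
    (hf : ∀ γ ∈ CongruenceSubgroup.Gamma0 N, ∀ z, slash k f (lift γ) z = ω (γ 1 1) * f z)
    {γ : SL(2, ℤ)} (hγ : (N : ℤ) ∣ γ 1 0) (z : ℍ) :
    f (γ • z) = ω (γ 1 1) * autFactor γ z ^ k * f z := by
  have h1 := hf γ (CongruenceSubgroup.Gamma0_mem.mpr ((ZMod.intCast_zmod_eq_zero_iff_dvd _ _).mpr hγ)) z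
  have h0 := pow_ne_zero k (autFactor_ne_zero (dvd_trans (by exact_mod_cast hN) hγ) z)
  change f (γ • z) * (autFactor γ z ^ k)⁻¹ = _ at h1
  field_simp at h1
  rw [h1]; ring

/-- The reason is the factorization `diag(1, p²)(px, y; N, 1) = (x, b; pN, p + jN)(p, -j; 0, p)`,
valid because `pb = y + xj`; its first factor lies in `Γ₀(N)`. -/
theorem slash_xi_lowerRep (hN : 4 ∣ N) (hN0 : 0 < N) {p : ℕ} [Fact p.Prime] [NeZero (p ^ 2)]
    (hpN : IsCoprime (p : ℤ) N)
    (hf : ∀ γ ∈ CongruenceSubgroup.Gamma0 N, ∀ z, slash k f (lift γ) z = ω (γ 1 1) * f z)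
    {x y b : ℤ} (h : p * x - N * y = 1) {j : ℕ} (hb : p * b = y + x * j) {z w : ℍ}
    (hw : (w : ℂ) = z - j / p) :
    slash k f ((xi (p ^ 2)).comp (lift (lowerRep p N x y h))) z =
      ω (p + j * N) * ((epsilon p)⁻¹ * (J(-j | p) : ℂ)) ^ k * f w := by
  have hp : p.Prime := Fact.out
  have hp0 : (p : ℂ) ≠ 0 := by exact_mod_cast hp.ne_zero
  have hodd : Odd p := by
    refine hp.odd_of_ne_two ?_
    rintro rfl
    obtain ⟨s, rfl⟩ := hN
    have : IsUnit (2 : ℤ) := hpN.isUnit_of_dvd' dvd_rfl ⟨2 * s, by push_cast; ring⟩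
    rw [Int.isUnit_iff] at this
    omega
  let γ : SL(2, ℤ) := ⟨!![x, b; (p * N : ℤ), p + j * N], by
    rw [Matrix.det_fin_two_of]; linear_combination h - N * hb⟩
  have e00 : γ 0 0 = x := rfl
  have e01 : γ 0 1 = b := rfl
  have e10 : γ 1 0 = p * N := rfl
  have e11 : γ 1 1 = p + j * N := rfl
  have hW := natCast_mul_add_one_ne_zero N z
  have hrow : (((p * N : ℤ) : ℂ) * w + ((p + j * N : ℤ) : ℂ)) = p * (N * z + 1) := by
    rw [hw]; push_cast; field_simp; ring
  have h1 : (xi (p ^ 2)).1 • (lowerRep p N x y h • z) = γ • w := by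
    apply UpperHalfPlane.ext
    rw [xi_smul_coe, lowerRep_smul_coe, smul_coe, e00, e01, e10, e11, hrow, hw]
    have hb' : (p : ℂ) * b = y + x * j := by exact_mod_cast hb
    have hnum : (x : ℂ) * (z - j / p) + b = (p * x * z + y) / p := by
      field_simp
      linear_combination hb'
    rw [hnum]
    push_cast
    generalize (N : ℂ) * (z : ℂ) + 1 = W at hW
    field_simp
  have h2 : autFactor γ w = (epsilon p)⁻¹ * (J(-j | p) : ℂ) *
      ((p : ℂ) ^ (1 / 2 : ℂ) * ((N : ℂ) * z + 1) ^ (1 / 2 : ℂ)) := by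
    rw [autFactor, e10, e11, hrow, sqrt_natCast_mul hp.ne_zero hW,
      kronecker_mul_add hodd hN hN0 hpN,
      epsilon_congr (d := (p : ℤ) + j * N) (d' := p) (by
        rw [add_sub_cancel_left]; exact dvd_mul_of_dvd_right (by exact_mod_cast hN) _)]
  rw [slash_xi_comp_lift, h1, apply_smul_of_slash_eq hN hf (γ := γ) ⟨p, by rw [e10]; ring⟩, h2,
    autFactor_lowerRep, e11, mul_pow]
  have h3 := pow_ne_zero k (mul_ne_zero (cpow_half_ne_zero hp0) (cpow_half_ne_zero hW))
  field_simp

/-- For `x = px'` the factorization is `diag(1, p²)(px, y; N, 1) = (x', y; N, p²) diag(p², 1)`, and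
the symbol and `ε` at the square `p²` are trivial. -/
theorem slash_xi_lowerRep_of_dvd (hN : 4 ∣ N) {p : ℕ} [Fact p.Prime] [NeZero (p ^ 2)]
    (hpN : IsCoprime (p : ℤ) N)
    (hf : ∀ γ ∈ CongruenceSubgroup.Gamma0 N, ∀ z, slash k f (lift γ) z = ω (γ 1 1) * f z)
    {x y x' : ℤ} (h : p * x - N * y = 1) (hx : x = p * x') {z w : ℍ}
    (hw : (w : ℂ) = (p : ℂ) ^ 2 * z) :
    slash k f ((xi (p ^ 2)).comp (lift (lowerRep p N x y h))) z =
      ω ((p : ℤ) ^ 2) * ((p : ℂ) ^ (1 / 2 : ℂ)) ^ k * f w := by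
  have hp : p.Prime := Fact.out
  have hp0 : (p : ℂ) ≠ 0 := by exact_mod_cast hp.ne_zero
  have hodd : Odd p := by
    refine hp.odd_of_ne_two ?_
    rintro rfl
    obtain ⟨s, rfl⟩ := hN
    have : IsUnit (2 : ℤ) := hpN.isUnit_of_dvd' dvd_rfl ⟨2 * s, by push_cast; ring⟩
    rw [Int.isUnit_iff] at this
    omega
  let γ : SL(2, ℤ) := ⟨!![x', y; (N : ℤ), (p : ℤ) ^ 2], by
    rw [Matrix.det_fin_two_of]; rw [hx] at h; linear_combination h⟩
  have e00 : γ 0 0 = x' := rfl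
  have e01 : γ 0 1 = y := rfl
  have e10 : γ 1 0 = N := rfl
  have e11 : γ 1 1 = (p : ℤ) ^ 2 := rfl
  have hW := natCast_mul_add_one_ne_zero N z
  have hrow : (((N : ℤ) : ℂ) * w + (((p : ℤ) ^ 2 : ℤ) : ℂ)) = p * (p * (N * z + 1)) := by
    rw [hw]; push_cast; ring
  have h1 : (xi (p ^ 2)).1 • (lowerRep p N x y h • z) = γ • w := by
    apply UpperHalfPlane.ext
    rw [xi_smul_coe, lowerRep_smul_coe, smul_coe, e00, e01, e10, e11, hrow, hw, hx]
    push_cast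
    field_simp
  have hK : kronecker (N : ℤ) ((p : ℤ) ^ 2) = 1 := by
    have h3 : ((p : ℤ) ^ 2) = ((p ^ 2 : ℕ) : ℤ) := by push_cast; rfl
    rw [h3, kronecker_natCast_right _ hodd.pow, jacobiSym.pow_right,
      jacobiSym.sq_one (Int.isCoprime_iff_gcd_eq_one.mp hpN.symm)]
  have hE : epsilon ((p : ℤ) ^ 2) = 1 := by
    have h3 : ((p : ℤ) ^ 2) % 4 = 1 := by
      have : Odd (p : ℤ) := by exact_mod_cast hodd
      exact Int.sq_mod_four_eq_one_of_odd this
    rw [epsilon, if_pos h3]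
  have h2 : autFactor γ w = (p : ℂ) ^ (1 / 2 : ℂ) * ((p : ℂ) ^ (1 / 2 : ℂ) *
      ((N : ℂ) * z + 1) ^ (1 / 2 : ℂ)) := by
    rw [autFactor, e10, e11, hrow, sqrt_natCast_mul hp.ne_zero (mul_ne_zero hp0 hW),
      sqrt_natCast_mul hp.ne_zero hW, hK, hE]
    simp
  rw [slash_xi_comp_lift, h1, apply_smul_of_slash_eq hN hf (γ := γ) ⟨1, by rw [e10]; ring⟩, h2,
    autFactor_lowerRep, e11, mul_pow]
  have h3 := pow_ne_zero k (mul_ne_zero (cpow_half_ne_zero hp0) (cpow_half_ne_zero hW))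
  field_simp

end

section Family

variable {a : ℕ} [NeZero a] {ψ : ℤ → ℂ} {θ : (ZMod a)ˣ → ℍ → ℂ}

theorem ThetaFamily.slash_charComponent (h : ThetaFamily k N a ψ θ) (ha : a ∣ N)
    (hψ1 : ∀ d : ℤ, (N : ℤ) ∣ d - 1 → ψ d = 1) (χ : DirichletCharacter ℂ a) :
    ∀ γ ∈ CongruenceSubgroup.Gamma1 N, slash k (charComponent θ χ) (lift γ) = charComponent θ χ := by
  intro γ hγ
  funext z
  have hγ0 : γ ∈ CongruenceSubgroup.Gamma0 N := CongruenceSubgroup.Gamma0_mem.mpr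
    ((CongruenceSubgroup.Gamma1_mem _ _).mp hγ).2.2
  have h1 := ((CongruenceSubgroup.Gamma1_mem _ _).mp hγ).2.1
  have h2 : (N : ℤ) ∣ γ 1 1 - 1 := by
    rw [← ZMod.intCast_zmod_eq_zero_iff_dvd]; push_cast; rw [h1, sub_self]
  have h3 : ((γ 1 1 : ℤ) : ZMod a) = 1 := by
    rw [← sub_eq_zero]
    have := (ZMod.intCast_zmod_eq_zero_iff_dvd _ a).mpr
      (dvd_trans (by exact_mod_cast ha : (a : ℤ) ∣ N) h2)
    push_cast at this
    exact this
  rw [(h.isModularForm_charComponent ha χ).slash_eq γ hγ0 z, hψ1 _ h2, h3]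
  simp

theorem ThetaFamily.hecke_eq_of_dvd (h : ThetaFamily k N a ψ θ) [NeZero N] (ha : a ∣ N) (hN : 4 ∣ N)
    (hψ : ∀ d : ℤ, IsCoprime (N : ℤ) d → ψ d ≠ 0) (hψ1 : ∀ d : ℤ, (N : ℤ) ∣ d - 1 → ψ d = 1)
    {p : ℕ} (hp : p.Prime) [NeZero (p ^ 2)] (hpN : p ∣ N) {z : ℍ} {w : ZMod (p ^ 2) → ℍ}
    (hw : ∀ t, (w t : ℂ) = (z + t.val) / (p : ℂ) ^ 2) :
    hecke k N a ψ (p ^ 2) (θ 1) z = ((((p ^ 2 : ℕ) : ℝ) ^ ((k : ℝ) / 4 - 1) : ℝ) : ℂ) *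
      ((((p : ℂ) ^ (1 / 2 : ℂ)) ^ k)⁻¹ * ∑ t, θ 1 (w t)) := by
  rw [h.hecke_eq ha hψ]
  simp_rw [fun χ => shimuraHecke_eq_of_dvd hN hp hpN (h.slash_charComponent ha hψ1 χ) z]
  rw [← Finset.mul_sum, Finset.sum_comm]
  congr 1
  rw [Finset.mul_sum]
  refine Finset.sum_congr rfl fun t _ => ?_
  simp_rw [fun χ => slash_xi_translate (k := k) p (charComponent θ χ) (t.val : ℤ) (z := z) (w := w t)
    (by rw [hw]; push_cast; rfl)]
  rw [← Finset.mul_sum]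
  have := sum_mul_charComponent θ 1 (w t)
  simp only [Units.val_one, map_one, one_mul, inv_one] at this
  rw [this]

/-- On the component at `χ` the extra representatives yield `χ(p)` or `χ(p)²`; summed over `χ`,
these move the family from `1` to `u⁻¹` or `u⁻²`. -/
theorem ThetaFamily.hecke_eq_of_isCoprime (h : ThetaFamily k N a ψ θ) [NeZero N] (ha : a ∣ N)
    (hN : 4 ∣ N) (hk : k ≠ 0) (hψ : ∀ d : ℤ, IsCoprime (N : ℤ) d → ψ d ≠ 0)
    (hψ1 : ∀ d : ℤ, (N : ℤ) ∣ d - 1 → ψ d = 1)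
    {p : ℕ} [Fact p.Prime] [NeZero (p ^ 2)] (hpN : IsCoprime (p : ℤ) N)
    (hψp : ∀ j : ℕ, ψ (p + j * N) = ψ p)
    {u : (ZMod a)ˣ} (hu : (u : ZMod a) = p) {z : ℍ} {w : ZMod (p ^ 2) → ℍ}
    (hw : ∀ t, (w t : ℂ) = (z + t.val) / (p : ℂ) ^ 2) {w' : ZMod p → ℍ}
    (hw' : ∀ j, (w' j : ℂ) = z - j.val / p) {w'' : ℍ} (hw'' : (w'' : ℂ) = (p : ℂ) ^ 2 * z) :
    hecke k N a ψ (p ^ 2) (θ 1) z = ((((p ^ 2 : ℕ) : ℝ) ^ ((k : ℝ) / 4 - 1) : ℝ) : ℂ) *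
      ((((p : ℂ) ^ (1 / 2 : ℂ)) ^ k)⁻¹ * ∑ t, θ 1 (w t) +
        (∑ j : ZMod p, ψ p * ((epsilon p)⁻¹ * (J(-j.val | p) : ℂ)) ^ k * θ u⁻¹ (w' j) +
          ψ ((p : ℤ) ^ 2) * ((p : ℂ) ^ (1 / 2 : ℂ)) ^ k * θ (u ^ 2)⁻¹ w'')) := by
  have hp : p.Prime := Fact.out
  have hN0 : (N : ZMod p) ≠ 0 := by
    have : IsUnit ((N : ℤ) : ZMod p) := (ZMod.coe_int_isUnit_iff_isCoprime _ _).mpr hpN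
    simpa using this.ne_zero
  -- For `j ≠ 0` this choice makes `y + xj` divisible by `p`, as `slash_xi_lowerRep` demands; for `j
  -- = 0` the convention `0⁻¹ = 0` makes `x` divisible by `p`.
  choose x y hxy hx using fun j : ZMod p => exists_representative hpN ((N : ZMod p) * j)⁻¹
  rw [h.hecke_eq ha hψ]
  simp_rw [fun χ => shimuraHecke_eq_of_isCoprime hN hpN (h.slash_charComponent ha hψ1 χ) hxy hx z]
  rw [← Finset.mul_sum, Finset.sum_add_distrib, Finset.sum_comm]
  congr 2
  · rw [Finset.mul_sum]
    refine Finset.sum_congr rfl fun t _ => ?_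
    simp_rw [fun χ => slash_xi_translate (k := k) p (charComponent θ χ) (t.val : ℤ) (z := z)
      (w := w t) (by rw [hw]; push_cast; rfl)]
    rw [← Finset.mul_sum]
    have := sum_mul_charComponent θ 1 (w t)
    simp only [Units.val_one, map_one, one_mul, inv_one] at this
    rw [this]
  -- On the right the term `j = 0` vanishes with its symbol, as `k ≠ 0`; on the left the index `0`
  -- is the representative that gives `z ↦ p²z`.
  · rw [Finset.sum_comm, ← Finset.add_sum_erase _ _ (Finset.mem_univ (0 : ZMod p)),
      ← Finset.add_sum_erase (a := (0 : ZMod p)) Finset.univ (fun j => ψ p * _ * θ u⁻¹ (w' j))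
        (Finset.mem_univ _), add_comm]
    have h0 : J(-((0 : ZMod p).val : ℤ) | p) = 0 := by
      rw [ZMod.val_zero]
      simp [jacobiSym.zero_left hp.one_lt]
    rw [h0, Int.cast_zero, mul_zero, zero_pow hk, mul_zero, zero_mul, zero_add]
    congr 1
    · refine Finset.sum_congr rfl fun j hj => ?_
      have hj0 : j ≠ 0 := (Finset.mem_erase.mp hj).1
      obtain ⟨b, hb⟩ : (p : ℤ) ∣ y j + x j * j.val := by
        rw [← ZMod.intCast_zmod_eq_zero_iff_dvd]
        push_cast
        rw [ZMod.natCast_zmod_val, hx]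
        have h2 := congrArg (Int.cast : ℤ → ZMod p) (hxy j)
        push_cast at h2
        rw [CharP.cast_eq_zero, zero_mul, zero_sub] at h2
        refine (mul_eq_zero.mp ?_).resolve_left hN0
        have h3 := mul_inv_cancel₀ (mul_ne_zero hN0 hj0)
        linear_combination h3 - h2
      have h5 : ∀ χ : DirichletCharacter ℂ a, slash k (charComponent θ χ)
          ((xi (p ^ 2)).comp (lift (lowerRep p N (x j) (y j) (hxy j)))) z =
          ψ p * ((epsilon p)⁻¹ * (J(-j.val | p) : ℂ)) ^ k *
            (χ (u : ZMod a) * charComponent θ χ (w' j)) := by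
        intro χ
        rw [slash_xi_lowerRep (ω := fun d => χ (d : ZMod a) * ψ d) hN (NeZero.pos N) hpN (h.isModularForm_charComponent ha χ).slash_eq
          (hxy j) hb.symm (hw' j), hψp, hu]
        have : (((p : ℤ) + j.val * N : ℤ) : ZMod a) = p := by
          have h6 : ((N : ℕ) : ZMod a) = 0 := (ZMod.natCast_eq_zero_iff _ _).mpr ha
          push_cast
          rw [h6, mul_zero, add_zero]
        rw [this]
        ring
      simp_rw [h5]
      rw [← Finset.mul_sum, sum_mul_charComponent]
    · obtain ⟨x', hx'⟩ : (p : ℤ) ∣ x 0 := by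
        rw [← ZMod.intCast_zmod_eq_zero_iff_dvd, hx]
        simp
      have h5 : ∀ χ : DirichletCharacter ℂ a, slash k (charComponent θ χ)
          ((xi (p ^ 2)).comp (lift (lowerRep p N (x 0) (y 0) (hxy 0)))) z =
          ψ ((p : ℤ) ^ 2) * ((p : ℂ) ^ (1 / 2 : ℂ)) ^ k *
            (χ ((u ^ 2 : (ZMod a)ˣ) : ZMod a) * charComponent θ χ w'') := by
        intro χ
        rw [slash_xi_lowerRep_of_dvd (ω := fun d => χ (d : ZMod a) * ψ d) hN hpN (h.isModularForm_charComponent ha χ).slash_eq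
          (hxy 0) hx' hw'', Units.val_pow_eq_pow_val, hu]
        push_cast
        ring
      simp_rw [h5]
      rw [← Finset.mul_sum, sum_mul_charComponent]

end Family

end HeckeEval

/-! ### Fourier expansions -/

section Fourier

/-- Averaging over the translations `t/m` kills, by orthogonality of additive characters, all
exponents not divisible by `m`. -/
theorem hasSum_sum_div {m : ℕ} [NeZero m] {r : ℕ → ℂ} {f : ℍ → ℂ}
    (hf : ∀ w : ℍ, HasSum (fun n : ℕ => r n * Complex.exp (2 * Real.pi * Complex.I * n * (w : ℂ)))
      (f w)) {z : ℍ} {w : ZMod m → ℍ} (hw : ∀ t, (w t : ℂ) = (z + t.val) / m) :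
    HasSum (fun n : ℕ => m * r (m * n) * Complex.exp (2 * Real.pi * Complex.I * n * (z : ℂ)))
      (∑ t, f (w t)) := by
  have hm : (m : ℂ) ≠ 0 := by exact_mod_cast NeZero.ne m
  have h1 : HasSum (fun n : ℕ => ∑ t, r n * Complex.exp (2 * Real.pi * Complex.I * n * (w t : ℂ)))
      (∑ t, f (w t)) := hasSum_sum fun t _ => hf (w t)
  have h2 : ∀ n : ℕ, ∑ t, r n * Complex.exp (2 * Real.pi * Complex.I * n * (w t : ℂ)) =
      r n * Complex.exp (2 * Real.pi * Complex.I * n * ((z : ℂ) / m)) *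
        (if (n : ZMod m) = 0 then (m : ℂ) else 0) := by
    intro n
    have h3 := AddChar.sum_mulShift (n : ZMod m) (ZMod.isPrimitive_stdAddChar m)
    rw [ZMod.card] at h3
    rw [apply_ite (Nat.cast : ℕ → ℂ), Nat.cast_zero] at h3
    rw [← h3, Finset.mul_sum]
    refine Finset.sum_congr rfl fun t _ => ?_
    have h4 : t * (n : ZMod m) = (((t.val * n : ℕ) : ℤ) : ZMod m) := by
      push_cast; rw [ZMod.natCast_zmod_val]
    rw [h4, ZMod.stdAddChar_coe, mul_assoc (r n), ← Complex.exp_add, hw]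
    congr 2
    push_cast
    field_simp
  have hinj : Function.Injective (fun n : ℕ => m * n) := fun a b hab =>
    Nat.eq_of_mul_eq_mul_left (NeZero.pos m) hab
  rw [← hinj.hasSum_iff] at h1
  · convert! h1 using 1
    funext n
    rw [Function.comp_apply, h2, if_pos (by push_cast; simp)]
    push_cast
    rw [mul_comm (_ * _) (m : ℂ), ← mul_assoc]
    congr 2
    field_simp
  · intro n hn
    rw [h2, if_neg, mul_zero]
    intro h
    rw [ZMod.natCast_eq_zero_iff] at h
    obtain ⟨c, rfl⟩ := h
    exact hn ⟨c, rfl⟩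

/-- In each coefficient the sum over `j` is, after `j ↦ -j`, the Gauss sum twisted by `n`, which
equals `(n/p)` times the untwisted one; this holds also for `p ∣ n`, where both vanish. -/
theorem hasSum_sum_jacobiSym {p : ℕ} [Fact p.Prime] (hp : p ≠ 2) {r : ℕ → ℂ} {f : ℍ → ℂ}
    (hf : ∀ w : ℍ, HasSum (fun n : ℕ => r n * Complex.exp (2 * Real.pi * Complex.I * n * (w : ℂ)))
      (f w)) {z : ℍ} {w : ZMod p → ℍ} (hw : ∀ j, (w j : ℂ) = z - j.val / p) :
    HasSum (fun n : ℕ => J(n | p) * primeGaussSum p * r n *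
      Complex.exp (2 * Real.pi * Complex.I * n * (z : ℂ))) (∑ j, (J(-j.val | p) : ℂ) * f (w j)) := by
  have hp0 : (p : ℂ) ≠ 0 := by exact_mod_cast (Fact.out : p.Prime).ne_zero
  have h1 : HasSum (fun n : ℕ => ∑ j, (J(-j.val | p) : ℂ) * (r n *
      Complex.exp (2 * Real.pi * Complex.I * n * (w j : ℂ)))) (∑ j, (J(-j.val | p) : ℂ) * f (w j)) :=
    hasSum_sum fun j _ => (hf (w j)).mul_left _
  convert! h1 using 1
  funext n
  have h2 := sum_quadChar_mul_stdAddChar p hp (n : ZMod p)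
  have h3 : quadChar p (n : ZMod p) = (J(n | p) : ℂ) := by
    rw [← quadChar_intCast]; push_cast; rfl
  rw [← h3, ← h2, ← Equiv.sum_comp (Equiv.neg (ZMod p)), Finset.sum_mul, Finset.sum_mul]
  refine Finset.sum_congr rfl fun j _ => ?_
  have h4 : (J(-j.val | p) : ℂ) = quadChar p (-j) := by
    rw [← quadChar_intCast]; push_cast; rw [ZMod.natCast_zmod_val]
  have h5 : (n : ZMod p) * -j = ((-(n * j.val : ℤ) : ℤ) : ZMod p) := by
    push_cast; rw [ZMod.natCast_zmod_val]; ring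
  rw [Equiv.neg_apply, h4, h5, ZMod.stdAddChar_coe, hw]
  have h6 : Complex.exp (2 * Real.pi * Complex.I * n * ((z : ℂ) - j.val / p)) =
      Complex.exp (2 * Real.pi * Complex.I * ((-(n * j.val : ℤ) : ℤ) : ℂ) / p) *
        Complex.exp (2 * Real.pi * Complex.I * n * (z : ℂ)) := by
    rw [← Complex.exp_add]
    congr 1
    push_cast
    field_simp
    ring
  rw [h6]
  ring

theorem hasSum_mul_natCast {m : ℕ} [NeZero m] {r r' : ℕ → ℂ} {f : ℍ → ℂ}
    (hf : ∀ w : ℍ, HasSum (fun n : ℕ => r n * Complex.exp (2 * Real.pi * Complex.I * n * (w : ℂ)))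
      (f w)) (hr : ∀ n, r' (m * n) = r n) (hr0 : ∀ n, ¬ m ∣ n → r' n = 0) {z w : ℍ}
    (hw : (w : ℂ) = m * z) :
    HasSum (fun n : ℕ => r' n * Complex.exp (2 * Real.pi * Complex.I * n * (z : ℂ))) (f w) := by
  have hinj : Function.Injective (fun n : ℕ => m * n) := fun a b hab =>
    Nat.eq_of_mul_eq_mul_left (NeZero.pos m) hab
  rw [← hinj.hasSum_iff]
  · convert! hf w using 1
    funext n
    rw [Function.comp_apply, hr, hw]
    congr 2
    push_cast
    ring
  · intro n hn
    rw [hr0, zero_mul]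
    rintro ⟨c, rfl⟩
    exact hn ⟨c, rfl⟩

end Fourier

/-! ### Normalizing constants -/

section Constants

/-- Shimura's normalization is chosen so that the `p²` translations together contribute the
coefficient at `p²n` with weight exactly `1`. -/
theorem hecke_constant (k p : ℕ) (hp : p ≠ 0) :
    ((((p ^ 2 : ℕ) : ℝ) ^ ((k : ℝ) / 4 - 1) : ℝ) : ℂ) * (p : ℂ) ^ 2 =
      ((p : ℂ) ^ (1 / 2 : ℂ)) ^ k := by
  have hp' : (0 : ℝ) < p := by exact_mod_cast Nat.pos_of_ne_zero hp
  have h1 : (p : ℂ) ^ (1 / 2 : ℂ) = (((p : ℝ) ^ (1 / 2 : ℝ) : ℝ) : ℂ) := by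
    rw [Complex.ofReal_cpow hp'.le]; norm_num
  rw [h1]
  norm_cast
  push_cast
  rw [← Real.rpow_natCast (p : ℝ) 2, ← Real.rpow_mul hp'.le, ← Real.rpow_add hp',
    ← Real.rpow_natCast, ← Real.rpow_mul hp'.le]
  congr 1
  push_cast
  ring

/-- One factor `ε_p` from the Gauss sum leaves an even power of `ε_p⁻¹`, and `ε_p⁻² = (-1/p)`. -/
theorem epsilon_pow_inv_mul {p : ℕ} (hp : Odd p) (l : ℕ) :
    ((epsilon p)⁻¹) ^ (2 * l + 1) * epsilon p = (kronecker (-1) p : ℂ) ^ l := by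
  have h1 : ((epsilon p)⁻¹) ^ 2 = (kronecker (-1) p : ℂ) := by
    rw [kronecker_natCast_right _ hp, jacobiSym.at_neg_one hp, inv_pow, epsilon_sq]
    rcases Nat.odd_mod_four_iff.mp (Nat.odd_iff.mp hp) with h4 | h4
    · rw [ZMod.χ₄_nat_one_mod_four h4, if_pos (by omega)]; simp
    · rw [ZMod.χ₄_nat_three_mod_four h4, if_neg (by omega)]; norm_num
  rw [pow_succ, pow_mul, h1, mul_assoc, inv_mul_cancel₀ (epsilon_ne_zero _), mul_one]

theorem jacobiSym_pow_of_odd {k : ℕ} (hk : Odd k) (a : ℤ) (b : ℕ) : J(a | b) ^ k = J(a | b) := by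
  obtain ⟨l, rfl⟩ := hk
  rcases jacobiSym.trichotomy a b with h | h | h <;> rw [h] <;> simp [pow_succ, pow_mul]

end Constants

/-! ### Fourier coefficients of the image under the Hecke operators -/

section FamilyFourier

variable {k N a : ℕ} [NeZero a] {ψ : ℤ → ℂ} {θ : (ZMod a)ˣ → ℍ → ℂ} {r : (ZMod a)ˣ → ℕ → ℂ}

theorem exists_coe_eq_add_div (m : ℕ) [NeZero m] (z : ℍ) (t : ℕ) :
    ∃ w : ℍ, (w : ℂ) = (z + t) / m :=
  ⟨(xi m).1 • (translate t • z), by rw [xi_smul_coe, translate_smul_coe]; push_cast; rfl⟩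

theorem ThetaFamily.hasSum_hecke_of_dvd (h : ThetaFamily k N a ψ θ) [NeZero N] (ha : a ∣ N)
    (hN : 4 ∣ N) (hψ : ∀ d : ℤ, IsCoprime (N : ℤ) d → ψ d ≠ 0)
    (hψ1 : ∀ d : ℤ, (N : ℤ) ∣ d - 1 → ψ d = 1) {p : ℕ} (hp : p.Prime) [NeZero (p ^ 2)]
    (hpN : p ∣ N) (hr : ∀ (u : (ZMod a)ˣ) (w : ℍ), HasSum (fun n : ℕ => r u n *
      Complex.exp (2 * Real.pi * Complex.I * n * (w : ℂ))) (θ u w)) (z : ℍ) :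
    HasSum (fun n : ℕ => r 1 (p ^ 2 * n) * Complex.exp (2 * Real.pi * Complex.I * n * (z : ℂ)))
      (hecke k N a ψ (p ^ 2) (θ 1) z) := by
  choose w hw using fun t : ZMod (p ^ 2) => exists_coe_eq_add_div (p ^ 2) z t.val
  have hp0 : (p : ℂ) ≠ 0 := by exact_mod_cast hp.ne_zero
  rw [h.hecke_eq_of_dvd ha hN hψ hψ1 hp hpN (fun t => by rw [hw t]; push_cast; rfl)]
  have h1 := (hasSum_sum_div (hr 1) hw).mul_left (((((p ^ 2 : ℕ) : ℝ) ^ ((k : ℝ) / 4 - 1) : ℝ) : ℂ) *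
      (((p : ℂ) ^ (1 / 2 : ℂ)) ^ k)⁻¹)
  rw [← mul_assoc]
  convert! h1 using 1
  funext n
  have h2 := hecke_constant k p hp.ne_zero
  have h3 := pow_ne_zero k (cpow_half_ne_zero hp0)
  have h4 : (((((p ^ 2 : ℕ) : ℝ) ^ ((k : ℝ) / 4 - 1) : ℝ) : ℂ) *
      (((p : ℂ) ^ (1 / 2 : ℂ)) ^ k)⁻¹) * ((p ^ 2 : ℕ) : ℂ) = 1 := by
    rw [mul_right_comm]
    push_cast at h2 ⊢
    rw [h2, mul_inv_cancel₀ h3]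
  rw [mul_assoc _ (r 1 _), ← mul_assoc _ ((p ^ 2 : ℕ) : ℂ), h4, one_mul]

theorem ThetaFamily.hasSum_hecke_of_isCoprime (h : ThetaFamily k N a ψ θ) [NeZero N] (ha : a ∣ N)
    (hN : 4 ∣ N) (hk : 3 ≤ k) (hodd : Odd k) (hψ : ∀ d : ℤ, IsCoprime (N : ℤ) d → ψ d ≠ 0)
    (hψ1 : ∀ d : ℤ, (N : ℤ) ∣ d - 1 → ψ d = 1) {p : ℕ} [Fact p.Prime] [NeZero (p ^ 2)] (hp2 : p ≠ 2)
    (hpN : IsCoprime (p : ℤ) N) (hψp : ∀ j : ℕ, ψ (p + j * N) = ψ p)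
    {u : (ZMod a)ˣ} (hu : (u : ZMod a) = p)
    (hr : ∀ (u : (ZMod a)ˣ) (w : ℍ), HasSum (fun n : ℕ => r u n *
      Complex.exp (2 * Real.pi * Complex.I * n * (w : ℂ))) (θ u w)) {r' : ℕ → ℂ}
    (hr' : ∀ n, r' (p ^ 2 * n) = r (u ^ 2)⁻¹ n) (hr0 : ∀ n, ¬ p ^ 2 ∣ n → r' n = 0) (z : ℍ) :
    HasSum (fun n : ℕ => (r 1 (p ^ 2 * n) +
        (kronecker (-1) p : ℂ) ^ ((k - 1) / 2) * (ψ p * J(n | p)) * (p : ℂ) ^ ((k - 1) / 2 - 1) *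
          r u⁻¹ n + ψ ((p : ℤ) ^ 2) * (p : ℂ) ^ (k - 2) * r' n) *
        Complex.exp (2 * Real.pi * Complex.I * n * (z : ℂ)))
      (hecke k N a ψ (p ^ 2) (θ 1) z) := by
  have hp : p.Prime := Fact.out
  have hp0 : (p : ℂ) ≠ 0 := by exact_mod_cast hp.ne_zero
  have hpodd := hp.odd_of_ne_two hp2
  choose w hw using fun t : ZMod (p ^ 2) => exists_coe_eq_add_div (p ^ 2) z t.val
  obtain ⟨w', hw'⟩ : ∃ w' : ZMod p → ℍ, ∀ j, (w' j : ℂ) = z - j.val / p :=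
    ⟨fun j => (-(j.val / p : ℝ)) +ᵥ z, fun j => by
      rw [UpperHalfPlane.coe_vadd]; push_cast; ring⟩
  obtain ⟨w'', hw''⟩ : ∃ w'' : ℍ, (w'' : ℂ) = (p : ℂ) ^ 2 * z := by
    have h2 : 0 < ((((p : ℝ) ^ 2 : ℝ) : ℂ) * (z : ℂ)).im := by
      rw [Complex.im_ofReal_mul]
      have : (0 : ℝ) < p := by exact_mod_cast hp.pos
      have := z.im_pos
      positivity
    exact ⟨⟨_, h2⟩, by push_cast; rfl⟩
  rw [h.hecke_eq_of_isCoprime ha hN (by omega) hψ hψ1 hpN hψp hu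
    (fun t => by rw [hw t]; push_cast; rfl) hw' hw'']
  set C : ℂ := ((((p ^ 2 : ℕ) : ℝ) ^ ((k : ℝ) / 4 - 1) : ℝ) : ℂ) with hC
  set P : ℂ := (p : ℂ) ^ (1 / 2 : ℂ) with hP
  have hP0 : P ≠ 0 := cpow_half_ne_zero hp0
  have hP2 : P ^ 2 = p := sqrt_sq _
  have hCk : C * (p : ℂ) ^ 2 = P ^ k := hecke_constant k p hp.ne_zero
  obtain ⟨l, rfl⟩ := hodd
  -- Now `k = 2λ + 1` with `λ = l + 1 ≥ 1`, so the subtractions in the exponents `λ - 1` and `k - 2`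
  -- are genuine.
  obtain ⟨l, rfl⟩ : ∃ l', l = l' + 1 := ⟨l - 1, by omega⟩
  have e1 : (2 * (l + 1) + 1 - 1) / 2 = l + 1 := by omega
  have e2 : l + 1 - 1 = l := by omega
  have e3 : 2 * (l + 1) + 1 - 2 = 2 * l + 1 := by omega
  rw [e1, e2, e3]
  -- The normalization `p^{k/2 - 2}` times the `√p` of the Gauss sum is `p^{λ - 1}`; below, times
  -- the `p^{k/2}` of the last representative, it is `p^{k - 2}`.
  have hCP : C * P = (p : ℂ) ^ l := by
    apply mul_right_cancel₀ (pow_ne_zero 2 hp0)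
    rw [mul_right_comm, hCk, ← hP2]
    ring
  have hCPk : C * P ^ (2 * (l + 1) + 1) = (p : ℂ) ^ (2 * l + 1) := by
    apply mul_right_cancel₀ (pow_ne_zero 2 hp0)
    rw [mul_right_comm, hCk, ← hP2]
    ring
  have hCPi : C * (P ^ (2 * (l + 1) + 1))⁻¹ * (p : ℂ) ^ 2 = 1 := by
    rw [mul_right_comm, hCk, mul_inv_cancel₀ (pow_ne_zero _ hP0)]
  have h1 := ((hasSum_sum_div (hr 1) hw).mul_left (P ^ (2 * (l + 1) + 1))⁻¹)
  have h2 := (hasSum_sum_jacobiSym hp2 (hr u⁻¹) hw').mul_left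
    (ψ p * ((epsilon p)⁻¹) ^ (2 * (l + 1) + 1))
  have h3 := (hasSum_mul_natCast (hr (u ^ 2)⁻¹) hr' hr0 (w := w'') (z := z)
    (by rw [hw'']; push_cast; rfl)).mul_left (ψ ((p : ℤ) ^ 2) * P ^ (2 * (l + 1) + 1))
  have h4 := (h1.add (h2.add h3)).mul_left C
  have hJ : ∀ j : ZMod p, ψ p * ((epsilon p)⁻¹ * (J(-j.val | p) : ℂ)) ^ (2 * (l + 1) + 1) *
      θ u⁻¹ (w' j) = ψ p * ((epsilon p)⁻¹) ^ (2 * (l + 1) + 1) *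
        ((J(-j.val | p) : ℂ) * θ u⁻¹ (w' j)) := by
    intro j
    have h5 : (J(-j.val | p) : ℂ) ^ (2 * (l + 1) + 1) = J(-j.val | p) := by
      exact_mod_cast jacobiSym_pow_of_odd ⟨l + 1, rfl⟩ (-j.val) p
    rw [mul_pow, h5]
    ring
  rw [Finset.sum_congr rfl fun j _ => hJ j, ← Finset.mul_sum]
  convert! h4 using 1
  funext n
  have hG := primeGaussSum_eq p hp2
  rw [← hP] at hG
  have hE := epsilon_pow_inv_mul hpodd (l + 1)
  rw [hG, ← hE, ← hCP, ← hCPk]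
  push_cast
  linear_combination (-(r 1 (p ^ 2 * n) *
    Complex.exp (2 * Real.pi * Complex.I * n * (z : ℂ)))) * hCPi

end FamilyFourier

/-! ### Representation numbers of cosets indexed by units -/

section LatticeFourier

variable {V : Type*} [AddCommGroup V] [Module ℚ V] {B : LinearMap.BilinForm ℚ V}
  {L : Submodule ℤ V} {k : ℕ}

theorem latticeCoset_cast_smul {a : ℕ} {ν : V} (hν : ν ∈ L) {v : ZMod a} {s : ℤ}
    (h : (s : ZMod a) = v) : latticeCoset L a ((v.cast : ℤ) • ν) = latticeCoset L a (s • ν) := by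
  refine latticeCoset_zsmul_congr hν ?_
  rw [← ZMod.intCast_zmod_eq_zero_iff_dvd]
  push_cast
  rw [h, sub_self]

theorem repNum_div_eq_zero (hint : IsIntegralLattice B L) {S : Set V} (hS : S ⊆ L) {m n : ℕ}
    (hm : m ≠ 0) (h : ¬ m ∣ n) : repNum B S ((n : ℚ) / m) = 0 := by
  have h0 : {x ∈ S | B x x = (n : ℚ) / m} = ∅ := by
    rw [Set.eq_empty_iff_forall_notMem]
    rintro x ⟨hx, hxn⟩
    obtain ⟨t, ht⟩ := hint x (hS hx) x (hS hx)
    have hm' : (m : ℚ) ≠ 0 := by exact_mod_cast hm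
    rw [ht, eq_div_iff hm'] at hxn
    have h1 : t * (m : ℤ) = n := by exact_mod_cast hxn
    exact h (by exact_mod_cast (Dvd.intro_left t h1 : (m : ℤ) ∣ n))
  rw [repNum, h0, Set.ncard_empty]

end LatticeFourier

end LatticeCosetHecke

/-! ### The Hecke action on theta series of lattice cosets -/

theorem mainTheorem3 {V : Type*} [AddCommGroup V] [Module ℚ V]
    (B : LinearMap.BilinForm ℚ V) (hsymm : B.IsSymm) (hpos : ∀ x : V, x ≠ 0 → 0 < B x x)
    (L : Submodule ℤ V) (hL : L.IsLattice ℚ) (hint : IsIntegralLattice B L)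
    (k : ℕ) (hk : 3 ≤ k) (hodd : Odd k) (e : Module.Basis (Fin k) ℤ L)
    (a : ℕ) (ha : 0 < a) (ν : V) (hν : ν ∈ L) (hcond : HasConductor L a ν a)
    (p : ℕ) [Fact p.Prime]
    (N : ℕ) (hN : N = 4 * level B e * a ^ 2)
    (ψ : ℤ → ℂ) (hψ : ∀ m : ℤ, ψ m = kronecker (4 * discr B e) m) :
    IsModularForm k (CongruenceSubgroup.Gamma0 N ⊓ CongruenceSubgroup.Gamma1 a) ψ
      (theta B (latticeCoset L a ν)) ∧
    (∃! F, IsCharDecomp k N a ψ (theta B (latticeCoset L a ν)) F) ∧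
    ∃ b : ℕ → ℂ,
      (∀ z : ℍ, HasSum (fun n : ℕ => b n * Complex.exp (2 * Real.pi * Complex.I * n * (z : ℂ)))
        (hecke k N a ψ (p ^ 2) (theta B (latticeCoset L a ν)) z)) ∧
      (p ∣ N → ∀ n : ℕ, b n = repNum B (latticeCoset L a ν) ((p : ℚ) ^ 2 * n)) ∧
      (¬ p ∣ N → ∀ pbar : ℤ, (p : ℤ) * pbar ≡ 1 [ZMOD a] → ∀ n : ℕ,
        b n = repNum B (latticeCoset L a ν) ((p : ℚ) ^ 2 * n)
          + (kronecker (-1) p : ℂ) ^ ((k - 1) / 2) * (kronecker (4 * discr B e * n) p : ℂ)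
              * (p : ℂ) ^ ((k - 1) / 2 - 1) * repNum B (latticeCoset L a (pbar • ν)) n
          + (kronecker (4 * discr B e) ((p : ℤ) ^ 2) : ℂ) * (p : ℂ) ^ (k - 2)
              * repNum B (latticeCoset L a (pbar ^ 2 • ν)) ((n : ℚ) / (p : ℚ) ^ 2)) := by
  obtain rfl : ψ = fun m => (kronecker (4 * discr B e) m : ℂ) := funext hψ
  subst hN
  have hl := (level_spec hsymm hpos hint e).1
  have : NeZero a := ⟨ha.ne'⟩
  have : NeZero (4 * level B e * a ^ 2) := ⟨by positivity⟩
  have hp : p.Prime := Fact.out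
  have haN : a ∣ 4 * level B e * a ^ 2 := ⟨4 * level B e * a, by ring⟩
  have h4N : 4 ∣ 4 * level B e * a ^ 2 := ⟨level B e * a ^ 2, by ring⟩
  have hlN : ((4 * level B e : ℕ) : ℤ) ∣ ((4 * level B e * a ^ 2 : ℕ) : ℤ) :=
    ⟨a ^ 2, by push_cast; ring⟩
  have hodd' : ∀ d : ℤ, IsCoprime ((4 * level B e * a ^ 2 : ℕ) : ℤ) d → Odd d := fun d hd =>
    Int.isCoprime_two_left.mp (hd.of_isCoprime_of_dvd_left
      ⟨2 * level B e * a ^ 2, by push_cast; ring⟩)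
  have hcop : ∀ d : ℤ, IsCoprime ((4 * level B e * a ^ 2 : ℕ) : ℤ) d →
      IsCoprime (level B e : ℤ) d := fun d hd =>
    hd.of_isCoprime_of_dvd_left ⟨4 * a ^ 2, by push_cast; ring⟩
  have hψ0 : ∀ d : ℤ, IsCoprime ((4 * level B e * a ^ 2 : ℕ) : ℤ) d →
      (kronecker (4 * discr B e) d : ℂ) ≠ 0 := by
    intro d hd h0
    have h1 := kronecker_sq (hodd' d hd)
      (isCoprime_four_discr hsymm hpos hint e (hodd' d hd) (hcop d hd))
    rw [Int.cast_eq_zero.mp h0] at h1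
    norm_num at h1
  have hper : ∀ d d' : ℤ, IsCoprime ((4 * level B e * a ^ 2 : ℕ) : ℤ) d →
      ((4 * level B e * a ^ 2 : ℕ) : ℤ) ∣ d - d' →
      (kronecker (4 * discr B e) d : ℂ) = kronecker (4 * discr B e) d' := by
    intro d d' hd h
    rw [kronecker_four_discr_periodic hsymm hpos hint e (hodd' d hd) (hcop d hd)
      (by exact_mod_cast hlN.trans h)]
  have hψ1 : ∀ d : ℤ, ((4 * level B e * a ^ 2 : ℕ) : ℤ) ∣ d - 1 →
      (kronecker (4 * discr B e) d : ℂ) = 1 := by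
    intro d hd
    rw [← hper 1 d isCoprime_one_right (by rwa [← dvd_neg, neg_sub]),
      kronecker_of_odd _ odd_one]
    simp
  have hF := thetaFamily_theta hsymm hpos hint e ha.ne' hν
  set θ : (ZMod a)ˣ → ℍ → ℂ :=
    fun u => theta B (latticeCoset L a (((u : ZMod a).cast : ℤ) • ν)) with hθ
  have hcoset1 : latticeCoset L a ((((1 : (ZMod a)ˣ) : ZMod a).cast : ℤ) • ν) =
      latticeCoset L a ν := by
    rw [latticeCoset_cast_smul hν (s := 1) (by simp), one_smul]
  have hθ1 : θ 1 = theta B (latticeCoset L a ν) := by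
    rw [hθ]
    simp only [hcoset1]
  have hr : ∀ (u : (ZMod a)ˣ) (w : ℍ), HasSum
      (fun n : ℕ => (repNum B (latticeCoset L a (((u : ZMod a).cast : ℤ) • ν)) n : ℂ) *
        Complex.exp (2 * Real.pi * Complex.I * n * (w : ℂ))) (θ u w) := fun u w =>
    hasSum_theta hsymm hpos hint e ha.ne' (L.smul_mem _ hν) w
  rw [← hθ1]
  refine ⟨hF.isModularForm, ⟨charComponent θ, hF.isCharDecomp haN, fun G hG =>
    hF.unique haN hψ0 hG⟩, ?_⟩
  by_cases hpN : p ∣ 4 * level B e * a ^ 2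
  · refine ⟨fun n => repNum B (latticeCoset L a ν) ((p : ℚ) ^ 2 * n), fun z => ?_,
      fun _ n => rfl, fun h => absurd hpN h⟩
    have h1 := hF.hasSum_hecke_of_dvd haN h4N hψ0 hψ1 hp hpN hr z
    rw [hcoset1] at h1
    convert! h1 using 1
    push_cast
    rfl
  · have hpN' : IsCoprime (p : ℤ) ((4 * level B e * a ^ 2 : ℕ) : ℤ) :=
      Nat.isCoprime_iff_coprime.mpr ((Nat.Prime.coprime_iff_not_dvd hp).mpr hpN)
    have hp2 : p ≠ 2 := by
      rintro rfl
      exact hpN ⟨2 * level B e * a ^ 2, by ring⟩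
    have hpodd := hp.odd_of_ne_two hp2
    have hua : IsUnit ((p : ℤ) : ZMod a) := by
      rw [ZMod.coe_int_isUnit_iff_isCoprime]
      exact hpN'.symm.of_isCoprime_of_dvd_left (by exact_mod_cast haN)
    obtain ⟨u, hu⟩ := hua
    rw [Int.cast_natCast] at hu
    -- Every admissible `p̄` represents the inverse of the unit `p` modulo `a`. Hence one
    -- coefficient sequence, defined through `u⁻¹`, serves all choices of `p̄`.
    have hpbar : ∀ q : ℤ, (p : ℤ) * q ≡ 1 [ZMOD a] → (q : ZMod a) = (u⁻¹ : (ZMod a)ˣ) := by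
      intro q hq
      have h1 := (ZMod.intCast_eq_intCast_iff _ _ a).mpr hq
      push_cast at h1
      rw [← hu] at h1
      exact (Units.inv_eq_of_mul_eq_one_right h1).symm
    set S₁ := latticeCoset L a ((((u⁻¹ : (ZMod a)ˣ) : ZMod a).cast : ℤ) • ν) with hS₁
    set S₂ := latticeCoset L a (((((u ^ 2)⁻¹ : (ZMod a)ˣ) : ZMod a).cast : ℤ) • ν) with hS₂
    have hpp0 : p ^ 2 ≠ 0 := pow_ne_zero _ hp.ne_zero
    refine ⟨_, fun z => hF.hasSum_hecke_of_isCoprime haN h4N hk hodd hψ0 hψ1 hp2 hpN'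
      (fun j => (hper _ _ hpN'.symm ⟨-j, by ring⟩).symm) hu hr
      (r' := fun n => (repNum B S₂ ((n : ℚ) / ((p ^ 2 : ℕ) : ℚ)) : ℂ)) ?_ ?_ z,
      fun h => absurd h hpN, ?_⟩
    · intro n
      have hpp : ((p ^ 2 : ℕ) : ℚ) ≠ 0 := by exact_mod_cast hpp0
      rw [Nat.cast_mul, mul_div_cancel_left₀ _ hpp]
    · intro n hn
      rw [repNum_div_eq_zero hint (latticeCoset_subset (L.smul_mem _ hν)) hpp0 hn, Nat.cast_zero]
    · intro _ q hq n
      have h1 : latticeCoset L a (q • ν) = S₁ := (latticeCoset_cast_smul hν (hpbar q hq)).symm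
      have h2 : latticeCoset L a (q ^ 2 • ν) = S₂ := by
        refine (latticeCoset_cast_smul hν ?_).symm
        push_cast
        rw [hpbar q hq, ← Units.val_pow_eq_pow_val, inv_pow]
      have h3 : kronecker (4 * discr B e * n) p = kronecker (4 * discr B e) p * J(n | p) := by
        rw [kronecker_natCast_right _ hpodd, kronecker_natCast_right _ hpodd, jacobiSym.mul_left]
      rw [h1, h2, h3, ← hS₁, hcoset1]
      push_cast
      rfl
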